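/- Let $u>0$, $\nu=\tfrac12\sqrt{1+4u}$, $\mathscr T=\,]0,\infty[\times]0,\infty[$ (points $(t,x)$), and $\mathscr H=-\tfrac12\big(\partial_x^2-\tfrac{u}{x^2}\big)$ on $x>0$. Put $$E_\nu(z)=\sum_{k\ge0}\frac{(-1)^k}{\Gamma(k+1)\Gamma(\nu+k+1)}\Big(\frac z2\Big)^{2k},\quad J_\nu(z)=\Big(\frac z2\Big)^\nu E_\nu(z),\quad G(t,x,0,x')=(-i)^{\nu+1}\frac{\sqrt{xx'}}{t}\,e^{i(x^2+x'^2)/(2t)}J_\nu\Big(\frac{xx'}t\Big)$$ (principal branches). For $\lambda\in\mathbb R$ and $(t,x)\in\mathscr T$ let $$\varphi_\lambda(t,x)=\frac{(-i)^{\nu+1}}{2^\nu}e^{ix^2/(2t)}\frac{x^{\nu+1/2}}{t^{\nu+1}}\int_0^\infty (x')^{\nu+1/2}e^{i(x')^2/(2t)}E_\nu\Big(\frac{xx'}t\Big)e^{i\lambda x'}\,dx',$$ where the integral is regularized by rotating the half-line by the angle $\pi/4$, i.e. it stands for $e^{i(\nu+3/2)\pi/4}\int_0^\infty y^{\nu+1/2}e^{-y^2/(2t)}E_\nu(e^{i\pi/4}xy/t)\,e^{i\lambda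 e^{i\pi/4}y}\,dy$. 1. For every $\lambda\in\mathbb R$: $\varphi_\lambda(t,x)=\lim_{R\to\infty}\int_0^R G(t,x,0,x')e^{i\lambda x'}dx'$ for all $(t,x)\in\mathscr T$; $\varphi_\lambda$ is $C^\infty$ on $\mathscr T$; and it solves the Cauchy problem $i\,\partial_t\varphi_\lambda=\mathscr H\varphi_\lambda$ on $\mathscr T$ with initial datum $e^{i\lambda x}$, in the sense that $\varphi_\lambda(t,x)\to e^{i\lambda x_0}$ as $t\to0^+$, $x\to x_0$, for every $x_0>0$. 2. For $a\in\mathbb R\setminus[-1,1]$ and $N\ge1$ let $\psi_N(t,x,a)=\sum_{j=0}^N C_j(N,a)\,\varphi_{1-2j/N}(t,x)$ with $C_j(N,a)=\binom Nj\big(\frac{1+a}2\big)^{N-j}\big(\frac{1-a}2\big)^j$. Then $\{\psi_N(\cdot,\cdot,a)\}_{N\ge1}$ is a supershift for the family $\{\varphi_\lambda\}_{\lambda\in\mathbb R}$ with supershift domain $\mathscr T$: each $\psi_N$ has the form $\sum_{j=0}^N C_j(N)\varphi_{k_j(N)}$ with $C_j(N)\in\mathbb C$ and $|k_j(N)|\le1$,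 and $\psi_N$ converges locally uniformly on $\mathscr T$ to a finite $\mathbb C$-linear combination of functions $\varphi_{\ell k}$, $\ell\in\mathbb Z\setminus\{0\}$, for some $k\in\mathbb R\setminus[-1,1]$. 3. For all $m,n\in\mathbb N$, on $\mathscr T$ and for all $N\ge 1$, $$\partial_t^m\partial_x^n\psi_N=\frac1{(2i)^m}\,\partial_x^n\Big(-\partial_x^2+\frac u{x^2}\Big)^m\psi_N,\qquad \partial_t^m\partial_x^n\varphi_a=\frac1{(2i)^m}\,\partial_x^n\Big(-\partial_x^2+\frac u{x^2}\Big)^m\varphi_a,$$ and, as $N\to\infty$, uniformly on every compact subset of $\mathscr T$, $$\partial_t^m\partial_x^n\psi_N\to\partial_t^m\partial_x^n\varphi_a\quad\text{and}\quad \frac1{(2i)^m}\Big(-\partial_x^2+\frac u{x^2}\Big)^m\partial_x^n\psi_N\to\frac1{(2i)^m}\Big(-\partial_x^2+\frac u{x^2}\Big)^m\partial_x^n\varphi_a .$$ In particular ($m=n=0$) $\psi_N(\cdot,\cdot,a)\to\varphi_a$ uniformly on compact subsets of $\mathscr T$. -/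

import Mathlib

open Set Filter Topology MeasureTheory

noncomputable section

namespace Centrifugal

/-! ### The regularized Fresnel integral -/

/-- The regularization of the formal integral `∫₀^∞ x^χ exp(-i ϕ x²) G(x) dx` for real `χ > -1`,
real `ϕ ≠ 0` and an entire function `G`: the half-line is rotated by the angle `-π/4` if `ϕ > 0`
and by the angle `π/4` if `ϕ < 0`, which turns the oscillating factor into a Gaussian. -/
def fresnelReg (χ ϕ : ℝ) (G : ℂ → ℂ) : ℂ :=
  if 0 < ϕ then
    Complex.exp (-(Complex.I * (χ + 1) * Real.pi / 4)) *
      ∫ y : ℝ in Ioi 0, ((y ^ χ * Real.exp (-(ϕ * y ^ 2)) : ℝ) : ℂ) *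
        G (Complex.exp (-(Complex.I * Real.pi / 4)) * y)
  else
    Complex.exp (Complex.I * (χ + 1) * Real.pi / 4) *
      ∫ y : ℝ in Ioi 0, ((y ^ χ * Real.exp (ϕ * y ^ 2) : ℝ) : ℂ) *
        G (Complex.exp (Complex.I * Real.pi / 4) * y)

/-! ### Bessel function and Green function -/

/-- The entire function
`E_ν(z) = ∑ₖ (-1)^k / (Γ(k+1) Γ(ν+k+1)) (z/2)^(2k)` (for `ν ≥ 0`). -/
def besselE (ν : ℝ) (z : ℂ) : ℂ :=
  ∑' k : ℕ, (-1) ^ k / ((Real.Gamma (k + 1) * Real.Gamma (ν + k + 1) : ℝ) : ℂ) *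
    (z / 2) ^ (2 * k)

/-- The Bessel function `J_ν(z) = (z/2)^ν E_ν(z)` of the first kind, with the principal branch
of the power. -/
def besselJ (ν : ℝ) (z : ℂ) : ℂ := (z / 2) ^ (ν : ℂ) * besselE ν z

/-- The Bessel index `ν = √(1+4u) / 2`. -/
def besselIndex (u : ℝ) : ℝ := Real.sqrt (1 + 4 * u) / 2

/-- The Green function `G(t, x, 0, x')`, for `t, x, x' > 0`, of the Schrödinger equation with
centrifugal potential `u/(2x²)`. -/
def green (u t x x' : ℝ) : ℂ :=
  (-Complex.I) ^ ((besselIndex u : ℂ) + 1) * ((Real.sqrt (x * x') / t : ℝ) : ℂ) *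
    Complex.exp (Complex.I * ((x ^ 2 + x' ^ 2) / (2 * t))) *
    besselJ (besselIndex u) ((x * x' / t : ℝ) : ℂ)

/-- The evolution of (the restriction to the half-line of) an entire datum `Y` through the Green
function, at the point `p = (t, x)` with `t, x > 0`: the regularized value of
`∫₀^∞ G(t, x, 0, x') Y(x') dx'`, where the factors of the Green function that do not depend on
`x'` are taken out of the integral. -/
def evolve (u : ℝ) (Y : ℂ → ℂ) (p : ℝ × ℝ) : ℂ :=
  (-Complex.I) ^ ((besselIndex u : ℂ) + 1) / ((2 ^ besselIndex u : ℝ) : ℂ) *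
    Complex.exp (Complex.I * (p.2 ^ 2 / (2 * p.1))) *
    ((p.2 ^ (besselIndex u + 1 / 2) / p.1 ^ (besselIndex u + 1) : ℝ) : ℂ) *
    fresnelReg (besselIndex u + 1 / 2) (-(1 / (2 * p.1)))
      (fun Z => besselE (besselIndex u) (p.2 * Z / p.1) * Y Z)

/-- `φ_λ`: the evolution of the datum `x ↦ exp(iλx)`. -/
def phi (u lam : ℝ) : ℝ × ℝ → ℂ := evolve u (fun Z => Complex.exp (Complex.I * lam * Z))

/-! ### Differential operators in the variables `(t, x)` -/

/-- `∂/∂t`. -/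
def dt (f : ℝ × ℝ → ℂ) (p : ℝ × ℝ) : ℂ := deriv (fun s : ℝ => f (s, p.2)) p.1

/-- `∂/∂x`. -/
def dx (f : ℝ × ℝ → ℂ) (p : ℝ × ℝ) : ℂ := deriv (fun y : ℝ => f (p.1, y)) p.2

/-- The operator `-∂²/∂x² + u/x²`. -/
def centrifugalOp (u : ℝ) (f : ℝ × ℝ → ℂ) (p : ℝ × ℝ) : ℂ :=
  -dx (dx f) p + u / p.2 ^ 2 * f p

/-- The Hamiltonian `-(∂²/∂x² - u/x²)/2`. -/
def hamiltonian (u : ℝ) (f : ℝ × ℝ → ℂ) (p : ℝ × ℝ) : ℂ :=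
  -(dx (dx f) p - u / p.2 ^ 2 * f p) / 2

/-- The open quadrant `]0,∞[ × ]0,∞[` of points `(t, x)`. -/
def quadrant : Set (ℝ × ℝ) := Ioi 0 ×ˢ Ioi 0

instance : LocallyCompactSpace quadrant :=
  (isOpen_Ioi.prod isOpen_Ioi : IsOpen quadrant).locallyCompactSpace

/-- `ψ` solves, on the quadrant, the Cauchy problem `i ∂ψ/∂t = H ψ`, `ψ(0, ·) = Y`. The initial
value is attained in the sense that `ψ`, extended by `Y` to `t = 0`, is continuous there when
`Y` is: `ψ(t, x) → Y(x₀)` as `t → 0+` and `x → x₀`, for every `x₀ > 0`. -/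
structure SolvesCauchy (u : ℝ) (Y : ℝ → ℂ) (ψ : ℝ × ℝ → ℂ) : Prop where
  schrodinger : ∀ p ∈ quadrant, Complex.I * dt ψ p = hamiltonian u ψ p
  initial : ∀ x₀ : ℝ, 0 < x₀ → Tendsto ψ (𝓝[>] (0 : ℝ) ×ˢ 𝓝 x₀) (𝓝 (Y x₀))

/-! ### Supershifts -/

/-- The sequence `ψ` (indexed by `N ≥ 1`) of functions on the locally compact space `T` is a
supershift for the family `φ`, with supershift domain `U`. -/
structure IsSupershift {T : Type*} [TopologicalSpace T] [LocallyCompactSpace T]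
    (φ : ℝ → T → ℂ) (ψ : ℕ → T → ℂ) (U : Set T) : Prop where
  combination : ∃ (C : ℕ → ℕ → ℂ) (k : ℕ → ℕ → ℝ), ∀ N : ℕ, 1 ≤ N →
    (∀ j ≤ N, |k N j| ≤ 1) ∧
      ψ N = fun τ => ∑ j ∈ Finset.range (N + 1), C N j * φ (k N j) τ
  isOpen_domain : IsOpen U
  limit : ∃ (kinf : ℝ) (S : Finset ℤ) (c : ℤ → ℂ), kinf ∉ Icc (-1 : ℝ) 1 ∧ (0 : ℤ) ∉ S ∧
    TendstoLocallyUniformlyOn ψ (fun τ => ∑ n ∈ S, c n * φ (n * kinf) τ) atTop U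

/-- `C_j(N,a) = binom(N,j) ((1+a)/2)^(N-j) ((1-a)/2)^j`, used for `0 ≤ j ≤ N`. -/
def coeff (N j : ℕ) (a : ℝ) : ℝ :=
  (N.choose j : ℝ) * ((1 + a) / 2) ^ (N - j) * ((1 - a) / 2) ^ j

/-- `ψ_N(t,x,a) = ∑_{j=0}^N C_j(N,a) φ_{1-2j/N}(t,x)`, for `N ≥ 1`. -/
def psi (u a : ℝ) (N : ℕ) (p : ℝ × ℝ) : ℂ :=
  ∑ j ∈ Finset.range (N + 1), (coeff N j a : ℂ) * phi u (1 - 2 * (j : ℝ) / (N : ℝ)) p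

end Centrifugal

end

/-!
The proof rests on the integrals over the rotated half-line `e^{iπ/4} ]0, ∞[`, called moments here:
`∫₀^∞ y^s e^{-y²/(2t)} E_μ(e^{iπ/4} x y / t) Y(e^{iπ/4} y) dy` for a datum `Y` of exponential type.
The Gaussian makes them converge absolutely. As `E_μ' = -(z/2) E_{μ+1}`, the partial derivatives
of a moment are again combinations of moments (`hasFDerivAt_moment`), so that a moment is smooth;
and since the majorants depend only on the bound for the datum, a moment depends continuously on
the datum, uniformly on compact sets (`tendstoUniformlyOn_moment`). Both properties pass to every
operator that is a sum of moments with smooth coefficients (`FresnelOp`), a class that contains the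
evolution and is stable under `∂/∂t`, `∂/∂x` and `-∂²/∂x² + u/x²`.

The Schrödinger equation for the evolution (`schrodinger_evolve`) is the three-term recurrence of
the functions `E_μ`. As `∂/∂t` commutes with the spatial operators on smooth functions, the
equation yields the formulas for the mixed derivatives of all its solutions
(`iterate_dt_iterate_dx_of_schrodinger`). The combination `psi` is the evolution of the
superoscillating datum `∑ C_j(N,a) e^{i(1-2j/N)z} = (cos(z/N) + i a sin(z/N))^N`, which is bounded
by `e^{B|z|}` with `B` independent of `N` and tends to `e^{iaz}` pointwise. The continuity in the
datum then gives the convergence of `psi`, with all derivatives, to `phi u a`, and with it the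
supershift property.

For the improper integral against the Green function and for the initial value, the behaviour of
`E_ν` at infinity is needed. Poisson's integral (`besselE_eq_poisson`), deformed into two vertical
half-lines (`poisson_eq_sides`), yields the bound `|z|^{ν+1/2} |E_ν(z)| ≤ C e^{|Im z|}` in the
sector `|Im z| ≤ Re z`, and the leading term of `w^{ν+1/2} E_ν(w)` on the half-line `w > 0`, with
an error `O(1/(1+w))`. By the bound, `e^{iz²/(2t)}` wins on large arcs, and Cauchy's theorem in
the sector of opening `π/4` identifies the improper integral with the integral over the rotated
half-line (`tendsto_integral_green`).

For the initial value (`tendsto_phi`), the integration runs along `[0, A]` with `A > x₀`, and then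
along the ray `A + e^{iπ/4} [0, ∞[`, whose contribution is `O(√t)`. On `[0, A]` the Bessel function
is replaced by its two leading exponentials, at the cost `O(t^{1/4})`. One of them gives the free
propagator on `[0, A]`, hence `e^{iλx₀}` in the limit, because the stationary point lies inside; the
other one gives its reflection, whose stationary point is near `-x₀`, outside of the interval, so
that it disappears.
-/

noncomputable section

namespace Centrifugal

/-! ### The series of the Bessel function -/

lemma gamma_mul_factorial_le {μ : ℝ} (hμ : 0 ≤ μ) (k : ℕ) :
    Real.Gamma (μ + 1) * k.factorial ≤ Real.Gamma (μ + k + 1) := by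
  induction k with
  | zero => simp
  | succ k ih =>
    have h0 : (0 : ℝ) ≤ k := k.cast_nonneg
    have : μ + ((k + 1 : ℕ) : ℝ) + 1 = (μ + k + 1) + 1 := by push_cast; ring
    rw [this, Real.Gamma_add_one (s := μ + k + 1) (by positivity), Nat.factorial_succ]
    push_cast
    have hG : 0 < Real.Gamma (μ + 1) := Real.Gamma_pos_of_pos (by positivity)
    have hf : (0 : ℝ) < k.factorial := by positivity
    calc Real.Gamma (μ + 1) * ((k + 1) * k.factorial)
        = (k + 1) * (Real.Gamma (μ + 1) * k.factorial) := by ring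
      _ ≤ (μ + k + 1) * Real.Gamma (μ + k + 1) := by
        apply mul_le_mul _ ih (by positivity) (by positivity)
        linarith

/-- The `k`-th term of the series defining `besselE μ z`. -/
def besselTerm (μ : ℝ) (k : ℕ) (z : ℂ) : ℂ :=
  (-1) ^ k / ((Real.Gamma (k + 1) * Real.Gamma (μ + k + 1) : ℝ) : ℂ) * (z / 2) ^ (2 * k)

lemma two_mul_factorial_le (k : ℕ) :
    ((2 * k).factorial : ℝ) ≤ 4 ^ k * (k.factorial * k.factorial) := by
  have h1 : (2 * k).choose k ≤ 4 ^ k := by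
    have := Nat.choose_le_two_pow (2 * k) k
    rwa [pow_mul] at this
  have h2 := Nat.choose_mul_factorial_mul_factorial (show k ≤ 2 * k by omega)
  rw [show 2 * k - k = k by omega] at h2
  have : (2 * k).factorial ≤ 4 ^ k * (k.factorial * k.factorial) := by
    rw [← h2, mul_assoc]
    exact Nat.mul_le_mul_right _ h1
  exact_mod_cast this

/-- The terms are dominated by those of the exponential series, since `(2k)! ≤ 4^k (k!)²` and
`Γ(μ+1) k! ≤ Γ(μ+k+1)`. -/
lemma norm_besselTerm_le {μ : ℝ} (hμ : 0 ≤ μ) (k : ℕ) (z : ℂ) :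
    ‖besselTerm μ k z‖ ≤
      (Real.Gamma (μ + 1))⁻¹ * (‖z‖ ^ (2 * k) / (2 * k).factorial) := by
  have hG : 0 < Real.Gamma (μ + 1) := Real.Gamma_pos_of_pos (by positivity)
  have hG' : 0 < Real.Gamma (μ + k + 1) := Real.Gamma_pos_of_pos (by positivity)
  have hf : (0 : ℝ) < k.factorial := by positivity
  have h1 := gamma_mul_factorial_le hμ k
  have h2 := two_mul_factorial_le k
  rw [besselTerm, Real.Gamma_nat_eq_factorial, norm_mul, norm_div, norm_pow, norm_pow, norm_neg,
    norm_one, one_pow, Complex.norm_real, norm_div, Real.norm_of_nonneg (by positivity)]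
  have h4 : (2 : ℝ) ^ (2 * k) = 4 ^ k := by rw [pow_mul]; norm_num
  rw [show ‖(2 : ℂ)‖ = 2 by simp, div_pow, h4, one_div_mul_eq_div, div_div, inv_mul_eq_div, div_div]
  apply div_le_div_of_nonneg_left (by positivity) (by positivity)
  calc ((2 * k).factorial : ℝ) * Real.Gamma (μ + 1)
      ≤ 4 ^ k * (k.factorial * k.factorial) * Real.Gamma (μ + 1) := by gcongr
    _ = 4 ^ k * (k.factorial * (Real.Gamma (μ + 1) * k.factorial)) := by ring
    _ ≤ 4 ^ k * (k.factorial * Real.Gamma (μ + k + 1)) := by gcongr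

lemma summable_pow_two_mul_div_factorial (x : ℝ) :
    Summable fun k : ℕ => x ^ (2 * k) / (2 * k).factorial :=
  (Real.summable_pow_div_factorial x).comp_injective
    (fun a b h => by simpa using h : Function.Injective fun k : ℕ => 2 * k)

lemma summable_besselTerm {μ : ℝ} (hμ : 0 ≤ μ) (z : ℂ) :
    Summable fun k => besselTerm μ k z :=
  Summable.of_norm_bounded ((summable_pow_two_mul_div_factorial ‖z‖).mul_left _)
    (fun k => norm_besselTerm_le hμ k z)

lemma besselE_eq_tsum (μ : ℝ) (z : ℂ) : besselE μ z = ∑' k, besselTerm μ k z := rfl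

lemma norm_besselE_le {μ : ℝ} (hμ : 0 ≤ μ) (z : ℂ) :
    ‖besselE μ z‖ ≤ (Real.Gamma (μ + 1))⁻¹ * Real.exp ‖z‖ := by
  have hG : 0 < Real.Gamma (μ + 1) := Real.Gamma_pos_of_pos (by positivity)
  rw [besselE_eq_tsum]
  refine (tsum_of_norm_bounded ((summable_pow_two_mul_div_factorial ‖z‖).mul_left _).hasSum
    (fun k => norm_besselTerm_le hμ k z)).trans ?_
  rw [tsum_mul_left]
  gcongr
  rw [Real.exp_eq_exp_ℝ, NormedSpace.exp_eq_tsum_div]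
  exact tsum_comp_le_tsum_of_inj (Real.summable_pow_div_factorial _)
    (fun k => by positivity) (fun a b h => by simpa using h : Function.Injective fun k : ℕ => 2 * k)

lemma besselTerm_succ_mul {μ : ℝ} (hμ : 0 ≤ μ) (k : ℕ) (z : ℂ) :
    besselTerm μ (k + 1) z * (k + 1) = -(z / 2) ^ 2 * besselTerm (μ + 1) k z := by
  have hk : (0 : ℝ) ≤ k := k.cast_nonneg
  have hG : Real.Gamma (μ + k + 1 + 1) ≠ 0 := (Real.Gamma_pos_of_pos (by positivity)).ne'
  have hf : (k.factorial : ℂ) ≠ 0 := by exact_mod_cast k.factorial_ne_zero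
  have hk1 : (k : ℂ) + 1 ≠ 0 := by exact_mod_cast k.succ_ne_zero
  have hG' : (Real.Gamma (μ + k + 1 + 1) : ℂ) ≠ 0 := by exact_mod_cast hG
  have e1 : μ + ((k + 1 : ℕ) : ℝ) + 1 = μ + k + 1 + 1 := by push_cast; ring
  have e2 : μ + 1 + (k : ℝ) + 1 = μ + k + 1 + 1 := by ring
  rw [besselTerm, besselTerm, Real.Gamma_nat_eq_factorial, Real.Gamma_nat_eq_factorial, e1, e2,
    Nat.factorial_succ]
  push_cast
  field_simp
  ring

lemma hasDerivAt_besselTerm_zero (μ : ℝ) (z : ℂ) : HasDerivAt (besselTerm μ 0) 0 z := by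
  have : besselTerm μ 0 = fun _ => besselTerm μ 0 0 := by
    funext w; simp [besselTerm]
  rw [this]; exact hasDerivAt_const _ _

lemma hasDerivAt_besselTerm_succ {μ : ℝ} (hμ : 0 ≤ μ) (k : ℕ) (z : ℂ) :
    HasDerivAt (besselTerm μ (k + 1)) (-(z / 2) * besselTerm (μ + 1) k z) z := by
  have h1 : HasDerivAt (fun w : ℂ => (w / 2) ^ (2 * (k + 1)))
      ((2 * (k + 1) : ℕ) * (z / 2) ^ (2 * k + 1) * (1 / 2)) z := by
    exact ((hasDerivAt_id z).div_const 2).pow (2 * (k + 1))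
  have h2 := h1.const_mul ((-1) ^ (k + 1) /
    ((Real.Gamma ((k + 1 : ℕ) + 1) * Real.Gamma (μ + (k + 1 : ℕ) + 1) : ℝ) : ℂ))
  refine h2.congr_deriv ?_
  by_cases hz : z = 0
  · simp [hz]
  have h3 := besselTerm_succ_mul hμ k z
  have hz2 : z / 2 ≠ 0 := by simpa using hz
  apply mul_right_cancel₀ hz2
  rw [show -(z / 2) * besselTerm (μ + 1) k z * (z / 2) = -(z / 2) ^ 2 * besselTerm (μ + 1) k z by
    ring, ← h3, besselTerm]
  push_cast
  ring

/-- Termwise differentiation: `E_μ' = -(z/2) E_{μ+1}`. -/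
theorem hasDerivAt_besselE {μ : ℝ} (hμ : 0 ≤ μ) (z : ℂ) :
    HasDerivAt (besselE μ) (-(z / 2) * besselE (μ + 1) z) z := by
  have hd : ∀ k w, DifferentiableAt ℂ (besselTerm μ k) w := by
    intro k w
    cases k with
    | zero => exact (hasDerivAt_besselTerm_zero μ w).differentiableAt
    | succ k => exact (hasDerivAt_besselTerm_succ hμ k w).differentiableAt
  have hG : 0 < Real.Gamma (μ + 1) := Real.Gamma_pos_of_pos (by positivity)
  have hU : IsOpen (Metric.ball (0 : ℂ) (‖z‖ + 1)) := Metric.isOpen_ball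
  have hzU : z ∈ Metric.ball (0 : ℂ) (‖z‖ + 1) := by simp
  have hu := (summable_pow_two_mul_div_factorial (‖z‖ + 1)).mul_left (Real.Gamma (μ + 1))⁻¹
  have hle : ∀ (k : ℕ) (w : ℂ), w ∈ Metric.ball (0 : ℂ) (‖z‖ + 1) → ‖besselTerm μ k w‖ ≤
      (Real.Gamma (μ + 1))⁻¹ * ((‖z‖ + 1) ^ (2 * k) / (2 * k).factorial) := by
    intro k w hw
    have hw' : ‖w‖ ≤ ‖z‖ + 1 := by simpa using (mem_ball_zero_iff.1 hw).le
    refine (norm_besselTerm_le hμ k w).trans ?_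
    gcongr
  have hdiff := Complex.differentiableOn_tsum_of_summable_norm hu
    (fun k w _ => (hd k w).differentiableWithinAt) hU hle
  have hsum := Complex.hasSum_deriv_of_summable_norm hu
    (fun k w _ => (hd k w).differentiableWithinAt) hU hle hzU
  have hderiv : deriv (besselE μ) z = -(z / 2) * besselE (μ + 1) z := by
    have : besselE μ = fun w => ∑' k, besselTerm μ k w := rfl
    rw [this, ← hsum.tsum_eq, hsum.summable.tsum_eq_zero_add,
      (hasDerivAt_besselTerm_zero μ z).deriv, zero_add, besselE_eq_tsum, ← tsum_mul_left]
    exact tsum_congr fun k => (hasDerivAt_besselTerm_succ hμ k z).deriv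
  rw [← hderiv]
  exact (hdiff.differentiableAt (hU.mem_nhds hzU)).hasDerivAt

lemma differentiable_besselE {μ : ℝ} (hμ : 0 ≤ μ) : Differentiable ℂ (besselE μ) :=
  fun z => (hasDerivAt_besselE hμ z).differentiableAt

lemma continuous_besselE {μ : ℝ} (hμ : 0 ≤ μ) : Continuous (besselE μ) :=
  (differentiable_besselE hμ).continuous

lemma besselTerm_zero_sub {μ : ℝ} (hμ : 0 ≤ μ) (z : ℂ) :
    besselTerm μ 0 z - (μ + 1) * besselTerm (μ + 1) 0 z = 0 := by
  have hG : (Real.Gamma (μ + 1) : ℂ) ≠ 0 := by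
    exact_mod_cast (Real.Gamma_pos_of_pos (by positivity : 0 < μ + 1)).ne'
  have h1 : (μ : ℂ) + 1 ≠ 0 := by
    exact_mod_cast (by positivity : μ + 1 ≠ 0)
  simp only [besselTerm, Nat.cast_zero, add_zero, zero_add, Real.Gamma_one]
  rw [Real.Gamma_add_one (s := μ + 1) (by positivity)]
  push_cast
  field_simp
  ring

lemma besselTerm_succ_sub {μ : ℝ} (hμ : 0 ≤ μ) (k : ℕ) (z : ℂ) :
    besselTerm μ (k + 1) z - (μ + 1) * besselTerm (μ + 1) (k + 1) z =
      -(z / 2) ^ 2 * besselTerm (μ + 2) k z := by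
  have hk : (0 : ℝ) ≤ k := k.cast_nonneg
  have hG : (Real.Gamma (μ + k + 2) : ℂ) ≠ 0 := by
    exact_mod_cast (Real.Gamma_pos_of_pos (by positivity : 0 < μ + k + 2)).ne'
  have h1 : (μ : ℂ) + k + 2 ≠ 0 := by
    exact_mod_cast (by positivity : μ + k + 2 ≠ 0)
  have hf : (k.factorial : ℂ) ≠ 0 := by exact_mod_cast k.factorial_ne_zero
  have hk1 : (k : ℂ) + 1 ≠ 0 := by exact_mod_cast k.succ_ne_zero
  have e1 : μ + ((k + 1 : ℕ) : ℝ) + 1 = μ + k + 2 := by push_cast; ring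
  have e2 : μ + 1 + ((k + 1 : ℕ) : ℝ) + 1 = μ + k + 2 + 1 := by push_cast; ring
  have e3 : μ + 2 + (k : ℝ) + 1 = μ + k + 2 + 1 := by ring
  simp only [besselTerm]
  rw [Real.Gamma_nat_eq_factorial, Real.Gamma_nat_eq_factorial, e1, e2, e3,
    Nat.factorial_succ, Real.Gamma_add_one (s := μ + k + 2) (by positivity)]
  push_cast
  field_simp
  ring

/-- The three-term recurrence, which is Bessel's equation written with the functions `besselE`. -/
theorem besselE_recurrence {μ : ℝ} (hμ : 0 ≤ μ) (z : ℂ) :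
    besselE μ z = (μ + 1) * besselE (μ + 1) z - (z / 2) ^ 2 * besselE (μ + 2) z := by
  have s0 := summable_besselTerm hμ z
  have s1 := summable_besselTerm (by positivity : 0 ≤ μ + 1) z
  have h : besselE μ z - (μ + 1) * besselE (μ + 1) z = -(z / 2) ^ 2 * besselE (μ + 2) z := by
    simp only [besselE_eq_tsum]
    rw [← tsum_mul_left, ← tsum_mul_left, ← s0.tsum_sub (s1.mul_left _),
      (s0.sub (s1.mul_left _)).tsum_eq_zero_add, besselTerm_zero_sub hμ, zero_add]
    exact tsum_congr fun k => besselTerm_succ_sub hμ k z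
  linear_combination h

/-! ### Moments along the rotated half-line -/

/-- The unit vector `e^{iπ/4}` spanning the rotated half-line. -/
def rot : ℂ := Complex.exp (Complex.I * Real.pi / 4)

lemma norm_rot : ‖rot‖ = 1 := by
  rw [rot, show Complex.I * Real.pi / 4 = ((Real.pi / 4 : ℝ) : ℂ) * Complex.I by push_cast; ring,
    Complex.norm_exp_ofReal_mul_I]

lemma rot_sq : rot ^ 2 = Complex.I := by
  rw [rot, ← Complex.exp_nat_mul,
    show ((2 : ℕ) : ℂ) * (Complex.I * Real.pi / 4) = (Real.pi : ℂ) / 2 * Complex.I by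
      push_cast; ring, Complex.exp_pi_div_two_mul_I]

/-- `Y` is continuous and of exponential type: `‖Y z‖ ≤ A e^{B‖z‖}`. -/
def ExpBounded (A B : ℝ) (Y : ℂ → ℂ) : Prop :=
  Continuous Y ∧ ∀ z, ‖Y z‖ ≤ A * Real.exp (B * ‖z‖)

/-- The Gaussian-Bessel kernel `y^s e^{-y²/(2t)} E_μ(e^{iπ/4} x y / t)` at `p = (t, x)`. -/
def kernel (μ s : ℝ) (p : ℝ × ℝ) (y : ℝ) : ℂ :=
  ((y ^ s * Real.exp (-(1 / (2 * p.1)) * y ^ 2) : ℝ) : ℂ) * besselE μ (p.2 * (rot * y) / p.1)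

/-- The integral of the kernel against the datum `Y` along the rotated half-line. -/
def moment (Y : ℂ → ℂ) (μ s : ℝ) (p : ℝ × ℝ) : ℂ :=
  ∫ y in Ioi (0 : ℝ), kernel μ s p y * Y (rot * y)

lemma integrableOn_rpow_mul_exp {s c : ℝ} (hs : -1 < s) (hc : 0 < c) (b : ℝ) :
    IntegrableOn (fun y : ℝ => y ^ s * Real.exp (-c * y ^ 2 + b * y)) (Ioi 0) := by
  have h := (integrableOn_rpow_mul_exp_neg_mul_sq (half_pos hc) hs).const_mul
    (Real.exp (b ^ 2 / (2 * c)))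
  refine h.mono' ?_ ?_
  · refine ContinuousOn.aestronglyMeasurable ?_ measurableSet_Ioi
    exact (continuousOn_id.rpow_const fun y hy => Or.inl (ne_of_gt hy)).mul (by fun_prop)
  · refine (ae_restrict_iff' measurableSet_Ioi).2 (Eventually.of_forall fun y hy => ?_)
    have hy : (0 : ℝ) < y := hy
    rw [Real.norm_of_nonneg (by positivity), mul_left_comm, ← Real.exp_add]
    refine mul_le_mul_of_nonneg_left (Real.exp_le_exp.2 ?_) (by positivity)
    -- complete the square in `-(c/2) y² + b y`
    have : 0 ≤ (c * y - b) ^ 2 / (2 * c) := by positivity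
    have e : (c * y - b) ^ 2 / (2 * c) = c / 2 * y ^ 2 - b * y + b ^ 2 / (2 * c) := by
      field_simp; ring
    linarith

lemma norm_kernel_le {μ s t₁ t₂ x₂ : ℝ} (hμ : 0 ≤ μ) (ht₁ : 0 < t₁) {p : ℝ × ℝ}
    (h₁ : t₁ ≤ p.1) (h₂ : p.1 ≤ t₂) (hx : |p.2| ≤ x₂) {y : ℝ} (hy : 0 < y) :
    ‖kernel μ s p y‖ ≤ (Real.Gamma (μ + 1))⁻¹ *
      (y ^ s * Real.exp (-(1 / (2 * t₂)) * y ^ 2 + x₂ / t₁ * y)) := by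
  have hp : 0 < p.1 := ht₁.trans_le h₁
  have ht₂ : 0 < t₂ := hp.trans_le h₂
  have hG : 0 < Real.Gamma (μ + 1) := Real.Gamma_pos_of_pos (by positivity)
  have hz : ‖(p.2 * (rot * y) / p.1 : ℂ)‖ ≤ x₂ / t₁ * y := by
    rw [norm_div, norm_mul, norm_mul, norm_rot, Complex.norm_real, Complex.norm_real,
      Complex.norm_real, Real.norm_of_nonneg hp.le, Real.norm_of_nonneg hy.le, one_mul,
      Real.norm_eq_abs, mul_div_right_comm]
    have : 0 ≤ x₂ := (abs_nonneg _).trans hx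
    gcongr
  rw [kernel, norm_mul, Complex.norm_real, Real.norm_of_nonneg (by positivity), Real.exp_add]
  calc y ^ s * Real.exp (-(1 / (2 * p.1)) * y ^ 2) * ‖besselE μ (p.2 * (rot * y) / p.1)‖
      ≤ y ^ s * Real.exp (-(1 / (2 * t₂)) * y ^ 2) *
        ((Real.Gamma (μ + 1))⁻¹ * Real.exp (x₂ / t₁ * y)) := by
        have : -(1 / (2 * p.1)) ≤ -(1 / (2 * t₂)) := by gcongr
        gcongr
        exact (norm_besselE_le hμ _).trans (by gcongr)
    _ = _ := by ring

lemma continuousOn_kernel {μ : ℝ} (hμ : 0 ≤ μ) (s : ℝ) (p : ℝ × ℝ) :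
    ContinuousOn (kernel μ s p) (Ioi 0) := by
  have h1 : ContinuousOn (fun y : ℝ => y ^ s) (Ioi 0) :=
    continuousOn_id.rpow_const fun y hy => Or.inl (ne_of_gt hy)
  refine (Complex.continuous_ofReal.comp_continuousOn (h1.mul (by fun_prop))).mul ?_
  exact ((continuous_besselE hμ).comp (by fun_prop)).continuousOn

lemma aestronglyMeasurable_kernel_mul {μ A B : ℝ} (hμ : 0 ≤ μ) (s : ℝ) (p : ℝ × ℝ) {Y : ℂ → ℂ}
    (hY : ExpBounded A B Y) :
    AEStronglyMeasurable (fun y : ℝ => kernel μ s p y * Y (rot * y))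
      (volume.restrict (Ioi 0)) := by
  refine ((continuousOn_kernel hμ s p).mul ?_).aestronglyMeasurable measurableSet_Ioi
  exact (hY.1.comp (by fun_prop)).continuousOn

/-- The integrable majorant of `kernel μ s p y * Y (rot * y)` on a box of points `p`. -/
def majorant (A B μ s t₁ t₂ x₂ y : ℝ) : ℝ :=
  (Real.Gamma (μ + 1))⁻¹ * A * (y ^ s * Real.exp (-(1 / (2 * t₂)) * y ^ 2 + (x₂ / t₁ + B) * y))

lemma integrableOn_majorant {s t₂ : ℝ} (hs : -1 < s) (ht₂ : 0 < t₂) (A B μ t₁ x₂ : ℝ) :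
    IntegrableOn (majorant A B μ s t₁ t₂ x₂) (Ioi 0) :=
  (integrableOn_rpow_mul_exp hs (by positivity) _).const_mul _

lemma norm_kernel_mul_le {A B μ s t₁ t₂ x₂ : ℝ} {Y : ℂ → ℂ}
    (hY : ∀ z, ‖Y z‖ ≤ A * Real.exp (B * ‖z‖))
    (hμ : 0 ≤ μ) (ht₁ : 0 < t₁) {p : ℝ × ℝ}
    (h₁ : t₁ ≤ p.1) (h₂ : p.1 ≤ t₂) (hx : |p.2| ≤ x₂) {y : ℝ} (hy : 0 < y) :
    ‖kernel μ s p y * Y (rot * y)‖ ≤ majorant A B μ s t₁ t₂ x₂ y := by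
  have hG : 0 < Real.Gamma (μ + 1) := Real.Gamma_pos_of_pos (by positivity)
  have h3 := hY (rot * y)
  have hn : ‖rot * (y : ℂ)‖ = y := by
    rw [norm_mul, norm_rot, one_mul, Complex.norm_real, Real.norm_of_nonneg hy.le]
  rw [hn] at h3
  rw [norm_mul]
  calc _ ≤ (Real.Gamma (μ + 1))⁻¹ *
      (y ^ s * Real.exp (-(1 / (2 * t₂)) * y ^ 2 + x₂ / t₁ * y)) * (A * Real.exp (B * y)) :=
        mul_le_mul (norm_kernel_le hμ ht₁ h₁ h₂ hx hy) h3 (norm_nonneg _) (by positivity)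
    _ = _ := by
      rw [majorant, add_mul, ← add_assoc, Real.exp_add _ (B * y)]; ring

lemma integrableOn_kernel_mul {A B μ s : ℝ} {Y : ℂ → ℂ} (hY : ExpBounded A B Y)
    (hμ : 0 ≤ μ) (hs : -1 < s) {p : ℝ × ℝ} (hp : 0 < p.1) :
    IntegrableOn (fun y : ℝ => kernel μ s p y * Y (rot * y)) (Ioi 0) := by
  refine (integrableOn_majorant hs hp A B μ p.1 |p.2|).mono'
    (aestronglyMeasurable_kernel_mul hμ s p hY) ?_
  exact (ae_restrict_iff' measurableSet_Ioi).2 (Eventually.of_forall fun y hy =>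
    norm_kernel_mul_le hY.2 hμ hp le_rfl le_rfl le_rfl hy)

/-- A linear map on `ℝ × ℝ` given by the values of its two partial derivatives. -/
def partials (a b : ℂ) : ℝ × ℝ →L[ℝ] ℂ :=
  (ContinuousLinearMap.fst ℝ ℝ ℝ).smulRight a + (ContinuousLinearMap.snd ℝ ℝ ℝ).smulRight b

lemma partials_apply (a b : ℂ) (v : ℝ × ℝ) : partials a b v = v.1 * a + v.2 * b := by
  simp [partials]

lemma norm_partials_le (a b : ℂ) : ‖partials a b‖ ≤ ‖a‖ + ‖b‖ := by
  refine ContinuousLinearMap.opNorm_le_bound _ (by positivity) fun v => ?_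
  rw [partials_apply, add_mul]
  refine (norm_add_le _ _).trans ?_
  rw [norm_mul, norm_mul, Complex.norm_real, Complex.norm_real, mul_comm, mul_comm ‖v.2‖]
  gcongr
  · exact norm_fst_le v
  · exact norm_snd_le v

lemma hasFDerivAt_kernel {μ : ℝ} (hμ : 0 ≤ μ) (s : ℝ) {p : ℝ × ℝ} (hp : 0 < p.1) {y : ℝ}
    (hy : 0 < y) :
    HasFDerivAt (fun q => kernel μ s q y)
      (partials
        (1 / (2 * p.1 ^ 2) * kernel μ (s + 2) p y +
          Complex.I * p.2 ^ 2 / (2 * p.1 ^ 3) * kernel (μ + 1) (s + 2) p y)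
        (-(Complex.I * p.2 / (2 * p.1 ^ 2)) * kernel (μ + 1) (s + 2) p y)) p := by
  have hp' : (p.1 : ℂ) ≠ 0 := by exact_mod_cast hp.ne'
  have h1 : HasFDerivAt (fun q : ℝ × ℝ => ((q.1 : ℝ) : ℂ)) (partials 1 0) p := by
    have := Complex.ofRealCLM.hasFDerivAt.comp p (hasFDerivAt_fst (𝕜 := ℝ) (p := p))
    refine this.congr_fderiv ?_
    ext <;> simp [partials_apply]
  have h2 : HasFDerivAt (fun q : ℝ × ℝ => ((q.2 : ℝ) : ℂ)) (partials 0 1) p := by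
    have := Complex.ofRealCLM.hasFDerivAt.comp p (hasFDerivAt_snd (𝕜 := ℝ) (p := p))
    refine this.congr_fderiv ?_
    ext <;> simp [partials_apply]
  have hinv : HasFDerivAt (fun q : ℝ × ℝ => ((q.1 : ℝ) : ℂ)⁻¹)
      (partials (-((p.1 : ℂ) ^ 2)⁻¹) 0) p := by
    have := (hasDerivAt_inv hp').complexToReal_fderiv.comp p h1
    refine this.congr_fderiv ?_
    ext <;> simp [partials_apply]
  have harg : HasFDerivAt (fun q : ℝ × ℝ => (q.2 * (rot * y) / q.1 : ℂ))
      (partials (-(p.2 * (rot * y) / p.1 ^ 2)) (rot * y / p.1)) p := by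
    have := (h2.mul_const' (rot * (y : ℂ))).mul hinv
    simp only [div_eq_mul_inv]
    refine this.congr_fderiv ?_
    ext <;> simp [partials_apply]; ring
  have hE := (hasDerivAt_besselE hμ (p.2 * (rot * y) / p.1)).complexToReal_fderiv.comp p harg
  have hexp : HasFDerivAt
      (fun q : ℝ × ℝ => ((y ^ s * Real.exp (-(1 / (2 * q.1)) * y ^ 2) : ℝ) : ℂ))
      (partials (((y ^ s * Real.exp (-(1 / (2 * p.1)) * y ^ 2) : ℝ) : ℂ) *
        (y ^ 2 / (2 * p.1 ^ 2))) 0) p := by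
    have h3 : HasFDerivAt (fun q : ℝ × ℝ => Complex.exp (-(((q.1 : ℝ) : ℂ)⁻¹ * (y ^ 2 / 2))))
        (partials (Complex.exp (-((p.1 : ℂ)⁻¹ * (y ^ 2 / 2))) * (y ^ 2 / (2 * p.1 ^ 2))) 0) p := by
      have h4 := (hinv.mul_const' ((y : ℂ) ^ 2 / 2)).neg
      have := (Complex.hasDerivAt_exp _).complexToReal_fderiv.comp p h4
      refine this.congr_fderiv ?_
      ext <;> simp [partials_apply]
      ring
    have h5 := h3.const_mul ((y ^ s : ℝ) : ℂ)
    have e : ∀ q : ℝ × ℝ, ((y ^ s * Real.exp (-(1 / (2 * q.1)) * y ^ 2) : ℝ) : ℂ) =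
        ((y ^ s : ℝ) : ℂ) * Complex.exp (-(((q.1 : ℝ) : ℂ)⁻¹ * (y ^ 2 / 2))) := by
      intro q
      push_cast
      congr 2
      rw [one_div, mul_inv]
      ring
    simp only [e]
    refine h5.congr_fderiv ?_
    ext <;> simp [partials_apply]
    ring
  have hk := hexp.mul hE
  have hys : y ^ (s + 2) = y ^ s * y ^ 2 := by
    rw [Real.rpow_add hy]; norm_num
  refine hk.congr_fderiv ?_
  have hI : Complex.I = rot ^ 2 := rot_sq.symm
  ext
  · simp [partials_apply, kernel, hys]
    rw [hI]
    field_simp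
    ring
  · simp [partials_apply, kernel, hys]
    rw [hI]
    field_simp

lemma quadrant_nhds_box {p : ℝ × ℝ} (hp : p ∈ quadrant) :
    Ioo (p.1 / 2) (2 * p.1) ×ˢ Ioo 0 (2 * p.2) ∈ 𝓝 p := by
  obtain ⟨h1, h2⟩ : 0 < p.1 ∧ 0 < p.2 := hp
  refine (isOpen_Ioo.prod isOpen_Ioo).mem_nhds ⟨⟨by linarith, by linarith⟩, ⟨h2, by linarith⟩⟩

lemma isOpen_quadrant : IsOpen quadrant := isOpen_Ioi.prod isOpen_Ioi

/-- The partial derivatives of a moment are combinations of moments, by differentiation under the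
integral sign. -/
theorem hasFDerivAt_moment {A B μ s : ℝ} {Y : ℂ → ℂ} (hY : ExpBounded A B Y)
    (hμ : 0 ≤ μ) (hs : -1 < s) {p : ℝ × ℝ} (hp : p ∈ quadrant) :
    HasFDerivAt (moment Y μ s)
      (partials
        (1 / (2 * p.1 ^ 2) * moment Y μ (s + 2) p +
          Complex.I * p.2 ^ 2 / (2 * p.1 ^ 3) * moment Y (μ + 1) (s + 2) p)
        (-(Complex.I * p.2 / (2 * p.1 ^ 2)) * moment Y (μ + 1) (s + 2) p)) p := by
  obtain ⟨hp1, hp2⟩ : 0 < p.1 ∧ 0 < p.2 := hp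
  have hμ1 : 0 ≤ μ + 1 := by positivity
  have hs2 : -1 < s + 2 := by linarith
  set U := Ioo (p.1 / 2) (2 * p.1) ×ˢ Ioo 0 (2 * p.2) with hU
  set D : ℝ × ℝ → ℝ → (ℝ × ℝ →L[ℝ] ℂ) := fun q y => partials
        ((1 / (2 * q.1 ^ 2) * kernel μ (s + 2) q y +
          Complex.I * q.2 ^ 2 / (2 * q.1 ^ 3) * kernel (μ + 1) (s + 2) q y) * Y (rot * y))
        ((-(Complex.I * q.2 / (2 * q.1 ^ 2)) * kernel (μ + 1) (s + 2) q y) * Y (rot * y)) with hD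
  have hi1 := integrableOn_kernel_mul hY hμ hs2 hp1
  have hi2 := integrableOn_kernel_mul hY hμ1 hs2 hp1
  have hia : IntegrableOn (fun y : ℝ => (1 / (2 * (p.1 : ℂ) ^ 2) * kernel μ (s + 2) p y +
          Complex.I * p.2 ^ 2 / (2 * p.1 ^ 3) * kernel (μ + 1) (s + 2) p y) * Y (rot * y))
          (Ioi 0) := by
    refine ((hi1.const_mul (1 / (2 * (p.1 : ℂ) ^ 2))).add
      (hi2.const_mul (Complex.I * p.2 ^ 2 / (2 * (p.1 : ℂ) ^ 3)))).congr
        (Eventually.of_forall fun y => ?_)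
    simp only [Pi.add_apply]
    rw [add_mul, mul_assoc, mul_assoc]
  have hib : IntegrableOn (fun y : ℝ => (-(Complex.I * p.2 / (2 * (p.1 : ℂ) ^ 2)) *
      kernel (μ + 1) (s + 2) p y) * Y (rot * y)) (Ioi 0) := by
    simp only [mul_assoc]
    exact hi2.const_mul (-(Complex.I * p.2 / (2 * (p.1 : ℂ) ^ 2)))
  set La : ℂ →L[ℝ] (ℝ × ℝ →L[ℝ] ℂ) :=
    ContinuousLinearMap.smulRightL ℝ (ℝ × ℝ) ℂ (ContinuousLinearMap.fst ℝ ℝ ℝ) with hLa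
  set Lb : ℂ →L[ℝ] (ℝ × ℝ →L[ℝ] ℂ) :=
    ContinuousLinearMap.smulRightL ℝ (ℝ × ℝ) ℂ (ContinuousLinearMap.snd ℝ ℝ ℝ) with hLb
  have hpart : ∀ a b : ℂ, partials a b = La a + Lb b := fun a b => rfl
  have hmain : HasFDerivAt (moment Y μ s) (∫ y in Ioi (0 : ℝ), D p y) p := by
    refine hasFDerivAt_integral_of_dominated_of_fderiv_le
      (bound := fun y => 2 / p.1 ^ 2 * majorant A B μ (s + 2) (p.1 / 2) (2 * p.1) (2 * p.2) y +
        (16 * p.2 ^ 2 / p.1 ^ 3 + 4 * p.2 / p.1 ^ 2) *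
          majorant A B (μ + 1) (s + 2) (p.1 / 2) (2 * p.1) (2 * p.2) y)
      (s := U) (F' := D)
      (quadrant_nhds_box ⟨hp1, hp2⟩) (Eventually.of_forall fun q =>
        aestronglyMeasurable_kernel_mul hμ s q hY)
      (integrableOn_kernel_mul hY hμ hs hp1) ?_ ?_ ?_ ?_
    · simp only [hD, hpart]
      exact (La.integrable_comp hia).aestronglyMeasurable.add
        (Lb.integrable_comp hib).aestronglyMeasurable
    · refine (ae_restrict_iff' measurableSet_Ioi).2 (Eventually.of_forall fun y hy q hq => ?_)
      obtain ⟨⟨h1, h2⟩, h3, h4⟩ := hq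
      have hq1 : 0 < q.1 := by linarith
      have hx : |q.2| ≤ 2 * p.2 := by rw [abs_of_pos h3]; exact h4.le
      have k1 := norm_kernel_mul_le (s := s + 2) hY.2 hμ (half_pos hp1) h1.le h2.le hx hy
      have k2 := norm_kernel_mul_le (s := s + 2) hY.2 hμ1 (half_pos hp1) h1.le h2.le hx hy
      have c1 : ‖(1 / (2 * (q.1 : ℂ) ^ 2))‖ ≤ 2 / p.1 ^ 2 := by
        rw [norm_div, norm_mul, norm_pow, Complex.norm_real, Real.norm_of_nonneg hq1.le, norm_one,
          Complex.norm_ofNat]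
        calc 1 / (2 * q.1 ^ 2) ≤ 1 / (2 * (p.1 / 2) ^ 2) := by gcongr
          _ = 2 / p.1 ^ 2 := by field_simp
      have c2 : ‖(Complex.I * q.2 ^ 2 / (2 * (q.1 : ℂ) ^ 3))‖ ≤ 16 * p.2 ^ 2 / p.1 ^ 3 := by
        rw [norm_div, norm_mul, norm_mul, norm_pow, norm_pow, Complex.norm_real, Complex.norm_real,
          Real.norm_of_nonneg hq1.le, Real.norm_of_nonneg h3.le, Complex.norm_I, one_mul,
          Complex.norm_ofNat]
        calc q.2 ^ 2 / (2 * q.1 ^ 3) ≤ (2 * p.2) ^ 2 / (2 * (p.1 / 2) ^ 3) := by gcongr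
          _ = _ := by field_simp; norm_num
      have c3 : ‖(-(Complex.I * q.2 / (2 * (q.1 : ℂ) ^ 2)))‖ ≤ 4 * p.2 / p.1 ^ 2 := by
        rw [norm_neg, norm_div, norm_mul, norm_mul, norm_pow, Complex.norm_real, Complex.norm_real,
          Real.norm_of_nonneg hq1.le, Real.norm_of_nonneg h3.le, Complex.norm_I, one_mul,
          Complex.norm_ofNat]
        calc q.2 / (2 * q.1 ^ 2) ≤ (2 * p.2) / (2 * (p.1 / 2) ^ 2) := by gcongr
          _ = _ := by field_simp; norm_num
      refine (norm_partials_le _ _).trans ?_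
      rw [add_mul, mul_assoc, mul_assoc, mul_assoc, add_mul (16 * p.2 ^ 2 / p.1 ^ 3), ← add_assoc]
      refine add_le_add ((norm_add_le _ _).trans (add_le_add ?_ ?_)) ?_ <;> rw [norm_mul]
      · exact mul_le_mul c1 k1 (norm_nonneg _) (by positivity)
      · exact mul_le_mul c2 k2 (norm_nonneg _) (by positivity)
      · exact mul_le_mul c3 k2 (norm_nonneg _) (by positivity)
    · exact ((integrableOn_majorant hs2 (by positivity) A B μ _ _).const_mul _).add
        ((integrableOn_majorant hs2 (by positivity) A B (μ + 1) _ _).const_mul _)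
    · refine (ae_restrict_iff' measurableSet_Ioi).2 (Eventually.of_forall fun y hy q hq => ?_)
      obtain ⟨⟨h1, h2⟩, h3, h4⟩ := hq
      have hq1 : 0 < q.1 := by linarith
      refine ((hasFDerivAt_kernel hμ s hq1 hy).mul_const' (Y (rot * y))).congr_fderiv ?_
      ext <;> simp [partials_apply, hD] <;> exact mul_comm _ _
  refine hmain.congr_fderiv ?_
  simp only [hD, hpart]
  rw [integral_add (La.integrable_comp hia) (Lb.integrable_comp hib), La.integral_comp_comm hia,
    Lb.integral_comp_comm hib]
  have e1 : ∫ y in Ioi (0 : ℝ), (1 / (2 * (p.1 : ℂ) ^ 2) * kernel μ (s + 2) p y +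
          Complex.I * p.2 ^ 2 / (2 * p.1 ^ 3) * kernel (μ + 1) (s + 2) p y) * Y (rot * y) =
      1 / (2 * p.1 ^ 2) * moment Y μ (s + 2) p +
          Complex.I * p.2 ^ 2 / (2 * p.1 ^ 3) * moment Y (μ + 1) (s + 2) p := by
    simp only [moment, add_mul, mul_assoc]
    rw [integral_add, integral_const_mul, integral_const_mul]
    · exact hi1.const_mul _
    · exact hi2.const_mul _
  have e2 : ∫ y in Ioi (0 : ℝ), (-(Complex.I * p.2 / (2 * (p.1 : ℂ) ^ 2)) *
      kernel (μ + 1) (s + 2) p y) * Y (rot * y) =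
      -(Complex.I * p.2 / (2 * p.1 ^ 2)) * moment Y (μ + 1) (s + 2) p := by
    simp only [moment, mul_assoc]
    rw [integral_const_mul]
  rw [e1, e2]

/-- Moments are smooth, by induction on the order of differentiability for all moments at once. -/
theorem contDiffOn_moment {A B μ s : ℝ} {Y : ℂ → ℂ} (hY : ExpBounded A B Y)
    (hμ : 0 ≤ μ) (hs : -1 < s) :
    ContDiffOn ℝ ((⊤ : ℕ∞) : WithTop ℕ∞) (moment Y μ s) quadrant := by
  rw [contDiffOn_infty]
  intro n
  induction n generalizing μ s with
  | zero =>
    rw [Nat.cast_zero, contDiffOn_zero]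
    exact fun p hp => (hasFDerivAt_moment hY hμ hs hp).continuousAt.continuousWithinAt
  | succ n ih =>
    push_cast
    rw [contDiffOn_succ_iff_fderiv_of_isOpen isOpen_quadrant]
    refine ⟨fun p hp => (hasFDerivAt_moment hY hμ hs hp).differentiableAt.differentiableWithinAt,
      by simp, ?_⟩
    refine ContDiffOn.congr ?_ fun p hp => (hasFDerivAt_moment hY hμ hs hp).fderiv
    have hof : ContDiff ℝ n (fun r : ℝ => (r : ℂ)) := Complex.ofRealCLM.contDiff
    have h1 : ContDiffOn ℝ n (fun q : ℝ × ℝ => (q.1 : ℂ)) quadrant :=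
      (hof.comp contDiff_fst).contDiffOn
    have h2 : ContDiffOn ℝ n (fun q : ℝ × ℝ => (q.2 : ℂ)) quadrant :=
      (hof.comp contDiff_snd).contDiffOn
    have hne : ∀ q ∈ quadrant, (q.1 : ℂ) ≠ 0 := fun q hq => by exact_mod_cast (ne_of_gt hq.1)
    have m1 := ih hμ (by linarith : -1 < s + 2)
    have m2 := ih (by positivity : 0 ≤ μ + 1) (by linarith : -1 < s + 2)
    have ha : ContDiffOn ℝ n (fun p : ℝ × ℝ => 1 / (2 * (p.1 : ℂ) ^ 2) * moment Y μ (s + 2) p +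
          Complex.I * p.2 ^ 2 / (2 * p.1 ^ 3) * moment Y (μ + 1) (s + 2) p) quadrant := by
      simp only [div_eq_mul_inv]
      refine ((contDiffOn_const.mul ((contDiffOn_const.mul (h1.pow 2)).inv ?_)).mul m1).add
        (((contDiffOn_const.mul (h2.pow 2)).mul ((contDiffOn_const.mul (h1.pow 3)).inv ?_)).mul m2)
      · exact fun q hq => by simpa using hne q hq
      · exact fun q hq => by simpa using hne q hq
    have hb : ContDiffOn ℝ n (fun p : ℝ × ℝ =>
        -(Complex.I * p.2 / (2 * (p.1 : ℂ) ^ 2)) * moment Y (μ + 1) (s + 2) p) quadrant := by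
      simp only [div_eq_mul_inv]
      refine ((contDiffOn_const.mul h2).mul ((contDiffOn_const.mul (h1.pow 2)).inv ?_)).neg.mul m2
      exact fun q hq => by simpa using hne q hq
    exact (contDiffOn_const.smulRight ha).add (contDiffOn_const.smulRight hb)

lemma exists_box_of_isCompact {K : Set (ℝ × ℝ)} (hK : IsCompact K) (hKq : K ⊆ quadrant) :
    ∃ t₁ t₂ x₂ : ℝ, 0 < t₁ ∧ 0 < t₂ ∧ ∀ p ∈ K, t₁ ≤ p.1 ∧ p.1 ≤ t₂ ∧ |p.2| ≤ x₂ := by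
  rcases K.eq_empty_or_nonempty with rfl | hne
  · exact ⟨1, 1, 1, one_pos, one_pos, by simp⟩
  obtain ⟨a, ha, hamin⟩ := hK.exists_isMinOn hne continuous_fst.continuousOn
  obtain ⟨b, hb, hbmax⟩ := hK.exists_isMaxOn hne continuous_fst.continuousOn
  obtain ⟨c, hc, hcmax⟩ := hK.exists_isMaxOn hne (continuous_snd.abs).continuousOn
  exact ⟨a.1, b.1, |c.2|, (hKq ha).1, (hKq hb).1, fun p hp => ⟨hamin hp, hbmax hp, hcmax hp⟩⟩

/-- The moments depend continuously on the datum, by dominated convergence with a majorant that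
serves all points of a compact set. -/
theorem tendstoUniformlyOn_moment {A B μ s : ℝ} {Y : ℕ → ℂ → ℂ} {Z : ℂ → ℂ}
    (hY : ∀ᶠ N in atTop, ExpBounded A B (Y N)) (hZ : ExpBounded A B Z)
    (hlim : ∀ z, Tendsto (fun N => Y N z) atTop (𝓝 (Z z))) (hμ : 0 ≤ μ) (hs : -1 < s)
    {K : Set (ℝ × ℝ)} (hK : IsCompact K) (hKq : K ⊆ quadrant) :
    TendstoUniformlyOn (fun N => moment (Y N) μ s) (moment Z μ s) atTop K := by
  obtain ⟨t₁, t₂, x₂, ht₁, ht₂, hbox⟩ := exists_box_of_isCompact hK hKq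
  have hG : 0 < Real.Gamma (μ + 1) := Real.Gamma_pos_of_pos (by positivity)
  set w : ℝ → ℝ := fun y => (Real.Gamma (μ + 1))⁻¹ *
      (y ^ s * Real.exp (-(1 / (2 * t₂)) * y ^ 2 + x₂ / t₁ * y)) with hw
  have hw0 : ∀ y : ℝ, 0 < y → 0 ≤ w y := fun y hy => by positivity
  have hwY : ∀ (V : ℂ → ℂ), ExpBounded A B V → ∀ y : ℝ, 0 < y →
      w y * ‖V (rot * y)‖ ≤ majorant A B μ s t₁ t₂ x₂ y := by
    intro V hV y hy
    have h3 := hV.2 (rot * y)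
    have hn : ‖rot * (y : ℂ)‖ = y := by
      rw [norm_mul, norm_rot, one_mul, Complex.norm_real, Real.norm_of_nonneg hy.le]
    rw [hn] at h3
    calc _ ≤ w y * (A * Real.exp (B * y)) := mul_le_mul_of_nonneg_left h3 (hw0 y hy)
      _ = _ := by
        rw [majorant, hw, add_mul, ← add_assoc, Real.exp_add _ (B * y)]; ring
  have hwc : ContinuousOn w (Ioi 0) :=
    continuousOn_const.mul ((continuousOn_id.rpow_const fun y hy => Or.inl (ne_of_gt hy)).mul
      (by fun_prop))
  have hint : Tendsto (fun N => ∫ y in Ioi (0 : ℝ), w y * ‖Y N (rot * y) - Z (rot * y)‖) atTop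
      (𝓝 (∫ y in Ioi (0 : ℝ), (0 : ℝ))) := by
    refine tendsto_integral_filter_of_dominated_convergence
      (fun y => 2 * majorant A B μ s t₁ t₂ x₂ y) ?_ ?_
      ((integrableOn_majorant hs ht₂ A B μ t₁ x₂).const_mul 2) ?_
    · filter_upwards [hY] with N hN
      refine (hwc.mul ?_).aestronglyMeasurable measurableSet_Ioi
      exact ((hN.1.comp (by fun_prop)).sub (hZ.1.comp (by fun_prop))).norm.continuousOn
    · filter_upwards [hY] with N hN
      refine (ae_restrict_iff' measurableSet_Ioi).2 (Eventually.of_forall fun y hy => ?_)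
      rw [Real.norm_of_nonneg (mul_nonneg (hw0 y hy) (norm_nonneg _))]
      have h1 := hwY _ hN y hy
      have h2 := hwY _ hZ y hy
      have h3 := mul_le_mul_of_nonneg_left (norm_sub_le (Y N (rot * y)) (Z (rot * y))) (hw0 y hy)
      linarith
    · refine Eventually.of_forall fun y => ?_
      have := ((hlim (rot * y)).sub_const (Z (rot * y))).norm.const_mul (w y)
      simpa using this
  rw [integral_zero] at hint
  rw [Metric.tendstoUniformlyOn_iff]
  intro ε hε
  filter_upwards [hY, hint.eventually (gt_mem_nhds hε)] with N hN hNε p hp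
  obtain ⟨h1, h2, h3⟩ := hbox p hp
  have hp1 : 0 < p.1 := ht₁.trans_le h1
  refine lt_of_le_of_lt ?_ hNε
  rw [dist_comm, dist_eq_norm, moment, moment, ← integral_sub
    (integrableOn_kernel_mul hN hμ hs hp1) (integrableOn_kernel_mul hZ hμ hs hp1)]
  refine norm_integral_le_of_norm_le ?_ ?_
  · refine ((integrableOn_majorant hs ht₂ A B μ t₁ x₂).const_mul 2).mono' ?_ ?_
    · refine (hwc.mul ?_).aestronglyMeasurable measurableSet_Ioi
      exact ((hN.1.comp (by fun_prop)).sub (hZ.1.comp (by fun_prop))).norm.continuousOn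
    · refine (ae_restrict_iff' measurableSet_Ioi).2 (Eventually.of_forall fun y hy => ?_)
      rw [Real.norm_of_nonneg (mul_nonneg (hw0 y hy) (norm_nonneg _))]
      have h1 := hwY _ hN y hy
      have h2 := hwY _ hZ y hy
      have h3 := mul_le_mul_of_nonneg_left (norm_sub_le (Y N (rot * y)) (Z (rot * y))) (hw0 y hy)
      linarith
  · refine (ae_restrict_iff' measurableSet_Ioi).2 (Eventually.of_forall fun y hy => ?_)
    rw [← mul_sub, norm_mul]
    exact mul_le_mul_of_nonneg_right (norm_kernel_le hμ ht₁ h1 h2 h3 hy) (norm_nonneg _)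

/-! ### Differential operators on the quadrant -/

/-- Smoothness on the open quadrant. -/
def SmoothQ (f : ℝ × ℝ → ℂ) : Prop := ContDiffOn ℝ ((⊤ : ℕ∞) : WithTop ℕ∞) f quadrant

lemma SmoothQ.contDiffAt {f : ℝ × ℝ → ℂ} (hf : SmoothQ f) {p : ℝ × ℝ}
    (hp : p ∈ quadrant) : ContDiffAt ℝ ((⊤ : ℕ∞) : WithTop ℕ∞) f p :=
  ContDiffOn.contDiffAt hf (isOpen_quadrant.mem_nhds hp)

lemma SmoothQ.differentiableAt {f : ℝ × ℝ → ℂ} (hf : SmoothQ f) {p : ℝ × ℝ} (hp : p ∈ quadrant) :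
    DifferentiableAt ℝ f p :=
  (hf.contDiffAt hp).differentiableAt (by simp)

lemma SmoothQ.congr {f g : ℝ × ℝ → ℂ} (hf : SmoothQ f) (h : EqOn f g quadrant) : SmoothQ g :=
  ContDiffOn.congr hf fun _ hp => (h hp).symm

lemma hasDerivAt_fst_of_hasFDerivAt {f : ℝ × ℝ → ℂ} {p : ℝ × ℝ} {L : ℝ × ℝ →L[ℝ] ℂ}
    (h : HasFDerivAt f L p) : HasDerivAt (fun s : ℝ => f (s, p.2)) (L (1, 0)) p.1 :=
  HasFDerivAt.comp_hasDerivAt (f := fun s : ℝ => (s, p.2)) p.1 h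
    ((hasDerivAt_id p.1).prodMk (hasDerivAt_const p.1 p.2))

lemma hasDerivAt_snd_of_hasFDerivAt {f : ℝ × ℝ → ℂ} {p : ℝ × ℝ} {L : ℝ × ℝ →L[ℝ] ℂ}
    (h : HasFDerivAt f L p) : HasDerivAt (fun y : ℝ => f (p.1, y)) (L (0, 1)) p.2 :=
  HasFDerivAt.comp_hasDerivAt (f := fun y : ℝ => (p.1, y)) p.2 h
    ((hasDerivAt_const p.2 p.1).prodMk (hasDerivAt_id p.2))

lemma dt_eq_fderiv {f : ℝ × ℝ → ℂ} (hf : SmoothQ f) :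
    EqOn (dt f) (fun p => fderiv ℝ f p (1, 0)) quadrant := fun _ hp =>
  (hasDerivAt_fst_of_hasFDerivAt (hf.differentiableAt hp).hasFDerivAt).deriv

lemma dx_eq_fderiv {f : ℝ × ℝ → ℂ} (hf : SmoothQ f) :
    EqOn (dx f) (fun p => fderiv ℝ f p (0, 1)) quadrant := fun _ hp =>
  (hasDerivAt_snd_of_hasFDerivAt (hf.differentiableAt hp).hasFDerivAt).deriv

lemma EqOn.dt {f g : ℝ × ℝ → ℂ} (h : EqOn f g quadrant) :
    EqOn (dt f) (Centrifugal.dt g) quadrant := fun p hp => by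
  have : (fun s : ℝ => f (s, p.2)) =ᶠ[𝓝 p.1] fun s => g (s, p.2) := by
    filter_upwards [isOpen_Ioi.mem_nhds hp.1] with s hs using h ⟨hs, hp.2⟩
  exact this.deriv_eq

lemma EqOn.dx {f g : ℝ × ℝ → ℂ} (h : EqOn f g quadrant) :
    EqOn (dx f) (Centrifugal.dx g) quadrant := fun p hp => by
  have : (fun y : ℝ => f (p.1, y)) =ᶠ[𝓝 p.2] fun y => g (p.1, y) := by
    filter_upwards [isOpen_Ioi.mem_nhds hp.2] with s hs using h ⟨hp.1, hs⟩
  exact this.deriv_eq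

lemma SmoothQ.fderiv_apply {f : ℝ × ℝ → ℂ} (hf : SmoothQ f) (v : ℝ × ℝ) :
    SmoothQ fun p => fderiv ℝ f p v := by
  have h : ContDiffOn ℝ ((⊤ : ℕ∞) : WithTop ℕ∞) (fderiv ℝ f) quadrant :=
    ContDiffOn.fderiv_of_isOpen hf isOpen_quadrant (by simp)
  exact h.clm_apply contDiffOn_const

lemma SmoothQ.dt {f : ℝ × ℝ → ℂ} (hf : SmoothQ f) : SmoothQ (dt f) :=
  (hf.fderiv_apply (1, 0)).congr (dt_eq_fderiv hf).symm

lemma SmoothQ.dx {f : ℝ × ℝ → ℂ} (hf : SmoothQ f) : SmoothQ (dx f) :=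
  (hf.fderiv_apply (0, 1)).congr (dx_eq_fderiv hf).symm

lemma SmoothQ.add {f g : ℝ × ℝ → ℂ} (hf : SmoothQ f) (hg : SmoothQ g) :
    SmoothQ fun p => f p + g p := ContDiffOn.add hf hg

lemma SmoothQ.mul {f g : ℝ × ℝ → ℂ} (hf : SmoothQ f) (hg : SmoothQ g) :
    SmoothQ fun p => f p * g p := ContDiffOn.mul hf hg

lemma SmoothQ.neg {f : ℝ × ℝ → ℂ} (hf : SmoothQ f) : SmoothQ fun p => -f p := ContDiffOn.neg hf

lemma smoothQ_const (c : ℂ) : SmoothQ fun _ => c := contDiffOn_const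

lemma SmoothQ.inv {f : ℝ × ℝ → ℂ} (hf : SmoothQ f) (h : ∀ p ∈ quadrant, f p ≠ 0) :
    SmoothQ fun p => (f p)⁻¹ := ContDiffOn.inv hf h

lemma smoothQ_ofReal {f : ℝ × ℝ → ℝ}
    (hf : ContDiffOn ℝ ((⊤ : ℕ∞) : WithTop ℕ∞) f quadrant) : SmoothQ fun p => (f p : ℂ) :=
  Complex.ofRealCLM.contDiff.comp_contDiffOn hf

lemma smoothQ_fst : SmoothQ fun p => (p.1 : ℂ) := smoothQ_ofReal contDiff_fst.contDiffOn

lemma smoothQ_snd : SmoothQ fun p => (p.2 : ℂ) := smoothQ_ofReal contDiff_snd.contDiffOn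

lemma SmoothQ.div {f g : ℝ × ℝ → ℂ} (hf : SmoothQ f) (hg : SmoothQ g)
    (h : ∀ p ∈ quadrant, g p ≠ 0) : SmoothQ fun p => f p / g p := by
  simpa only [div_eq_mul_inv] using hf.mul (hg.inv h)

lemma SmoothQ.pow {f : ℝ × ℝ → ℂ} (hf : SmoothQ f) (n : ℕ) : SmoothQ fun p => f p ^ n :=
  ContDiffOn.pow hf n

lemma fst_ne_zero {p : ℝ × ℝ} (hp : p ∈ quadrant) : (p.1 : ℂ) ≠ 0 := by
  exact_mod_cast (ne_of_gt hp.1)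

lemma snd_ne_zero {p : ℝ × ℝ} (hp : p ∈ quadrant) : (p.2 : ℂ) ≠ 0 := by
  exact_mod_cast (ne_of_gt hp.2)

lemma dt_dx_comm {f : ℝ × ℝ → ℂ} (hf : SmoothQ f) : EqOn (dt (dx f)) (dx (dt f)) quadrant := by
  intro p hp
  have hd : DifferentiableAt ℝ (fderiv ℝ f) p :=
    ((hf.contDiffAt hp).fderiv_right (m := 1) (by norm_cast)).differentiableAt (by simp)
  have key : ∀ v w : ℝ × ℝ, fderiv ℝ (fun q => fderiv ℝ f q v) p w =
      fderiv ℝ (fderiv ℝ f) p w v := by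
    intro v w
    rw [fderiv_clm_apply hd (differentiableAt_const v)]
    simp
  rw [EqOn.dt (dx_eq_fderiv hf) hp, EqOn.dx (dt_eq_fderiv hf) hp,
    dt_eq_fderiv (hf.fderiv_apply _) hp, dx_eq_fderiv (hf.fderiv_apply _) hp]
  simp only [key]
  exact (hf.contDiffAt hp).isSymmSndFDerivAt (by simp; norm_cast) _ _

lemma dt_const_mul (c : ℂ) (f : ℝ × ℝ → ℂ) : dt (fun p => c * f p) = fun p => c * dt f p := by
  funext p; exact deriv_const_mul_field c

lemma dx_const_mul (c : ℂ) (f : ℝ × ℝ → ℂ) : dx (fun p => c * f p) = fun p => c * dx f p := by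
  funext p; exact deriv_const_mul_field c

/-- The properties of a linear differential operator on the quadrant with smooth coefficients
that do not depend on the time variable. -/
structure IsTimeInvariant (D : (ℝ × ℝ → ℂ) → ℝ × ℝ → ℂ) : Prop where
  congr : ∀ {f g}, EqOn f g quadrant → EqOn (D f) (D g) quadrant
  smooth : ∀ {f}, SmoothQ f → SmoothQ (D f)
  const_mul : ∀ c f, D (fun p => c * f p) = fun p => c * D f p
  dt_comm : ∀ {f}, SmoothQ f → EqOn (dt (D f)) (D (dt f)) quadrant

lemma isTimeInvariant_dx : IsTimeInvariant dx :=
  ⟨EqOn.dx, SmoothQ.dx, dx_const_mul, dt_dx_comm⟩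

lemma smoothQ_potential (u : ℝ) : SmoothQ fun p => (u : ℂ) / (p.2 : ℂ) ^ 2 :=
  (smoothQ_const u).div (smoothQ_snd.pow 2) fun _ hp => pow_ne_zero 2 (snd_ne_zero hp)

lemma isTimeInvariant_centrifugalOp (u : ℝ) : IsTimeInvariant (centrifugalOp u) where
  congr h _ hp := by
    simp only [centrifugalOp]
    rw [EqOn.dx (EqOn.dx h) hp, h hp]
  smooth h := h.dx.dx.neg.add ((smoothQ_potential u).mul h)
  const_mul c f := by
    funext p
    simp only [centrifugalOp, dx_const_mul]
    ring
  dt_comm {f} h p hp := by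
    have e1 : HasDerivAt (fun s : ℝ => dx (dx f) (s, p.2)) (dt (dx (dx f)) p) p.1 :=
      (hasDerivAt_fst_of_hasFDerivAt
        (h.dx.dx.differentiableAt hp).hasFDerivAt).differentiableAt.hasDerivAt
    have e2 : HasDerivAt (fun s : ℝ => f (s, p.2)) (dt f p) p.1 :=
      (hasDerivAt_fst_of_hasFDerivAt
        (h.differentiableAt hp).hasFDerivAt).differentiableAt.hasDerivAt
    have e3 := e1.neg.add (e2.const_mul ((u : ℂ) / (p.2 : ℂ) ^ 2))
    have e4 : dt (centrifugalOp u f) p = -dt (dx (dx f)) p + u / p.2 ^ 2 * dt f p := e3.deriv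
    rw [e4, centrifugalOp, dt_dx_comm h.dx hp, EqOn.dx (dt_dx_comm h) hp]

lemma IsTimeInvariant.iterate {D : (ℝ × ℝ → ℂ) → ℝ × ℝ → ℂ} (hD : IsTimeInvariant D) (n : ℕ) :
    IsTimeInvariant D^[n] := by
  induction n with
  | zero => exact ⟨fun h => h, fun h => h, fun _ _ => rfl, fun _ => eqOn_refl _ _⟩
  | succ n ih =>
    simp only [Function.iterate_succ']
    refine ⟨fun h => hD.congr (ih.congr h), fun h => hD.smooth (ih.smooth h), fun c f => ?_,
      fun {f} h => ?_⟩
    · simp only [Function.comp_apply, ih.const_mul, hD.const_mul]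
    · exact (hD.dt_comm (ih.smooth h)).trans (hD.congr (ih.dt_comm h))

lemma SmoothQ.iterate_dt {f : ℝ × ℝ → ℂ} (hf : SmoothQ f) (m : ℕ) :
    SmoothQ (Centrifugal.dt^[m] f) := by
  induction m with
  | zero => exact hf
  | succ m ih => rw [Function.iterate_succ_apply']; exact ih.dt

lemma IsTimeInvariant.iterate_dt_comm {D : (ℝ × ℝ → ℂ) → ℝ × ℝ → ℂ} (hD : IsTimeInvariant D)
    {f : ℝ × ℝ → ℂ} (hf : SmoothQ f) (m : ℕ) :
    EqOn (dt^[m] (D f)) (D (dt^[m] f)) quadrant := by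
  induction m with
  | zero => exact eqOn_refl _ _
  | succ m ih =>
    simp only [Function.iterate_succ_apply']
    exact (EqOn.dt ih).trans (hD.dt_comm (hf.iterate_dt m))

/-- The Schrödinger equation reads `∂/∂t = (2i)⁻¹ (-∂²/∂x² + u/x²)`, and the two sides commute. -/
lemma iterate_dt_of_schrodinger {u : ℝ} {f : ℝ × ℝ → ℂ} (hf : SmoothQ f)
    (hS : ∀ p ∈ quadrant, Complex.I * dt f p = hamiltonian u f p) (m : ℕ) :
    EqOn (dt^[m] f) (fun p => 1 / (2 * Complex.I) ^ m * (centrifugalOp u)^[m] f p) quadrant := by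
  have h1 : EqOn (dt f) (fun p => 1 / (2 * Complex.I) * centrifugalOp u f p) quadrant := by
    intro p hp
    have := hS p hp
    simp only [hamiltonian, centrifugalOp] at this ⊢
    field_simp
    linear_combination 2 * this
  induction m with
  | zero => intro p _; simp
  | succ m ih =>
    have hL := isTimeInvariant_centrifugalOp u
    rw [Function.iterate_succ_apply']
    intro p hp
    rw [EqOn.dt ih hp, dt_const_mul]
    simp only
    rw [(hL.iterate m).dt_comm hf hp, (hL.iterate m).congr h1 hp, (hL.iterate m).const_mul,
      Function.iterate_succ_apply, pow_succ]
    simp only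
    ring

/-- The mixed derivatives of a smooth solution of the Schrödinger equation. -/
theorem iterate_dt_iterate_dx_of_schrodinger {u : ℝ} {f : ℝ × ℝ → ℂ} (hf : SmoothQ f)
    (hS : ∀ p ∈ quadrant, Complex.I * dt f p = hamiltonian u f p) (m n : ℕ) {p : ℝ × ℝ}
    (hp : p ∈ quadrant) :
    (dt^[m] (dx^[n] f)) p =
      1 / (2 * Complex.I) ^ m * (dx^[n] ((centrifugalOp u)^[m] f)) p := by
  have hD := isTimeInvariant_dx.iterate n
  rw [hD.iterate_dt_comm hf m hp, hD.congr (iterate_dt_of_schrodinger hf hS m) hp, hD.const_mul]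

/-! ### Operators generated by the moments -/

/-- The operators from data to functions on the quadrant that are finite sums of moments with
smooth coefficients, up to equality on the quadrant. -/
inductive FresnelOp : ((ℂ → ℂ) → ℝ × ℝ → ℂ) → Prop
  | moment (g : ℝ × ℝ → ℂ) (hg : SmoothQ g) (μ s : ℝ) (hμ : 0 ≤ μ) (hs : -1 < s) :
      FresnelOp fun Y p => g p * moment Y μ s p
  | add (T T' : (ℂ → ℂ) → ℝ × ℝ → ℂ) (h : FresnelOp T) (h' : FresnelOp T') :
      FresnelOp fun Y p => T Y p + T' Y p
  | congr (T T' : (ℂ → ℂ) → ℝ × ℝ → ℂ) (h : FresnelOp T)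
      (h' : ∀ A B Y, ExpBounded A B Y → EqOn (T Y) (T' Y) quadrant) : FresnelOp T'

namespace FresnelOp

variable {T : (ℂ → ℂ) → ℝ × ℝ → ℂ}

lemma smoothQ (hT : FresnelOp T) {A B : ℝ} {Y : ℂ → ℂ} (hY : ExpBounded A B Y) :
    SmoothQ (T Y) := by
  induction hT with
  | moment g hg μ s hμ hs => exact hg.mul (contDiffOn_moment hY hμ hs)
  | add T T' _ _ ih ih' => exact ih.add ih'
  | congr T T' _ h' ih => exact ih.congr (h' A B Y hY)

lemma mul_left (hT : FresnelOp T) {g : ℝ × ℝ → ℂ} (hg : SmoothQ g) :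
    FresnelOp fun Y p => g p * T Y p := by
  induction hT with
  | moment f hf μ s hμ hs =>
    refine congr _ _ (moment (fun p => g p * f p) (hg.mul hf) μ s hμ hs) fun A B Y _ p _ => ?_
    ring
  | add T T' _ _ ih ih' =>
    refine congr _ _ (add _ _ ih ih') fun A B Y _ p _ => ?_
    ring
  | congr T T' _ h' ih =>
    refine congr _ _ ih fun A B Y hY p hp => ?_
    simp only [h' A B Y hY hp]

lemma hasDerivAt_snd {f : ℝ × ℝ → ℂ} (hf : SmoothQ f) {p : ℝ × ℝ} (hp : p ∈ quadrant) :
    HasDerivAt (fun y : ℝ => f (p.1, y)) (Centrifugal.dx f p) p.2 :=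
  (hasDerivAt_snd_of_hasFDerivAt
    (hf.differentiableAt hp).hasFDerivAt).differentiableAt.hasDerivAt

lemma hasDerivAt_fst {f : ℝ × ℝ → ℂ} (hf : SmoothQ f) {p : ℝ × ℝ} (hp : p ∈ quadrant) :
    HasDerivAt (fun y : ℝ => f (y, p.2)) (Centrifugal.dt f p) p.1 :=
  (hasDerivAt_fst_of_hasFDerivAt
    (hf.differentiableAt hp).hasFDerivAt).differentiableAt.hasDerivAt

end FresnelOp

lemma hasDerivAt_moment_snd {A B μ s : ℝ} {Y : ℂ → ℂ} (hY : ExpBounded A B Y)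
    (hμ : 0 ≤ μ) (hs : -1 < s) {p : ℝ × ℝ} (hp : p ∈ quadrant) :
    HasDerivAt (fun y : ℝ => moment Y μ s (p.1, y))
      (-(Complex.I * p.2 / (2 * p.1 ^ 2)) * moment Y (μ + 1) (s + 2) p) p.2 := by
  have := hasDerivAt_snd_of_hasFDerivAt (hasFDerivAt_moment hY hμ hs hp)
  simpa [partials_apply] using this

lemma hasDerivAt_moment_fst {A B μ s : ℝ} {Y : ℂ → ℂ} (hY : ExpBounded A B Y)
    (hμ : 0 ≤ μ) (hs : -1 < s) {p : ℝ × ℝ} (hp : p ∈ quadrant) :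
    HasDerivAt (fun t : ℝ => moment Y μ s (t, p.2))
      (1 / (2 * p.1 ^ 2) * moment Y μ (s + 2) p +
        Complex.I * p.2 ^ 2 / (2 * p.1 ^ 3) * moment Y (μ + 1) (s + 2) p) p.1 := by
  have := hasDerivAt_fst_of_hasFDerivAt (hasFDerivAt_moment hY hμ hs hp)
  simpa [partials_apply] using this

namespace FresnelOp

variable {T : (ℂ → ℂ) → ℝ × ℝ → ℂ}

lemma dx (hT : FresnelOp T) : FresnelOp fun Y => dx (T Y) := by
  induction hT with
  | moment g hg μ s hμ hs =>
    have hc : SmoothQ fun p => -(Complex.I * p.2 / (2 * (p.1 : ℂ) ^ 2)) :=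
      (((smoothQ_const _).mul smoothQ_snd).div ((smoothQ_const _).mul (smoothQ_fst.pow 2))
        fun p hp => by simpa using fst_ne_zero hp).neg
    refine congr _ _ (add _ _ (moment (Centrifugal.dx g) hg.dx μ s hμ hs)
      (moment (fun p => g p * -(Complex.I * p.2 / (2 * (p.1 : ℂ) ^ 2))) (hg.mul hc)
        (μ + 1) (s + 2) (by linarith) (by linarith))) fun A B Y hY p hp => ?_
    refine Eq.trans ?_ ((hasDerivAt_snd hg hp).mul (hasDerivAt_moment_snd hY hμ hs hp)).deriv.symm
    simp only [mul_assoc, Prod.mk.eta]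
  | add T T' hT hT' ih ih' =>
    refine congr _ _ (add _ _ ih ih') fun A B Y hY p hp => ?_
    exact ((hasDerivAt_snd (hT.smoothQ hY) hp).add
      (hasDerivAt_snd (hT'.smoothQ hY) hp)).deriv.symm
  | congr T T' _ h' ih =>
    exact congr _ _ ih fun A B Y hY => EqOn.dx (h' A B Y hY)

lemma dt (hT : FresnelOp T) : FresnelOp fun Y => dt (T Y) := by
  induction hT with
  | moment g hg μ s hμ hs =>
    have hc1 : SmoothQ fun p => 1 / (2 * (p.1 : ℂ) ^ 2) :=
      (smoothQ_const _).div ((smoothQ_const _).mul (smoothQ_fst.pow 2))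
        fun p hp => by simpa using fst_ne_zero hp
    have hc2 : SmoothQ fun p => Complex.I * p.2 ^ 2 / (2 * (p.1 : ℂ) ^ 3) :=
      ((smoothQ_const _).mul (smoothQ_snd.pow 2)).div ((smoothQ_const _).mul (smoothQ_fst.pow 3))
        fun p hp => by simpa using fst_ne_zero hp
    refine congr _ _ (add _ _ (moment (Centrifugal.dt g) hg.dt μ s hμ hs) (add _ _
      (moment _ (hg.mul hc1) μ (s + 2) hμ (by linarith))
      (moment _ (hg.mul hc2) (μ + 1) (s + 2) (by linarith) (by linarith))))
      fun A B Y hY p hp => ?_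
    refine Eq.trans ?_ ((hasDerivAt_fst hg hp).mul (hasDerivAt_moment_fst hY hμ hs hp)).deriv.symm
    simp only [mul_assoc, Prod.mk.eta, mul_add]
  | add T T' hT hT' ih ih' =>
    refine congr _ _ (add _ _ ih ih') fun A B Y hY p hp => ?_
    exact ((hasDerivAt_fst (hT.smoothQ hY) hp).add
      (hasDerivAt_fst (hT'.smoothQ hY) hp)).deriv.symm
  | congr T T' _ h' ih =>
    exact congr _ _ ih fun A B Y hY => EqOn.dt (h' A B Y hY)

lemma centrifugalOp (hT : FresnelOp T) (u : ℝ) : FresnelOp fun Y => centrifugalOp u (T Y) := by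
  refine congr _ _ (add _ _ (hT.dx.dx.mul_left (smoothQ_const (-1)))
    (hT.mul_left (smoothQ_potential u))) fun A B Y hY p hp => ?_
  simp only [Centrifugal.centrifugalOp, neg_one_mul]

lemma iterate {D : (ℝ × ℝ → ℂ) → ℝ × ℝ → ℂ}
    (hD : ∀ {T}, FresnelOp T → FresnelOp fun Y => D (T Y)) (hT : FresnelOp T) (n : ℕ) :
    FresnelOp fun Y => D^[n] (T Y) := by
  induction n with
  | zero => exact hT
  | succ n ih => simp only [Function.iterate_succ_apply']; exact hD ih

lemma tendstoUniformlyOn (hT : FresnelOp T) {A B : ℝ} {Y : ℕ → ℂ → ℂ} {Z : ℂ → ℂ}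
    (hY : ∀ᶠ N in atTop, ExpBounded A B (Y N)) (hZ : ExpBounded A B Z)
    (hlim : ∀ z, Tendsto (fun N => Y N z) atTop (𝓝 (Z z)))
    {K : Set (ℝ × ℝ)} (hK : IsCompact K) (hKq : K ⊆ quadrant) :
    TendstoUniformlyOn (fun N => T (Y N)) (T Z) atTop K := by
  induction hT with
  | moment g hg μ s hμ hs =>
    have hm := tendstoUniformlyOn_moment hY hZ hlim hμ hs hK hKq
    obtain ⟨M, hM⟩ := hK.exists_bound_of_continuousOn ((ContDiffOn.continuousOn hg).mono hKq)
    rw [Metric.tendstoUniformlyOn_iff] at hm ⊢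
    intro ε hε
    have hM1 : 0 < |M| + 1 := by positivity
    filter_upwards [hm (ε / (|M| + 1)) (by positivity)] with N hN p hp
    have h1 := hN p hp
    rw [dist_eq_norm] at h1 ⊢
    rw [← mul_sub, norm_mul]
    calc _ ≤ (|M| + 1) * ‖Centrifugal.moment Z μ s p - Centrifugal.moment (Y N) μ s p‖ := by
          gcongr
          linarith [hM p hp, le_abs_self M]
      _ < (|M| + 1) * (ε / (|M| + 1)) := by gcongr
      _ = ε := by field_simp
  | add T T' _ _ ih ih' => exact ih.add ih'
  | congr T T' _ h' ih =>
    have h1 : TendstoUniformlyOn (fun N => T (Y N)) (T' Z) atTop K :=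
      ih.congr_right fun p hp => h' A B Z hZ (hKq hp)
    refine h1.congr ?_
    filter_upwards [hY] with N hN p hp using h' A B _ hN (hKq hp)

end FresnelOp

/-! ### The Schrödinger equation for the evolution -/

/-- The factor of `evolve` that does not depend on the datum. -/
def prefactor (u : ℝ) (p : ℝ × ℝ) : ℂ :=
  (-Complex.I) ^ ((besselIndex u : ℂ) + 1) / ((2 ^ besselIndex u : ℝ) : ℂ) *
    Complex.exp (Complex.I * (((besselIndex u + 1 / 2 : ℝ) : ℂ) + 1) * Real.pi / 4) *
    (Complex.exp (Complex.I * (p.2 ^ 2 / (2 * p.1))) *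
      ((p.2 ^ (besselIndex u + 1 / 2) / p.1 ^ (besselIndex u + 1) : ℝ) : ℂ))

lemma besselIndex_nonneg (u : ℝ) : 0 ≤ besselIndex u := by
  rw [besselIndex]; positivity

lemma evolve_eq_prefactor_mul_moment (u : ℝ) (Y : ℂ → ℂ) {p : ℝ × ℝ} (hp : p ∈ quadrant) :
    evolve u Y p = prefactor u p * moment Y (besselIndex u) (besselIndex u + 1 / 2) p := by
  have h : ¬ 0 < -(1 / (2 * p.1)) := by
    have : 0 < p.1 := hp.1
    have : 0 < 1 / (2 * p.1) := by positivity
    linarith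
  rw [evolve, fresnelReg, if_neg h, prefactor, moment]
  simp only [kernel, rot]
  ring_nf

lemma smoothQ_prefactor (u : ℝ) : SmoothQ (prefactor u) := by
  refine (smoothQ_const _).mul (SmoothQ.mul ?_ ?_)
  · have h := (smoothQ_const Complex.I).mul ((smoothQ_snd.pow 2).div
      ((smoothQ_const 2).mul smoothQ_fst) fun p hp => by simpa using fst_ne_zero hp)
    exact ContDiffOn.cexp h
  · refine smoothQ_ofReal (ContDiffOn.div ?_ ?_ ?_)
    · exact contDiff_snd.contDiffOn.rpow_const_of_ne fun p hp => ne_of_gt hp.2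
    · exact contDiff_fst.contDiffOn.rpow_const_of_ne fun p hp => ne_of_gt hp.1
    · exact fun p hp => (Real.rpow_pos_of_pos hp.1 _).ne'

theorem fresnelOp_evolve (u : ℝ) : FresnelOp (evolve u) := by
  have h := besselIndex_nonneg u
  exact .congr _ _ (.moment _ (smoothQ_prefactor u) (besselIndex u) (besselIndex u + 1 / 2) h
    (by linarith)) fun A B Y _ p hp => (evolve_eq_prefactor_mul_moment u Y hp).symm

lemma hasDerivAt_prefactor_snd (u : ℝ) {p : ℝ × ℝ} (hp : p ∈ quadrant) :
    HasDerivAt (fun y : ℝ => prefactor u (p.1, y))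
      ((Complex.I * p.2 / p.1 + (besselIndex u + 1 / 2) / p.2) * prefactor u p) p.2 := by
  have ht := fst_ne_zero hp
  have hx := snd_ne_zero hp
  have hp2 : 0 < p.2 := hp.2
  have h1 : HasDerivAt (fun y : ℝ => Complex.exp (Complex.I * ((y : ℂ) ^ 2 / (2 * p.1))))
      (Complex.exp (Complex.I * (p.2 ^ 2 / (2 * p.1))) * (Complex.I * p.2 / p.1)) p.2 := by
    have := ((((hasDerivAt_id (p.2 : ℂ)).pow 2).div_const (2 * (p.1 : ℂ))).const_mul
      Complex.I).cexp.comp_ofReal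
    refine this.congr_deriv ?_
    simp
    field_simp
  have h2 : HasDerivAt (fun y : ℝ => ((y ^ (besselIndex u + 1 / 2) / p.1 ^ (besselIndex u + 1) : ℝ)
      : ℂ)) ((besselIndex u + 1 / 2) / p.2 *
        ((p.2 ^ (besselIndex u + 1 / 2) / p.1 ^ (besselIndex u + 1) : ℝ) : ℂ)) p.2 := by
    have := ((Real.hasDerivAt_rpow_const (p := besselIndex u + 1 / 2)
      (Or.inl hp2.ne')).div_const (p.1 ^ (besselIndex u + 1))).ofReal_comp
    refine this.congr_deriv ?_
    rw [Real.rpow_sub_one hp2.ne']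
    push_cast
    ring
  refine ((h1.mul h2).const_mul _).congr_deriv ?_
  rw [prefactor]
  ring

lemma hasDerivAt_prefactor_fst (u : ℝ) {p : ℝ × ℝ} (hp : p ∈ quadrant) :
    HasDerivAt (fun t : ℝ => prefactor u (t, p.2))
      ((-(Complex.I * p.2 ^ 2 / (2 * p.1 ^ 2)) - (besselIndex u + 1) / p.1) * prefactor u p)
      p.1 := by
  have ht := fst_ne_zero hp
  have hx := snd_ne_zero hp
  have hp1 : 0 < p.1 := hp.1
  have h1 : HasDerivAt (fun t : ℝ => Complex.exp (Complex.I * ((p.2 : ℂ) ^ 2 / (2 * t))))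
      (Complex.exp (Complex.I * (p.2 ^ 2 / (2 * p.1))) *
        -(Complex.I * p.2 ^ 2 / (2 * p.1 ^ 2))) p.1 := by
    have := (((hasDerivAt_const (p.1 : ℂ) ((p.2 : ℂ) ^ 2)).div
      ((hasDerivAt_id (p.1 : ℂ)).const_mul 2) (by simpa using ht)).const_mul
      Complex.I).cexp.comp_ofReal
    refine this.congr_deriv ?_
    simp
    field_simp
  have h2 : HasDerivAt (fun t : ℝ => ((p.2 ^ (besselIndex u + 1 / 2) / t ^ (besselIndex u + 1) : ℝ)
      : ℂ)) (-((besselIndex u + 1) / p.1) *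
        ((p.2 ^ (besselIndex u + 1 / 2) / p.1 ^ (besselIndex u + 1) : ℝ) : ℂ)) p.1 := by
    have h3 := Real.hasDerivAt_rpow_const (p := besselIndex u + 1) (Or.inl hp1.ne')
    have hpos := (Real.rpow_pos_of_pos hp1 (besselIndex u + 1)).ne'
    have := ((hasDerivAt_const p.1 (p.2 ^ (besselIndex u + 1 / 2))).div h3 hpos).ofReal_comp
    refine this.congr_deriv ?_
    have hpos' : ((p.1 ^ (besselIndex u + 1) : ℝ) : ℂ) ≠ 0 := by exact_mod_cast hpos
    rw [Real.rpow_sub_one hp1.ne']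
    push_cast
    field_simp
    ring
  refine ((h1.mul h2).const_mul _).congr_deriv ?_
  rw [prefactor]
  ring

/-- The Bessel recurrence, integrated against the Gaussian and the datum. -/
lemma moment_recurrence {A B μ s : ℝ} {Y : ℂ → ℂ} (hY : ExpBounded A B Y)
    (hμ : 0 ≤ μ) (hs : -1 < s) {p : ℝ × ℝ} (hp : p ∈ quadrant) :
    moment Y μ s p = (μ + 1) * moment Y (μ + 1) s p -
      Complex.I * p.2 ^ 2 / (4 * p.1 ^ 2) * moment Y (μ + 2) (s + 2) p := by
  have ht := fst_ne_zero hp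
  have i1 := integrableOn_kernel_mul hY (by linarith : 0 ≤ μ + 1) hs hp.1
  have i2 := integrableOn_kernel_mul hY (by linarith : 0 ≤ μ + 2) (by linarith : -1 < s + 2) hp.1
  simp only [moment]
  rw [← integral_const_mul, ← integral_const_mul, ← integral_sub (i1.const_mul _) (i2.const_mul _)]
  refine setIntegral_congr_fun measurableSet_Ioi fun y hy => ?_
  have hy : 0 < y := hy
  have hys : y ^ (s + 2) = y ^ s * y ^ 2 := by
    rw [Real.rpow_add hy]; norm_num
  simp only [kernel]
  rw [besselE_recurrence hμ, hys, ← rot_sq]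
  push_cast
  field_simp
  ring

/-- After two derivatives in `x` and one in `t` the equation is a linear relation between the
moments of indices `μ = ν, ν + 1, ν + 2`, where `ν` is the Bessel index; it is the recurrence
`moment_recurrence` with `μ = ν` and `s = ν + 1/2 + 2`, since `u = ν² - 1/4`. -/
theorem schrodinger_evolve {u : ℝ} (hu : 0 < u) {A B : ℝ} {Y : ℂ → ℂ} (hY : ExpBounded A B Y)
    {p : ℝ × ℝ} (hp : p ∈ quadrant) :
    Complex.I * dt (evolve u Y) p = hamiltonian u (evolve u Y) p := by
  set ν := besselIndex u with hν
  have hν0 : 0 ≤ ν := besselIndex_nonneg u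
  have hνu : (u : ℂ) = ν ^ 2 - 1 / 4 := by
    have : u = ν ^ 2 - 1 / 4 := by
      rw [hν, besselIndex, div_pow, Real.sq_sqrt (by positivity)]; ring
    rw [this]; push_cast; ring
  have hs : -1 < ν + 1 / 2 := by linarith
  have hev : EqOn (evolve u Y) (fun q => prefactor u q * moment Y ν (ν + 1 / 2) q) quadrant :=
    fun q hq => evolve_eq_prefactor_mul_moment u Y hq
  have hdt : dt (evolve u Y) p = _ := (EqOn.dt hev hp).trans
    ((hasDerivAt_prefactor_fst u hp).mul (hasDerivAt_moment_fst hY hν0 hs hp)).deriv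
  have hdx : EqOn (dx (evolve u Y)) (fun q => prefactor u q *
      ((Complex.I * q.2 / q.1 + (ν + 1 / 2) / q.2) * moment Y ν (ν + 1 / 2) q -
        Complex.I * q.2 / (2 * q.1 ^ 2) * moment Y (ν + 1) (ν + 1 / 2 + 2) q)) quadrant := by
    intro q hq
    refine (EqOn.dx hev hq).trans (((hasDerivAt_prefactor_snd u hq).mul
      (hasDerivAt_moment_snd hY hν0 hs hq)).deriv.trans ?_)
    simp only [Prod.mk.eta, ← hν]
    ring
  have ht := fst_ne_zero hp
  have hx := snd_ne_zero hp
  have hid : HasDerivAt (fun y : ℝ => (y : ℂ)) 1 p.2 := (hasDerivAt_id p.2).ofReal_comp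
  have hc1 : HasDerivAt (fun y : ℝ => Complex.I * y / p.1 + ((ν : ℂ) + 1 / 2) / y)
      (Complex.I / p.1 - (ν + 1 / 2) / p.2 ^ 2) p.2 := by
    refine (((hid.const_mul Complex.I).div_const (p.1 : ℂ)).add
      ((hasDerivAt_const p.2 ((ν : ℂ) + 1 / 2)).div hid hx)).congr_deriv ?_
    ring
  have hc2 : HasDerivAt (fun y : ℝ => Complex.I * y / (2 * (p.1 : ℂ) ^ 2))
      (Complex.I / (2 * p.1 ^ 2)) p.2 := by
    refine ((hid.const_mul Complex.I).div_const (2 * (p.1 : ℂ) ^ 2)).congr_deriv ?_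
    ring
  have hdxx : dx (dx (evolve u Y)) p = _ := (EqOn.dx hdx hp).trans
    ((hasDerivAt_prefactor_snd u hp).mul ((hc1.mul (hasDerivAt_moment_snd hY hν0 hs hp)).sub
      (hc2.mul (hasDerivAt_moment_snd hY (by linarith : 0 ≤ ν + 1)
        (by linarith : -1 < ν + 1 / 2 + 2) hp)))).deriv
  have hrec := moment_recurrence hY hν0 (by linarith : -1 < ν + 1 / 2 + 2) hp
  rw [hamiltonian, hdt, hdxx, hev hp]
  simp only [Prod.mk.eta, Pi.sub_apply, Pi.mul_apply, ← hν]
  rw [hνu, hrec, show ν + 1 + 1 = ν + 2 by ring]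
  field_simp
  ring

/-! ### Superoscillating data -/

/-- The plane wave `z ↦ e^{iλz}` as an entire function. -/
def planeWave (lam : ℝ) (z : ℂ) : ℂ := Complex.exp (Complex.I * lam * z)

/-- The superoscillating sequence `∑_j C_j(N,a) e^{i(1-2j/N)z}`. -/
def superosc (a : ℝ) (N : ℕ) (z : ℂ) : ℂ :=
  ∑ j ∈ Finset.range (N + 1), (coeff N j a : ℂ) * planeWave (1 - 2 * (j : ℝ) / (N : ℝ)) z

lemma phi_eq_evolve (u lam : ℝ) : phi u lam = evolve u (planeWave lam) := rfl

lemma expBounded_planeWave (lam : ℝ) : ExpBounded 1 |lam| (planeWave lam) := by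
  refine ⟨by unfold planeWave; fun_prop, fun z => ?_⟩
  refine (Complex.norm_exp_le_exp_norm _).trans ?_
  rw [one_mul, norm_mul, norm_mul, Complex.norm_I, one_mul, Complex.norm_real, Real.norm_eq_abs]

lemma ExpBounded.mono {A B A' B' : ℝ} {Y : ℂ → ℂ} (h : ExpBounded A B Y) (hA : A ≤ A')
    (hB : B ≤ B') : ExpBounded A' B' Y := by
  refine ⟨h.1, fun z => (h.2 z).trans ?_⟩
  have h0 : 0 ≤ A := by
    have := (norm_nonneg _).trans (h.2 0)
    simpa using this
  have : 0 ≤ A' := h0.trans hA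
  gcongr

/-- Linearity of the evolution in the datum. -/
lemma evolve_sum {u : ℝ} {ι : Type*} (s : Finset ι) (c : ι → ℂ) (Y : ι → ℂ → ℂ)
    {A B : ι → ℝ} (hY : ∀ i ∈ s, ExpBounded (A i) (B i) (Y i)) {p : ℝ × ℝ} (hp : p ∈ quadrant) :
    evolve u (fun z => ∑ i ∈ s, c i * Y i z) p = ∑ i ∈ s, c i * evolve u (Y i) p := by
  have h := besselIndex_nonneg u
  simp only [evolve_eq_prefactor_mul_moment u _ hp, moment, Finset.mul_sum]
  rw [integral_finsetSum, Finset.mul_sum]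
  · refine Finset.sum_congr rfl fun i _ => ?_
    rw [mul_left_comm (c i), ← integral_const_mul (c i)]
    congr 2
    funext y
    ring
  · intro i hi
    refine ((integrableOn_kernel_mul (hY i hi) h
      (by linarith : -1 < besselIndex u + 1 / 2) hp.1).const_mul (c i)).congr
      (Eventually.of_forall fun y => ?_)
    simp only
    ring

lemma psi_eq_evolve (u a : ℝ) (N : ℕ) : EqOn (psi u a N) (evolve u (superosc a N)) quadrant := by
  intro p hp
  exact (evolve_sum _ _ _ (fun j _ => expBounded_planeWave _) hp).symm

/-- The binomial theorem. -/
lemma superosc_eq_pow (a : ℝ) {N : ℕ} (hN : 1 ≤ N) (z : ℂ) :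
    superosc a N z = (((1 + a) / 2 : ℝ) * Complex.exp (Complex.I * (z / N)) +
      ((1 - a) / 2 : ℝ) * Complex.exp (-(Complex.I * (z / N)))) ^ N := by
  have hN0 : (N : ℂ) ≠ 0 := by exact_mod_cast (by omega : N ≠ 0)
  rw [add_comm, add_pow, superosc]
  refine Finset.sum_congr rfl fun j hj => ?_
  have hj : j ≤ N := by simpa [Nat.lt_succ_iff] using hj
  rw [mul_pow, mul_pow, ← Complex.exp_nat_mul, ← Complex.exp_nat_mul, coeff, planeWave]
  have he : Complex.exp (Complex.I * ((1 - 2 * (j : ℝ) / (N : ℝ) : ℝ) : ℂ) * z) =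
      Complex.exp (j * -(Complex.I * (z / N))) *
        Complex.exp (((N - j : ℕ) : ℂ) * (Complex.I * (z / N))) := by
    rw [← Complex.exp_add]
    congr 1
    push_cast [Nat.cast_sub hj]
    field_simp
    ring
  rw [he]
  push_cast
  ring

/-- The exponential type of the superoscillating sequence does not depend on `N`. -/
lemma expBounded_superosc (a : ℝ) {N : ℕ} (hN : 1 ≤ N) :
    ExpBounded 1 (|(1 + a) / 2| + |(1 - a) / 2|) (superosc a N) := by
  set L := |(1 + a) / 2| + |(1 - a) / 2| with hL
  have hL1 : 1 ≤ L := by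
    have := abs_add_le ((1 + a) / 2) ((1 - a) / 2)
    rwa [show (1 + a) / 2 + (1 - a) / 2 = 1 by ring, abs_one] at this
  refine ⟨?_, fun z => ?_⟩
  · unfold superosc planeWave
    fun_prop
  have hN0 : (0 : ℝ) < N := by exact_mod_cast hN
  set r := ‖z‖ / N with hr
  have hr0 : 0 ≤ r := by positivity
  have hiz : ‖Complex.I * (z / N)‖ = r := by simp [hr]
  have e1 : ‖Complex.exp (Complex.I * (z / N)) - 1‖ ≤ Real.exp r - 1 := by
    rw [← hiz]
    simpa using Complex.norm_exp_sub_sum_le_exp_norm_sub_sum (Complex.I * (z / N)) 1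
  have e2 : ‖Complex.exp (-(Complex.I * (z / N))) - 1‖ ≤ Real.exp r - 1 := by
    rw [← hiz, ← norm_neg (Complex.I * (z / N))]
    simpa using Complex.norm_exp_sub_sum_le_exp_norm_sub_sum (-(Complex.I * (z / N))) 1
  have hbase : ‖((1 + a) / 2 : ℝ) * Complex.exp (Complex.I * (z / N)) +
      ((1 - a) / 2 : ℝ) * Complex.exp (-(Complex.I * (z / N)))‖ ≤ Real.exp (L * r) := by
    have e : ((1 + a) / 2 : ℝ) * Complex.exp (Complex.I * (z / N)) +
      ((1 - a) / 2 : ℝ) * Complex.exp (-(Complex.I * (z / N))) =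
      1 + (((1 + a) / 2 : ℝ) * (Complex.exp (Complex.I * (z / N)) - 1) +
        ((1 - a) / 2 : ℝ) * (Complex.exp (-(Complex.I * (z / N))) - 1)) := by
      push_cast; ring
    rw [e]
    calc _ ≤ 1 + (|(1 + a) / 2| * (Real.exp r - 1) + |(1 - a) / 2| * (Real.exp r - 1)) := by
          refine (norm_add_le _ _).trans (add_le_add (by simp) ((norm_add_le _ _).trans ?_))
          rw [norm_mul, norm_mul, Complex.norm_real, Complex.norm_real, Real.norm_eq_abs,
            Real.norm_eq_abs]
          gcongr
      _ = 1 + L * (Real.exp r - 1) := by rw [hL]; ring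
      _ ≤ (1 + (Real.exp r - 1)) ^ L :=
          -- Bernoulli's inequality turns the weight `L ≥ 1` into an exponent
          one_add_mul_self_le_rpow_one_add (by linarith [Real.exp_pos r]) hL1
      _ = Real.exp (L * r) := by
          rw [add_sub_cancel, ← Real.exp_mul, mul_comm]
  rw [superosc_eq_pow a hN, norm_pow, one_mul]
  calc _ ≤ Real.exp (L * r) ^ N := by gcongr
    _ = Real.exp (L * ‖z‖) := by
      rw [← Real.exp_nat_mul, hr]
      congr 1
      field_simp

/-- The base of the power is `1 + iaz/N + o(1/N)`. -/
lemma tendsto_superosc (a : ℝ) (z : ℂ) :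
    Tendsto (fun N => superosc a N z) atTop (𝓝 (planeWave a z)) := by
  set G : ℂ → ℂ := fun h => ((1 + a) / 2 : ℝ) * Complex.exp (Complex.I * (z * h)) +
    ((1 - a) / 2 : ℝ) * Complex.exp (-(Complex.I * (z * h))) with hG
  have hd : HasDerivAt G (Complex.I * a * z) 0 := by
    have h0 : HasDerivAt (fun h : ℂ => Complex.I * (z * h)) (Complex.I * z) 0 := by
      simpa using ((hasDerivAt_id (0 : ℂ)).const_mul z).const_mul Complex.I
    refine ((h0.cexp.const_mul _).add (h0.neg.cexp.const_mul _)).congr_deriv ?_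
    simp
    ring
  have hG0 : G 0 = 1 := by simp [hG]; ring
  have hslope := hd.tendsto_slope_zero
  have hseq : Tendsto (fun N : ℕ => ((N : ℂ))⁻¹) atTop (𝓝[≠] 0) := by
    refine tendsto_nhdsWithin_iff.2 ⟨tendsto_inv_atTop_nhds_zero_nat, ?_⟩
    filter_upwards [eventually_ge_atTop 1] with N hN
    simp only [mem_compl_iff, mem_singleton_iff, inv_eq_zero, Nat.cast_eq_zero]
    omega
  have hlim : Tendsto (fun N : ℕ => (N : ℂ) * (G ((N : ℂ)⁻¹) - 1)) atTop
      (𝓝 (Complex.I * a * z)) := by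
    refine (hslope.comp hseq).congr fun N => ?_
    simp [hG0]
  refine (Complex.tendsto_one_add_pow_exp_of_tendsto hlim).congr' ?_
  filter_upwards [eventually_ge_atTop 1] with N hN
  rw [superosc_eq_pow a hN, add_sub_cancel]
  simp only [hG, div_eq_mul_inv]

/-! ### Rotation of the contour in a sector -/

/-- The integral of `h` over the arc of radius `r` from angle `0` to angle `π/4`. -/
def arcIntegral (h : ℂ → ℂ) (r : ℝ) : ℂ :=
  Complex.I * ∫ θ in (0 : ℝ)..(Real.pi / 4),
    h (r * Complex.exp (θ * Complex.I)) * (r * Complex.exp (θ * Complex.I))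

lemma rot_eq : rot = Complex.exp (((Real.pi / 4 : ℝ) : ℂ) * Complex.I) := by
  rw [rot]; congr 1; push_cast; ring

lemma rot_eq_add : rot = ((Real.sqrt 2 / 2 : ℝ) : ℂ) + ((Real.sqrt 2 / 2 : ℝ) : ℂ) * Complex.I := by
  rw [rot_eq, Complex.exp_mul_I, ← Complex.ofReal_cos, ← Complex.ofReal_sin, Real.cos_pi_div_four,
    Real.sin_pi_div_four]

lemma re_mul_exp (r θ : ℝ) : ((r : ℂ) * Complex.exp (θ * Complex.I)).re = r * Real.cos θ := by
  rw [Complex.re_ofReal_mul, Complex.exp_ofReal_mul_I_re]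

lemma im_mul_exp (r θ : ℝ) : ((r : ℂ) * Complex.exp (θ * Complex.I)).im = r * Real.sin θ := by
  rw [Complex.im_ofReal_mul, Complex.exp_ofReal_mul_I_im]

lemma cos_pos_of_mem {θ : ℝ} (hθ : θ ∈ Icc 0 (Real.pi / 4)) : 0 < Real.cos θ :=
  Real.cos_pos_of_mem_Ioo ⟨by linarith [hθ.1, Real.pi_pos], by linarith [hθ.2, Real.pi_pos]⟩

lemma re_rot_mul {r : ℝ} : (rot * r).re = Real.sqrt 2 / 2 * r := by
  rw [rot_eq_add]; simp

lemma im_rot_mul {r : ℝ} : (rot * r).im = Real.sqrt 2 / 2 * r := by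
  rw [rot_eq_add]; simp

section Rotation

variable {h : ℂ → ℂ}

/-- Cauchy's theorem for a truncated sector of opening `π/4`. The exponential maps a rectangle
onto the truncated sector, so that the theorem for rectangles applies. -/
lemma sector_integral_sub (hd : DifferentiableOn ℂ h {z | 0 < z.re}) {ε R : ℝ} (hε : 0 < ε)
    (hR : 0 < R) :
    (∫ r in ε..R, h r) - rot * (∫ r in ε..R, h (rot * r)) +
      arcIntegral h R - arcIntegral h ε = 0 := by
  have hhalf : IsOpen {z : ℂ | 0 < z.re} := isOpen_lt continuous_const Complex.continuous_re
  have hcont : ContinuousOn h {z | 0 < z.re} := hd.continuousOn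
  set g : ℂ → ℂ := fun w => h (Complex.exp w) * Complex.exp w with hg
  have hmem : ∀ w : ℂ, w.im ∈ Icc 0 (Real.pi / 4) → 0 < (Complex.exp w).re := by
    intro w hw
    rw [Complex.exp_re]
    exact mul_pos (Real.exp_pos _) (cos_pos_of_mem hw)
  have hgd : DifferentiableOn ℂ g (uIcc (Real.log ε : ℂ).re ((Real.log R : ℂ) +
      ((Real.pi / 4 : ℝ) : ℂ) * Complex.I).re ×ℂ uIcc (Real.log ε : ℂ).im ((Real.log R : ℂ) +
      ((Real.pi / 4 : ℝ) : ℂ) * Complex.I).im) := by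
    intro w hw
    have hw2 := hw.2
    simp only [mem_preimage, Complex.ofReal_im, Complex.add_im, Complex.mul_im, Complex.ofReal_re,
      Complex.I_im, mul_one, Complex.I_re, mul_zero, add_zero, zero_add] at hw2
    rw [uIcc_of_le (by positivity)] at hw2
    have h1 := hd.differentiableAt (hhalf.mem_nhds (hmem w hw2))
    exact ((h1.comp w Complex.differentiableAt_exp).mul
      Complex.differentiableAt_exp).differentiableWithinAt
  have key := Complex.integral_boundary_rect_eq_zero_of_differentiableOn g _ _ hgd
  simp only [Complex.ofReal_im, Complex.add_im, Complex.mul_im, Complex.ofReal_re,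
      Complex.I_im, mul_one, Complex.I_re, mul_zero, add_zero, zero_add, Complex.add_re,
      Complex.mul_re, sub_self, Complex.ofReal_zero, zero_mul, smul_eq_mul] at key
  have himg : Real.exp '' uIcc (Real.log ε) (Real.log R) ⊆ Ioi 0 := by
    rintro _ ⟨s, _, rfl⟩; exact Real.exp_pos s
  have sub1 : (∫ s in Real.log ε..Real.log R, g s) = ∫ r in ε..R, h r := by
    have := intervalIntegral.integral_deriv_smul_comp'' (a := Real.log ε) (b := Real.log R)
      (f := Real.exp) (f' := Real.exp) (g := fun r : ℝ => h r) Real.continuous_exp.continuousOn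
      (fun s _ => (Real.hasDerivAt_exp s).hasDerivWithinAt) Real.continuous_exp.continuousOn ?_
    · rw [Real.exp_log hε, Real.exp_log hR] at this
      rw [← this]
      refine intervalIntegral.integral_congr fun s _ => ?_
      simp only [hg, Function.comp_apply, Complex.ofReal_exp, Complex.real_smul]
      ring
    · refine hcont.comp Complex.continuous_ofReal.continuousOn fun r hr => ?_
      have : 0 < r := himg hr
      simpa using this
  have sub2 : (∫ s in Real.log ε..Real.log R, g (s + ((Real.pi / 4 : ℝ) : ℂ) * Complex.I)) =
      rot * ∫ r in ε..R, h (rot * r) := by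
    have := intervalIntegral.integral_deriv_smul_comp'' (a := Real.log ε) (b := Real.log R)
      (f := Real.exp) (f' := Real.exp) (g := fun r : ℝ => h (rot * r))
      Real.continuous_exp.continuousOn
      (fun s _ => (Real.hasDerivAt_exp s).hasDerivWithinAt) Real.continuous_exp.continuousOn ?_
    · rw [Real.exp_log hε, Real.exp_log hR] at this
      rw [← this, ← intervalIntegral.integral_const_mul]
      refine intervalIntegral.integral_congr fun s _ => ?_
      simp only [hg, Function.comp_apply, Complex.ofReal_exp, Complex.real_smul, Complex.exp_add,
        ← rot_eq]
      ring_nf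
    · refine hcont.comp (by fun_prop) fun r hr => ?_
      have : 0 < r := himg hr
      simp only [mem_ofPred_eq]
      rw [re_rot_mul]
      positivity
  have sub3 : ∀ ρ : ℝ, 0 < ρ → (Complex.I * ∫ θ in (0 : ℝ)..(Real.pi / 4),
      g (Real.log ρ + θ * Complex.I)) = arcIntegral h ρ := by
    intro ρ hρ
    rw [arcIntegral]
    congr 1
    refine intervalIntegral.integral_congr fun θ _ => ?_
    simp only [hg, Complex.exp_add, ← Complex.ofReal_exp, Real.exp_log hρ]
  rw [sub1, sub2, sub3 R hR, sub3 ε hε] at key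
  exact key

lemma tendsto_arcIntegral_zero (hc : ContinuousOn h {z | 0 ≤ z.re}) :
    Tendsto (arcIntegral h) (𝓝[>] 0) (𝓝 0) := by
  have hK : IsCompact ({z : ℂ | 0 ≤ z.re} ∩ Metric.closedBall 0 1) :=
    (isCompact_closedBall _ _).inter_left (isClosed_le continuous_const Complex.continuous_re)
  obtain ⟨M, hM⟩ := hK.exists_bound_of_continuousOn (hc.mono inter_subset_left)
  have hbound : ∀ r ∈ Ioo (0 : ℝ) 1, ‖arcIntegral h r‖ ≤ M * r * |Real.pi / 4 - 0| := by
    intro r hr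
    rw [arcIntegral, norm_mul, Complex.norm_I, one_mul]
    refine intervalIntegral.norm_integral_le_of_norm_le_const fun θ hθ => ?_
    rw [uIoc_of_le (by positivity)] at hθ
    have hn : ‖(r : ℂ) * Complex.exp (θ * Complex.I)‖ = r := by
      rw [norm_mul, Complex.norm_exp_ofReal_mul_I, mul_one, Complex.norm_real,
        Real.norm_of_nonneg hr.1.le]
    rw [norm_mul, hn]
    refine mul_le_mul_of_nonneg_right (hM _ ⟨?_, ?_⟩) hr.1.le
    · simp only [mem_ofPred_eq]
      rw [re_mul_exp]
      exact mul_nonneg hr.1.le (cos_pos_of_mem ⟨hθ.1.le, hθ.2⟩).le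
    · rw [mem_closedBall_zero_iff, hn]; exact hr.2.le
  refine squeeze_zero_norm' (a := fun r => M * r * |Real.pi / 4 - 0|) ?_ ?_
  · filter_upwards [Ioo_mem_nhdsGT (zero_lt_one' ℝ)] with r hr using hbound r hr
  · have : Tendsto (fun r : ℝ => M * r * |Real.pi / 4 - 0|) (𝓝 0)
        (𝓝 (M * 0 * |Real.pi / 4 - 0|)) :=
      Continuous.tendsto (f := fun r : ℝ => M * r * |Real.pi / 4 - 0|) (by fun_prop) 0
    simp only [mul_zero, zero_mul] at this
    exact this.mono_left nhdsWithin_le_nhds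

/-- The sector may be taken down to its vertex, for a function continuous up to the boundary. -/
lemma sector_integral (hc : ContinuousOn h {z | 0 ≤ z.re})
    (hd : DifferentiableOn ℂ h {z | 0 < z.re}) {R : ℝ} (hR : 0 < R) :
    (∫ r in (0 : ℝ)..R, h r) = rot * (∫ r in (0 : ℝ)..R, h (rot * r)) - arcIntegral h R := by
  have c1 : ContinuousOn (fun r : ℝ => h r) (Ici 0) :=
    hc.comp Complex.continuous_ofReal.continuousOn fun r hr => by simpa using hr
  have c2 : ContinuousOn (fun r : ℝ => h (rot * r)) (Ici 0) := by
    refine hc.comp (by fun_prop) fun r hr => ?_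
    have hr : 0 ≤ r := hr
    simp only [mem_ofPred_eq]
    rw [re_rot_mul]; positivity
  have prim : ∀ f : ℝ → ℂ, ContinuousOn f (Ici 0) →
      Tendsto (fun ε => ∫ r in ε..R, f r) (𝓝[>] 0) (𝓝 (∫ r in (0 : ℝ)..R, f r)) := by
    intro f hf
    have hi : IntervalIntegrable f volume 0 R :=
      (hf.mono (by rw [uIcc_of_le hR.le]; exact Icc_subset_Ici_self)).intervalIntegrable
    have h1 := intervalIntegral.continuousOn_primitive_interval_left (f := f) (μ := volume)
      (a := 0) (b := R) (by
        rw [uIcc_of_le hR.le, integrableOn_Icc_iff_integrableOn_Ioc]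
        exact (intervalIntegrable_iff_integrableOn_Ioc_of_le hR.le).1 hi)
    have h2 := h1 0 left_mem_uIcc
    rw [uIcc_of_le hR.le] at h2
    exact h2.tendsto.mono_left (nhdsWithin_le_iff.2 (mem_of_superset
      (Ioo_mem_nhdsGT hR) Ioo_subset_Icc_self))
  have lim := (((prim _ c1).sub ((prim _ c2).const_mul rot)).add_const (arcIntegral h R)).sub
    (tendsto_arcIntegral_zero hc)
  have hev : (fun ε => (∫ r in ε..R, h r) - rot * (∫ r in ε..R, h (rot * r)) +
      arcIntegral h R - arcIntegral h ε) =ᶠ[𝓝[>] 0] fun _ => 0 := by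
    filter_upwards [self_mem_nhdsWithin] with ε hε using sector_integral_sub hd hε hR
  have := tendsto_nhds_unique (lim.congr' hev) tendsto_const_nhds
  linear_combination this

/-- Jordan's lemma: Gaussian decay in `r` of rate proportional to the angle makes the integrals over
large arcs vanish, without decay on the real axis itself. -/
lemma tendsto_arcIntegral_atTop {C c r₀ : ℝ} (hC : 0 ≤ C) (hc0 : 0 < c)
    (hb : ∀ r ≥ r₀, ∀ θ ∈ Icc 0 (Real.pi / 4),
      ‖h (r * Complex.exp (θ * Complex.I))‖ ≤ C * Real.exp (-(c * r ^ 2 * θ))) :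
    Tendsto (arcIntegral h) atTop (𝓝 0) := by
  have hbound : ∀ r, r₀ ≤ r → 0 < r → ‖arcIntegral h r‖ ≤ C / c * r⁻¹ := by
    intro r hr hr0
    rw [arcIntegral, norm_mul, Complex.norm_I, one_mul]
    have hk : 0 < c * r ^ 2 := by positivity
    have hle := intervalIntegral.norm_integral_le_of_norm_le (a := 0) (b := Real.pi / 4)
      (f := fun θ : ℝ => h (r * Complex.exp (θ * Complex.I)) * (r * Complex.exp (θ * Complex.I)))
      (g := fun θ => C * Real.exp (-(c * r ^ 2 * θ)) * r) (μ := volume) (by positivity)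
      (Eventually.of_forall fun θ hθ => by
        rw [norm_mul]
        have hn : ‖(r : ℂ) * Complex.exp (θ * Complex.I)‖ = r := by
          rw [norm_mul, Complex.norm_exp_ofReal_mul_I, mul_one, Complex.norm_real,
            Real.norm_of_nonneg hr0.le]
        rw [hn]
        exact mul_le_mul_of_nonneg_right (hb r hr θ ⟨hθ.1.le, hθ.2⟩) hr0.le)
      (Continuous.intervalIntegrable (by fun_prop) _ _)
    refine hle.trans ?_
    have hder : ∀ θ : ℝ, HasDerivAt (fun θ => -(C * r / (c * r ^ 2)) *
        Real.exp (-(c * r ^ 2 * θ))) (C * Real.exp (-(c * r ^ 2 * θ)) * r) θ := by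
      intro θ
      refine ((((hasDerivAt_id θ).const_mul (c * r ^ 2)).neg.exp).const_mul _).congr_deriv ?_
      simp only [id, Pi.neg_apply]
      field_simp
    rw [intervalIntegral.integral_eq_sub_of_hasDerivAt (fun θ _ => hder θ)
      (Continuous.intervalIntegrable (by fun_prop) _ _)]
    have e1 : C * r / (c * r ^ 2) = C / c * r⁻¹ := by field_simp
    rw [e1, mul_zero, neg_zero, Real.exp_zero]
    have : 0 ≤ C / c * r⁻¹ * Real.exp (-(c * r ^ 2 * (Real.pi / 4))) := by positivity
    linarith
  refine squeeze_zero_norm' (a := fun r => C / c * r⁻¹) ?_ ?_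
  · filter_upwards [eventually_ge_atTop r₀, eventually_gt_atTop 0] with r h1 h2 using hbound r h1 h2
  · simpa using tendsto_inv_atTop_zero.const_mul (C / c)

/-- Rotation of the half-line by `π/4` for an integrand that decays on the arcs. -/
theorem tendsto_integral_rot {C c r₀ : ℝ} (hc : ContinuousOn h {z | 0 ≤ z.re})
    (hd : DifferentiableOn ℂ h {z | 0 < z.re}) (hC : 0 ≤ C) (hc0 : 0 < c)
    (hb : ∀ r ≥ r₀, ∀ θ ∈ Icc 0 (Real.pi / 4),
      ‖h (r * Complex.exp (θ * Complex.I))‖ ≤ C * Real.exp (-(c * r ^ 2 * θ)))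
    (hi : IntegrableOn (fun r : ℝ => h (rot * r)) (Ioi 0)) :
    Tendsto (fun R : ℝ => ∫ r in (0 : ℝ)..R, h r) atTop
      (𝓝 (rot * ∫ r in Ioi (0 : ℝ), h (rot * r))) := by
  have h1 := (intervalIntegral_tendsto_integral_Ioi 0 hi tendsto_id).const_mul rot
  have h2 := h1.sub (tendsto_arcIntegral_atTop hC hc0 hb)
  rw [sub_zero] at h2
  refine h2.congr' ?_
  filter_upwards [eventually_gt_atTop 0] with R hR using (sector_integral hc hd hR).symm

end Rotation

lemma le_sin_mul {θ : ℝ} (hθ : θ ∈ Icc 0 (Real.pi / 4)) : θ / 2 ≤ Real.sin θ := by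
  have h1 := Real.mul_le_sin hθ.1 (by linarith [hθ.2, Real.pi_pos])
  have h2 : (1 : ℝ) / 2 ≤ 2 / Real.pi := by
    rw [div_le_div_iff₀ (by norm_num) Real.pi_pos]; linarith [Real.pi_le_four]
  have := mul_le_mul_of_nonneg_right h2 hθ.1
  linarith

lemma half_le_cos {θ : ℝ} (hθ : θ ∈ Icc 0 (Real.pi / 4)) : 1 / 2 ≤ Real.cos θ := by
  have : Real.cos (Real.pi / 3) ≤ Real.cos θ :=
    Real.cos_le_cos_of_nonneg_of_le_pi hθ.1 (by linarith [Real.pi_pos])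
      (by linarith [hθ.2, Real.pi_pos])
  rwa [Real.cos_pi_div_three] at this

/-- The Fresnel integral. -/
theorem tendsto_integral_fresnel :
    Tendsto (fun R : ℝ => ∫ v in (0 : ℝ)..R, Complex.exp (Complex.I * v ^ 2)) atTop
      (𝓝 (rot * (Real.sqrt Real.pi / 2 : ℝ))) := by
  have hrot : ∀ r : ℝ, Complex.exp (Complex.I * (rot * r) ^ 2) =
      ((Real.exp (-1 * r ^ 2) : ℝ) : ℂ) := by
    intro r
    rw [mul_pow, rot_sq, ← mul_assoc, Complex.I_mul_I]
    push_cast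
    rfl
  have h := tendsto_integral_rot (h := fun z => Complex.exp (Complex.I * z ^ 2)) (C := 1)
    (c := 1 / 2) (r₀ := 0) (by fun_prop) (by fun_prop) zero_le_one (by norm_num) ?_ ?_
  · simp only [hrot] at h
    rw [integral_complex_ofReal, integral_gaussian_Ioi, div_one] at h
    exact h
  · intro r hr θ hθ
    rw [Complex.norm_exp, one_mul]
    refine Real.exp_le_exp.2 ?_
    have e : (Complex.I * ((r : ℂ) * Complex.exp (θ * Complex.I)) ^ 2).re =
        -(2 * (r * Real.cos θ) * (r * Real.sin θ)) := by
      rw [Complex.I_mul_re, sq, Complex.mul_im, re_mul_exp, im_mul_exp]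
      ring
    rw [e]
    have h1 := le_sin_mul hθ
    have h2 := half_le_cos hθ
    have h3 : 1 / 2 * (θ / 2) ≤ Real.cos θ * Real.sin θ :=
      mul_le_mul h2 h1 (by linarith [hθ.1]) (by linarith)
    have h4 := mul_le_mul_of_nonneg_left h3 (by positivity : 0 ≤ 2 * r ^ 2)
    nlinarith
  · simp only [hrot]
    exact ((integrable_exp_neg_mul_sq one_pos).ofReal).integrableOn

/-! ### Poisson's integral -/

/-- The moments of the weight `(1 - s²)^β` on `[-1, 1]`. -/
def weightMoment (β : ℝ) (n : ℕ) : ℝ := ∫ s in (-1 : ℝ)..1, (1 - s ^ 2) ^ β * s ^ n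

lemma one_sub_sq_nonneg {s : ℝ} (hs : s ∈ Icc (-1 : ℝ) 1) : 0 ≤ 1 - s ^ 2 := by
  nlinarith [hs.1, hs.2]

lemma continuous_weight {β : ℝ} (hβ : 0 < β) : Continuous fun s : ℝ => (1 - s ^ 2) ^ β :=
  Continuous.rpow_const (by fun_prop) fun _ => Or.inr hβ.le

/-- A Beta integral after `s = 2t - 1`, evaluated with the duplication formula. -/
lemma weightMoment_zero {β : ℝ} (hβ : 0 < β) :
    weightMoment β 0 = Real.sqrt Real.pi * Real.Gamma (β + 1) / Real.Gamma (β + 1 / 2 + 1) := by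
  have hb : Complex.betaIntegral ((β + 1 : ℝ) : ℂ) ((β + 1 : ℝ) : ℂ) =
      ((∫ t in (0 : ℝ)..1, t ^ β * (1 - t) ^ β : ℝ) : ℂ) := by
    rw [Complex.betaIntegral, ← intervalIntegral.integral_ofReal]
    refine intervalIntegral.integral_congr fun t ht => ?_
    rw [uIcc_of_le zero_le_one] at ht
    push_cast [Complex.ofReal_cpow ht.1, Complex.ofReal_cpow (sub_nonneg.2 ht.2)]
    simp
  have hG := Complex.Gamma_mul_Gamma_eq_betaIntegral (s := ((β + 1 : ℝ) : ℂ))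
    (t := ((β + 1 : ℝ) : ℂ)) (by simp; linarith) (by simp; linarith)
  rw [hb, ← Complex.ofReal_add, Complex.Gamma_ofReal, Complex.Gamma_ofReal] at hG
  have hG' : Real.Gamma (β + 1) * Real.Gamma (β + 1) =
      Real.Gamma (β + 1 + (β + 1)) * ∫ t in (0 : ℝ)..1, t ^ β * (1 - t) ^ β := by
    exact_mod_cast hG
  have hsub : ∫ t in (0 : ℝ)..1, t ^ β * (1 - t) ^ β =
      (4 ^ β)⁻¹ * (2⁻¹ * weightMoment β 0) := by
    have h1 := intervalIntegral.integral_comp_mul_sub (a := 0) (b := 1)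
      (fun s : ℝ => (1 - s ^ 2) ^ β * s ^ 0) (two_ne_zero' ℝ) 1
    norm_num at h1
    rw [weightMoment]
    norm_num
    rw [← h1, ← intervalIntegral.integral_const_mul]
    refine intervalIntegral.integral_congr fun t ht => ?_
    rw [uIcc_of_le zero_le_one] at ht
    have h4 : (4 : ℝ) ^ β ≠ 0 := (Real.rpow_pos_of_pos (by norm_num) _).ne'
    have e : 1 - (2 * t - 1) ^ 2 = 4 * (t * (1 - t)) := by ring
    rw [e, Real.mul_rpow (by norm_num) (mul_nonneg ht.1 (sub_nonneg.2 ht.2)),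
      Real.mul_rpow ht.1 (sub_nonneg.2 ht.2)]
    field_simp
  have hdup := Real.Gamma_mul_Gamma_add_half (β + 1)
  rw [hsub] at hG'
  have e1 : β + 1 + (β + 1) = 2 * (β + 1) := by ring
  have e2 : β + 1 + 1 / 2 = β + 1 / 2 + 1 := by ring
  rw [e1] at hG'
  rw [e2] at hdup
  have p1 : 0 < Real.Gamma (β + 1) := Real.Gamma_pos_of_pos (by linarith)
  have p2 : 0 < Real.Gamma (β + 1 / 2 + 1) := Real.Gamma_pos_of_pos (by linarith)
  have p3 : 0 < Real.Gamma (2 * (β + 1)) := Real.Gamma_pos_of_pos (by linarith)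
  have p4 : (0 : ℝ) < 4 ^ β := Real.rpow_pos_of_pos (by norm_num) _
  have e3 : (2 : ℝ) ^ (1 - 2 * (β + 1)) = (2 * 4 ^ β)⁻¹ := by
    rw [show 1 - 2 * (β + 1) = -(1 + 2 * β) by ring, Real.rpow_neg (by norm_num),
      Real.rpow_add (by norm_num), Real.rpow_one, Real.rpow_mul (by norm_num)]
    norm_num
  rw [e3] at hdup
  rw [eq_div_iff p2.ne']
  apply mul_left_cancel₀ (mul_pos p1 p3).ne'
  have h5 : weightMoment β 0 * Real.Gamma (2 * (β + 1)) =
      Real.Gamma (β + 1) * Real.Gamma (β + 1) * (2 * 4 ^ β) := by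
    rw [hG']; field_simp
  calc _ = (weightMoment β 0 * Real.Gamma (2 * (β + 1))) *
        (Real.Gamma (β + 1) * Real.Gamma (β + 1 / 2 + 1)) := by ring
    _ = _ := by rw [h5, hdup]; field_simp

lemma intervalIntegrable_weight {β : ℝ} (hβ : 0 < β) (n : ℕ) :
    IntervalIntegrable (fun s : ℝ => (1 - s ^ 2) ^ β * s ^ n) volume (-1) 1 :=
  ((continuous_weight hβ).mul (continuous_pow n)).intervalIntegrable _ _

/-- Integration by parts gives a recurrence for the moments. -/
lemma weightMoment_add_two {β : ℝ} (hβ : 0 < β) (n : ℕ) :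
    (n + 2 * β + 3) * weightMoment β (n + 2) = (n + 1) * weightMoment β n := by
  have hder : ∀ s ∈ uIcc (-1 : ℝ) 1, HasDerivAt (fun s : ℝ => (1 - s ^ 2) ^ (β + 1) * s ^ (n + 1))
      ((n + 1) * ((1 - s ^ 2) ^ β * s ^ n) -
        (n + 2 * β + 3) * ((1 - s ^ 2) ^ β * s ^ (n + 2))) s := by
    intro s hs
    rw [uIcc_of_le (by norm_num)] at hs
    have h1 : HasDerivAt (fun s : ℝ => 1 - s ^ 2) (-(2 * s)) s := by
      simpa using (hasDerivAt_pow 2 s).const_sub 1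
    have h2 := h1.rpow_const (p := β + 1) (Or.inr (by linarith))
    have h3 := h2.mul (hasDerivAt_pow (n + 1) s)
    refine h3.congr_deriv ?_
    have e : (1 - s ^ 2) ^ (β + 1) = (1 - s ^ 2) ^ β * (1 - s ^ 2) := by
      rw [Real.rpow_add_one' (one_sub_sq_nonneg hs) (by linarith)]
    rw [e, add_sub_cancel_right, Nat.add_sub_cancel]
    push_cast
    ring
  have h := intervalIntegral.integral_eq_sub_of_hasDerivAt hder
    (((intervalIntegrable_weight hβ n).const_mul _).sub
      ((intervalIntegrable_weight hβ (n + 2)).const_mul _))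
  rw [intervalIntegral.integral_sub ((intervalIntegrable_weight hβ n).const_mul _)
      ((intervalIntegrable_weight hβ (n + 2)).const_mul _),
    intervalIntegral.integral_const_mul, intervalIntegral.integral_const_mul] at h
  norm_num at h
  rw [Real.zero_rpow (by linarith)] at h
  simp only [weightMoment]
  linarith

lemma weightMoment_odd (β : ℝ) (k : ℕ) : weightMoment β (2 * k + 1) = 0 := by
  have h := intervalIntegral.integral_comp_neg (a := -1) (b := 1)
    (fun s : ℝ => (1 - s ^ 2) ^ β * s ^ (2 * k + 1))
  have e : ∀ s : ℝ, (1 - (-s) ^ 2) ^ β * (-s) ^ (2 * k + 1) =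
      -((1 - s ^ 2) ^ β * s ^ (2 * k + 1)) := by
    intro s
    rw [neg_sq, (odd_two_mul_add_one k).neg_pow]
    ring
  simp only [e, neg_neg, intervalIntegral.integral_neg] at h
  rw [weightMoment]
  linarith

lemma weightMoment_even_eq_besselTerm {β : ℝ} (hβ : 0 < β) (z : ℂ) (k : ℕ) :
    (Complex.I * z) ^ (2 * k) / (2 * k).factorial * (weightMoment β (2 * k) : ℂ) =
      ((Real.sqrt Real.pi * Real.Gamma (β + 1) : ℝ) : ℂ) * besselTerm (β + 1 / 2) k z := by
  induction k with
  | zero =>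
    simp only [besselTerm, mul_zero, Nat.factorial_zero, pow_zero, Nat.cast_zero, zero_add,
      Real.Gamma_one, add_zero, weightMoment_zero hβ]
    push_cast
    ring
  | succ k ih =>
    have hrec := weightMoment_add_two hβ (2 * k)
    have hk : (0 : ℝ) ≤ k := k.cast_nonneg
    have hβk : β + k + 3 / 2 ≠ 0 := by positivity
    have hβkC : (β : ℂ) + k + 3 / 2 ≠ 0 := by
      have := Complex.ofReal_ne_zero.2 hβk
      push_cast at this
      exact this
    have hm : weightMoment β (2 * (k + 1)) = (k + 1 / 2) / (β + k + 3 / 2) *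
        weightMoment β (2 * k) := by
      rw [mul_add, mul_one]
      rw [div_mul_eq_mul_div, eq_div_iff hβk]
      push_cast at hrec
      linarith
    have hterm : besselTerm (β + 1 / 2) (k + 1) z =
        -(z / 2) ^ 2 / ((k + 1) * (β + k + 3 / 2)) * besselTerm (β + 1 / 2) k z := by
      have e1 : β + 1 / 2 + ((k + 1 : ℕ) : ℝ) + 1 = β + 1 / 2 + k + 1 + 1 := by push_cast; ring
      have hG : (Real.Gamma (β + 1 / 2 + k + 1) : ℂ) ≠ 0 := by
        exact_mod_cast (Real.Gamma_pos_of_pos (by positivity)).ne'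
      have hf : (k.factorial : ℂ) ≠ 0 := by exact_mod_cast k.factorial_ne_zero
      have hk1 : (k : ℂ) + 1 ≠ 0 := by exact_mod_cast k.succ_ne_zero
      have hb2 : (β : ℂ) + 1 / 2 + k + 1 ≠ 0 := by
        convert hβkC using 1; ring
      simp only [besselTerm]
      rw [e1, Real.Gamma_add_one (s := β + 1 / 2 + k + 1) (by positivity),
        Real.Gamma_nat_eq_factorial, Real.Gamma_nat_eq_factorial, Nat.factorial_succ]
      push_cast
      rw [show (β : ℂ) + 1 / 2 + k + 1 = β + k + 3 / 2 by ring]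
      field_simp
      ring
    rw [hterm, mul_left_comm, ← ih, hm, show 2 * (k + 1) = 2 * k + 1 + 1 by ring,
      Nat.factorial_succ, Nat.factorial_succ]
    have hf : ((2 * k).factorial : ℂ) ≠ 0 := by exact_mod_cast (2 * k).factorial_ne_zero
    have hk1 : (k : ℂ) + 1 ≠ 0 := by exact_mod_cast k.succ_ne_zero
    have hk2 : 2 * (k : ℂ) + 1 ≠ 0 := by exact_mod_cast (2 * k).succ_ne_zero
    have hk3 : 2 * (k : ℂ) + 1 + 1 ≠ 0 := by exact_mod_cast (2 * k + 1).succ_ne_zero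
    have hI : Complex.I ^ 2 = -1 := Complex.I_sq
    push_cast
    rw [mul_pow Complex.I, mul_pow Complex.I, pow_succ Complex.I, pow_succ Complex.I,
      mul_assoc (Complex.I ^ (2 * k)), Complex.I_mul_I]
    field_simp
    ring

/-- Poisson's integral representation of the Bessel function. -/
theorem besselE_eq_poisson {β : ℝ} (hβ : 0 < β) (z : ℂ) :
    ((Real.sqrt Real.pi * Real.Gamma (β + 1) : ℝ) : ℂ) * besselE (β + 1 / 2) z =
      ∫ s in (-1 : ℝ)..1, (((1 - s ^ 2) ^ β : ℝ) : ℂ) * Complex.exp (Complex.I * z * s) := by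
  have hw := continuous_weight hβ
  have hsum : HasSum (fun n : ℕ => ∫ s in (-1 : ℝ)..1, (((1 - s ^ 2) ^ β : ℝ) : ℂ) *
      ((Complex.I * z * s) ^ n / n.factorial))
      (∫ s in (-1 : ℝ)..1, (((1 - s ^ 2) ^ β : ℝ) : ℂ) * Complex.exp (Complex.I * z * s)) := by
    refine intervalIntegral.hasSum_integral_of_dominated_convergence
      (fun n s => (1 - s ^ 2) ^ β * (‖z‖ ^ n / n.factorial)) ?_ ?_ ?_ ?_ ?_
    · intro n
      exact Continuous.aestronglyMeasurable (by fun_prop)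
    · intro n
      refine Eventually.of_forall fun s hs => ?_
      rw [uIoc_of_le (by norm_num)] at hs
      have hs' : s ∈ Icc (-1 : ℝ) 1 := Ioc_subset_Icc_self hs
      have hs1 : |s| ≤ 1 := abs_le.2 hs'
      rw [norm_mul, norm_div, norm_pow, norm_mul, norm_mul, Complex.norm_I, one_mul,
        Complex.norm_real, Complex.norm_real, Real.norm_of_nonneg
        (Real.rpow_nonneg (one_sub_sq_nonneg hs') _), Complex.norm_natCast, Real.norm_eq_abs]
      refine mul_le_mul_of_nonneg_left ?_ (Real.rpow_nonneg (one_sub_sq_nonneg hs') _)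
      gcongr
      exact mul_le_of_le_one_right (norm_nonneg _) hs1
    · exact Eventually.of_forall fun s _ => (Real.summable_pow_div_factorial _).mul_left _
    · simp only [tsum_mul_left]
      exact (hw.mul continuous_const).intervalIntegrable _ _
    · refine Eventually.of_forall fun s _ => ?_
      have := NormedSpace.expSeries_div_hasSum_exp (𝔸 := ℂ) (Complex.I * z * s)
      rw [← Complex.exp_eq_exp_ℂ] at this
      exact this.mul_left _
  have hterm : ∀ n : ℕ, (∫ s in (-1 : ℝ)..1, (((1 - s ^ 2) ^ β : ℝ) : ℂ) *
      ((Complex.I * z * s) ^ n / n.factorial)) =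
      (Complex.I * z) ^ n / n.factorial * (weightMoment β n : ℂ) := by
    intro n
    rw [weightMoment, ← intervalIntegral.integral_ofReal, ← intervalIntegral.integral_const_mul]
    refine intervalIntegral.integral_congr fun s _ => ?_
    push_cast
    ring
  simp only [hterm] at hsum
  have hinj : Function.Injective fun k : ℕ => 2 * k := fun a b h => by simpa using h
  have heven := (hinj.hasSum_iff (f := fun n : ℕ =>
      (Complex.I * z) ^ n / n.factorial * (weightMoment β n : ℂ)) (fun n hn => by
    obtain ⟨k, rfl | rfl⟩ := n.even_or_odd'
    · exact absurd ⟨k, rfl⟩ hn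
    · simp [weightMoment_odd])).2 hsum
  have h2 := ((summable_besselTerm (by positivity : 0 ≤ β + 1 / 2) z).hasSum).mul_left
    ((Real.sqrt Real.pi * Real.Gamma (β + 1) : ℝ) : ℂ)
  refine h2.unique (heven.congr_fun fun k => ?_)
  exact (weightMoment_even_eq_besselTerm hβ z k).symm

/-! ### Asymptotics of the Bessel function -/

/-- The integrand of Poisson's integral `∫ (1 - s²)^β e^{izs} ds`, continued to the half-strip
`|Re s| ≤ 1`, `Im s ≥ 0`. -/
def poissonIntegrand (β : ℝ) (z s : ℂ) : ℂ :=
  (1 - s) ^ (β : ℂ) * (1 + s) ^ (β : ℂ) * Complex.exp (Complex.I * z * s)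

/-- The values of the Poisson integrand on the side `s = e + iτ` of the half-strip, `e = ± 1`. -/
def sideKernel (e β : ℝ) (z : ℂ) (τ : ℝ) : ℂ :=
  (2 + e * Complex.I * τ) ^ (β : ℂ) * (-(e * Complex.I * τ)) ^ (β : ℂ) *
    Complex.exp (Complex.I * z * (e + Complex.I * τ))

lemma poissonIntegrand_one_add (β : ℝ) (z : ℂ) (τ : ℝ) :
    poissonIntegrand β z (1 + τ * Complex.I) = sideKernel 1 β z τ := by
  have e1 : (1 : ℂ) - (1 + τ * Complex.I) = -((1 : ℝ) * Complex.I * τ) := by push_cast; ring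
  have e2 : (1 : ℂ) + (1 + τ * Complex.I) = 2 + (1 : ℝ) * Complex.I * τ := by push_cast; ring
  have e3 : (1 : ℂ) + τ * Complex.I = (1 : ℝ) + Complex.I * τ := by push_cast; ring
  rw [poissonIntegrand, sideKernel, e1, e2, e3, mul_comm ((-_ : ℂ) ^ (β : ℂ))]

lemma poissonIntegrand_neg_one_add (β : ℝ) (z : ℂ) (τ : ℝ) :
    poissonIntegrand β z (-1 + τ * Complex.I) = sideKernel (-1) β z τ := by
  have e1 : (1 : ℂ) - (-1 + τ * Complex.I) = 2 + (-1 : ℝ) * Complex.I * τ := by push_cast; ring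
  have e2 : (1 : ℂ) + (-1 + τ * Complex.I) = -((-1 : ℝ) * Complex.I * τ) := by push_cast; ring
  have e3 : (-1 : ℂ) + τ * Complex.I = (-1 : ℝ) + Complex.I * τ := by push_cast; ring
  rw [poissonIntegrand, sideKernel, e1, e2, e3]

/-- A constant with `(2 + τ)^β ≤ expConst β * e^{τ/2}` for `τ ≥ 0`. -/
def expConst (β : ℝ) : ℝ := (2 * β) ^ β * Real.exp 1

lemma expConst_nonneg {β : ℝ} (hβ : 0 < β) : 0 ≤ expConst β := by
  unfold expConst; positivity

lemma two_add_rpow_le {β : ℝ} (hβ : 0 < β) {τ : ℝ} (hτ : 0 ≤ τ) :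
    (2 + τ) ^ β ≤ expConst β * Real.exp (τ / 2) := by
  have h1 : (2 + τ) / (2 * β) ≤ Real.exp ((2 + τ) / (2 * β)) := by
    linarith [Real.add_one_le_exp ((2 + τ) / (2 * β))]
  calc (2 + τ) ^ β = (2 * β * ((2 + τ) / (2 * β))) ^ β := by
        congr 1; field_simp
    _ ≤ (2 * β * Real.exp ((2 + τ) / (2 * β))) ^ β := by gcongr
    _ = (2 * β) ^ β * Real.exp ((2 + τ) / (2 * β) * β) := by
        rw [Real.mul_rpow (by positivity) (by positivity), ← Real.exp_mul]
    _ = expConst β * Real.exp (τ / 2) := by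
        rw [expConst, mul_assoc, ← Real.exp_add]
        congr 2
        field_simp

lemma norm_exp_side {e : ℝ} (he : |e| = 1) (z : ℂ) (τ : ℝ) :
    ‖Complex.exp (Complex.I * z * (e + Complex.I * τ))‖ ≤
      Real.exp |z.im| * Real.exp (-(z.re * τ)) := by
  rw [Complex.norm_exp, ← Real.exp_add]
  refine Real.exp_le_exp.2 ?_
  have e1 : (Complex.I * z * (e + Complex.I * τ)).re = -(e * z.im) - z.re * τ := by
    simp; ring
  rw [e1]
  have : -(e * z.im) ≤ |z.im| := by
    have := neg_abs_le (e * z.im)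
    rw [abs_mul, he, one_mul] at this
    linarith
  linarith

lemma norm_side_mul {e : ℝ} (he : |e| = 1) {τ : ℝ} (hτ : 0 ≤ τ) :
    ‖(e * Complex.I * τ : ℂ)‖ = τ := by
  rw [norm_mul, norm_mul, Complex.norm_I, mul_one, Complex.norm_real, Complex.norm_real,
    Real.norm_eq_abs, he, one_mul, Real.norm_of_nonneg hτ]

lemma norm_two_add_side_le {e : ℝ} (he : |e| = 1) {τ : ℝ} (hτ : 0 ≤ τ) :
    ‖(2 + e * Complex.I * τ : ℂ)‖ ≤ 2 + τ := by
  refine (norm_add_le _ _).trans ?_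
  rw [norm_side_mul he hτ, Complex.norm_ofNat]

lemma re_two_add_side (e τ : ℝ) : (2 + e * Complex.I * τ : ℂ).re = 2 := by
  simp

/-- The growth of `(2 + eiτ)^β` is absorbed by one half of the exponential decay, because
`1 ≤ Re z`. -/
lemma norm_sideKernel_le {e β : ℝ} (he : |e| = 1) (hβ : 0 < β) {z : ℂ} (hz : 1 ≤ z.re) {τ : ℝ}
    (hτ : 0 ≤ τ) :
    ‖sideKernel e β z τ‖ ≤
      Real.exp |z.im| * (expConst β * (τ ^ β * Real.exp (-(z.re / 2 * τ)))) := by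
  rw [sideKernel, norm_mul, norm_mul, Complex.norm_cpow_real, Complex.norm_cpow_real, norm_neg,
    norm_side_mul he hτ]
  have h1 : ‖(2 + e * Complex.I * τ : ℂ)‖ ^ β ≤ expConst β * Real.exp (τ / 2) :=
    (Real.rpow_le_rpow (norm_nonneg _) (norm_two_add_side_le he hτ) hβ.le).trans
      (two_add_rpow_le hβ hτ)
  have h2 : Real.exp (τ / 2) * Real.exp (-(z.re * τ)) ≤ Real.exp (-(z.re / 2 * τ)) := by
    rw [← Real.exp_add]
    refine Real.exp_le_exp.2 ?_
    nlinarith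
  have hK := expConst_nonneg hβ
  calc _ ≤ expConst β * Real.exp (τ / 2) * τ ^ β *
        (Real.exp |z.im| * Real.exp (-(z.re * τ))) := by
        gcongr
        exact norm_exp_side he z τ
    _ = Real.exp |z.im| * (expConst β * (τ ^ β * (Real.exp (τ / 2) * Real.exp (-(z.re * τ))))) := by
        ring
    _ ≤ _ := by gcongr

lemma integrableOn_rpow_mul_exp_neg {s r : ℝ} (hs : -1 < s) (hr : 0 < r) :
    IntegrableOn (fun τ : ℝ => τ ^ s * Real.exp (-(r * τ))) (Ioi 0) := by
  have := integrableOn_rpow_mul_exp_neg_mul_rpow hs one_pos hr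
  simpa only [Real.rpow_one, neg_mul] using this

lemma continuousOn_sideKernel {e β : ℝ} (he : |e| = 1) (z : ℂ) :
    ContinuousOn (sideKernel e β z) (Ioi 0) := by
  have he0 : e ≠ 0 := by rintro rfl; simp at he
  refine ContinuousOn.mul (ContinuousOn.mul ?_ ?_) (by fun_prop)
  · refine ContinuousOn.cpow_const (by fun_prop) fun τ _ => Or.inl ?_
    rw [re_two_add_side]; norm_num
  · refine ContinuousOn.cpow_const (by fun_prop) fun τ hτ => Or.inr ?_
    have : τ ≠ 0 := ne_of_gt hτ
    simp [he0, this]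

lemma integrableOn_sideKernel {e β : ℝ} (he : |e| = 1) (hβ : 0 < β) {z : ℂ} (hz : 1 ≤ z.re) :
    IntegrableOn (sideKernel e β z) (Ioi 0) := by
  refine (((integrableOn_rpow_mul_exp_neg (s := β) (r := z.re / 2) (by linarith)
    (by linarith)).const_mul (expConst β)).const_mul (Real.exp |z.im|)).mono'
    ((continuousOn_sideKernel he z).aestronglyMeasurable measurableSet_Ioi) ?_
  exact (ae_restrict_iff' measurableSet_Ioi).2 (Eventually.of_forall fun τ hτ =>
    norm_sideKernel_le he hβ hz (le_of_lt hτ))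

lemma norm_integral_sideKernel_le {e β : ℝ} (he : |e| = 1) (hβ : 0 < β) {z : ℂ}
    (hz : 1 ≤ z.re) :
    ‖∫ τ in Ioi (0 : ℝ), sideKernel e β z τ‖ ≤
      Real.exp |z.im| * (expConst β * ((2 / z.re) ^ (β + 1) * Real.Gamma (β + 1))) := by
  have hr : 0 < z.re / 2 := by linarith
  refine (norm_integral_le_of_norm_le (((integrableOn_rpow_mul_exp_neg (s := β) (r := z.re / 2)
    (by linarith) hr).const_mul (expConst β)).const_mul (Real.exp |z.im|))
    ((ae_restrict_iff' measurableSet_Ioi).2 (Eventually.of_forall fun τ hτ =>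
      norm_sideKernel_le he hβ hz (le_of_lt hτ)))).trans_eq ?_
  have h := Real.integral_rpow_mul_exp_neg_mul_Ioi (a := β + 1) (by linarith) hr
  rw [add_sub_cancel_right] at h
  rw [integral_const_mul, integral_const_mul, h, one_div_div]

/-- Deformation of the Poisson integral into the two vertical sides of the half-strip. -/
theorem poisson_eq_sides {β : ℝ} (hβ : 0 < β) {z : ℂ} (hz : 1 ≤ z.re) :
    ∫ s in (-1 : ℝ)..1, (((1 - s ^ 2) ^ β : ℝ) : ℂ) * Complex.exp (Complex.I * z * s) =
      Complex.I * (∫ τ in Ioi (0 : ℝ), sideKernel (-1) β z τ) -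
        Complex.I * (∫ τ in Ioi (0 : ℝ), sideKernel 1 β z τ) := by
  set F := poissonIntegrand β z with hF
  have hβ' : 0 < ((β : ℂ)).re := by simpa using hβ
  have hrect : ∀ T : ℝ, 0 < T → (∫ s in (-1 : ℝ)..1, F s) -
      (∫ s in (-1 : ℝ)..1, F (s + T * Complex.I)) +
      Complex.I * (∫ τ in (0 : ℝ)..T, sideKernel 1 β z τ) -
      Complex.I * (∫ τ in (0 : ℝ)..T, sideKernel (-1) β z τ) = 0 := by
    intro T hT
    have key := Complex.integral_boundary_rect_eq_zero_of_continuousOn_of_differentiableOn F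
      (-1 : ℂ) (1 + T * Complex.I) ?_ ?_
    · simp only [Complex.neg_im, Complex.neg_re, Complex.one_re, Complex.one_im, Complex.add_im,
        Complex.mul_im, Complex.ofReal_re, Complex.I_im, mul_one, Complex.ofReal_im, Complex.I_re,
        mul_zero, add_zero, zero_add, Complex.add_re, Complex.mul_re, sub_self, neg_zero,
        Complex.ofReal_zero, zero_mul, smul_eq_mul, Complex.ofReal_one, Complex.ofReal_neg] at key
      simp only [hF, poissonIntegrand_one_add, poissonIntegrand_neg_one_add] at key ⊢
      exact key
    · intro s hs
      have h1 := hs.1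
      simp only [Complex.neg_re, Complex.one_re, Complex.add_re, Complex.mul_re,
        Complex.ofReal_re, Complex.I_re, mul_zero, Complex.ofReal_im, Complex.I_im, mul_one,
        sub_self, add_zero, mem_preimage] at h1
      rw [uIcc_of_le (by norm_num)] at h1
      refine ContinuousAt.continuousWithinAt (ContinuousAt.mul (ContinuousAt.mul ?_ ?_)
        (by fun_prop))
      · exact ContinuousAt.comp (g := fun w : ℂ => w ^ (β : ℂ)) (f := fun s : ℂ => 1 - s)
          (Complex.continuousAt_cpow_const_of_re_pos
            (Or.inl (by simp only [Complex.sub_re, Complex.one_re]; linarith [h1.2])) hβ')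
          (by fun_prop)
      · exact ContinuousAt.comp (g := fun w : ℂ => w ^ (β : ℂ)) (f := fun s : ℂ => 1 + s)
          (Complex.continuousAt_cpow_const_of_re_pos
            (Or.inl (by simp only [Complex.add_re, Complex.one_re]; linarith [h1.1])) hβ')
          (by fun_prop)
    · intro s hs
      have h1 := hs.1
      simp only [Complex.neg_re, Complex.one_re, Complex.add_re, Complex.mul_re,
        Complex.ofReal_re, Complex.I_re, mul_zero, Complex.ofReal_im, Complex.I_im, mul_one,
        sub_self, add_zero, mem_preimage] at h1
      rw [min_eq_left (by norm_num), max_eq_right (by norm_num)] at h1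
      have d1 : DifferentiableAt ℂ (fun s : ℂ => (1 - s) ^ (β : ℂ)) s :=
        DifferentiableAt.cpow_const (by fun_prop)
          (Or.inl (by simp only [Complex.sub_re, Complex.one_re]; linarith [h1.2]))
      have d2 : DifferentiableAt ℂ (fun s : ℂ => (1 + s) ^ (β : ℂ)) s :=
        DifferentiableAt.cpow_const (by fun_prop)
          (Or.inl (by simp only [Complex.add_re, Complex.one_re]; linarith [h1.1]))
      exact ((d1.mul d2).mul (by fun_prop)).differentiableWithinAt
  have htop : Tendsto (fun T : ℝ => ∫ s in (-1 : ℝ)..1, F (s + T * Complex.I)) atTop (𝓝 0) := by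
    have hK := expConst_nonneg (by positivity : 0 < 2 * β)
    have hb : ∀ T : ℝ, 0 < T → ‖∫ s in (-1 : ℝ)..1, F (s + T * Complex.I)‖ ≤
        expConst (2 * β) * Real.exp |z.im| * 2 * Real.exp (-(T / 2)) := by
      intro T hT
      have hpt : ∀ s ∈ uIoc (-1 : ℝ) 1, ‖F (s + T * Complex.I)‖ ≤
          expConst (2 * β) * Real.exp |z.im| * Real.exp (-(T / 2)) := by
        intro s hs
        rw [uIoc_of_le (by norm_num)] at hs
        have n1 : ‖(1 : ℂ) - (s + T * Complex.I)‖ ≤ 2 + T := by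
          have e : (1 : ℂ) - (s + T * Complex.I) = ((1 - s : ℝ) : ℂ) - T * Complex.I := by
            push_cast; ring
          rw [e]
          refine (norm_sub_le _ _).trans (add_le_add ?_ ?_)
          · rw [Complex.norm_real, Real.norm_of_nonneg (by linarith [hs.2])]; linarith [hs.1]
          · rw [norm_mul, Complex.norm_I, mul_one, Complex.norm_real, Real.norm_of_nonneg hT.le]
        have n2 : ‖(1 : ℂ) + (s + T * Complex.I)‖ ≤ 2 + T := by
          have e : (1 : ℂ) + (s + T * Complex.I) = ((1 + s : ℝ) : ℂ) + T * Complex.I := by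
            push_cast; ring
          rw [e]
          refine (norm_add_le _ _).trans (add_le_add ?_ ?_)
          · rw [Complex.norm_real, Real.norm_of_nonneg (by linarith [hs.1])]; linarith [hs.2]
          · rw [norm_mul, Complex.norm_I, mul_one, Complex.norm_real, Real.norm_of_nonneg hT.le]
        have n3 : ‖Complex.exp (Complex.I * z * (s + T * Complex.I))‖ ≤
            Real.exp |z.im| * Real.exp (-T) := by
          rw [Complex.norm_exp, ← Real.exp_add]
          refine Real.exp_le_exp.2 ?_
          have e1 : (Complex.I * z * (s + T * Complex.I)).re = -(s * z.im) - z.re * T := by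
            simp; ring
          rw [e1]
          have h2 : -(s * z.im) ≤ |z.im| := by
            have h3 := neg_abs_le (s * z.im)
            rw [abs_mul] at h3
            have h4 : |s| ≤ 1 := abs_le.2 ⟨hs.1.le, hs.2⟩
            nlinarith [abs_nonneg z.im]
          nlinarith
        rw [hF, poissonIntegrand, norm_mul, norm_mul, Complex.norm_cpow_real,
          Complex.norm_cpow_real]
        calc _ ≤ (2 + T) ^ β * (2 + T) ^ β * (Real.exp |z.im| * Real.exp (-T)) := by gcongr
          _ = (2 + T) ^ (2 * β) * (Real.exp |z.im| * Real.exp (-T)) := by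
            rw [← Real.rpow_add (by positivity), two_mul]
          _ ≤ expConst (2 * β) * Real.exp (T / 2) * (Real.exp |z.im| * Real.exp (-T)) := by
            gcongr
            exact two_add_rpow_le (by positivity) hT.le
          _ = _ := by
            rw [show -(T / 2) = T / 2 + -T by ring, Real.exp_add]; ring
      refine (intervalIntegral.norm_integral_le_of_norm_le_const hpt).trans_eq ?_
      norm_num
      ring
    refine squeeze_zero_norm' (a := fun T => expConst (2 * β) * Real.exp |z.im| * 2 *
      Real.exp (-(T / 2))) ?_ ?_
    · filter_upwards [eventually_gt_atTop 0] with T hT using hb T hT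
    · have h1 : Tendsto (fun T : ℝ => Real.exp (-(T / 2))) atTop (𝓝 0) :=
        Real.tendsto_exp_neg_atTop_nhds_zero.comp (tendsto_id.atTop_div_const two_pos)
      simpa using h1.const_mul (expConst (2 * β) * Real.exp |z.im| * 2)
  have i1 := intervalIntegral_tendsto_integral_Ioi 0
    (integrableOn_sideKernel (e := 1) (by simp) hβ hz) tendsto_id
  have i2 := intervalIntegral_tendsto_integral_Ioi 0
    (integrableOn_sideKernel (e := -1) (by simp) hβ hz) tendsto_id
  have hlim := (((tendsto_const_nhds (x := ∫ s in (-1 : ℝ)..1, F s)).sub htop).add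
    (i1.const_mul Complex.I)).sub (i2.const_mul Complex.I)
  have hev : (fun T : ℝ => (∫ s in (-1 : ℝ)..1, F s) -
      (∫ s in (-1 : ℝ)..1, F (s + T * Complex.I)) +
      Complex.I * (∫ τ in (0 : ℝ)..id T, sideKernel 1 β z τ) -
      Complex.I * (∫ τ in (0 : ℝ)..id T, sideKernel (-1) β z τ)) =ᶠ[atTop] fun _ => 0 := by
    filter_upwards [eventually_gt_atTop 0] with T hT using hrect T hT
  have heq := tendsto_nhds_unique (hlim.congr' hev) tendsto_const_nhds
  have hreal : ∫ s in (-1 : ℝ)..1, (((1 - s ^ 2) ^ β : ℝ) : ℂ) * Complex.exp (Complex.I * z * s) =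
      ∫ s in (-1 : ℝ)..1, F s := by
    refine intervalIntegral.integral_congr fun s hs => ?_
    rw [uIcc_of_le (by norm_num)] at hs
    have h1 : 0 ≤ 1 - s := by linarith [hs.2]
    have h2 : 0 ≤ 1 + s := by linarith [hs.1]
    rw [hF, poissonIntegrand, show 1 - s ^ 2 = (1 - s) * (1 + s) by ring, Real.mul_rpow h1 h2]
    push_cast [Complex.ofReal_cpow h1, Complex.ofReal_cpow h2]
    rfl
  rw [hreal]
  linear_combination heq

/-- The product of a power with `besselE` grows at most like `e^{|Im z|}` in the sector
`|Im z| ≤ Re z`. -/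
theorem exists_norm_rpow_mul_besselE_le {β : ℝ} (hβ : 0 < β) :
    ∃ C : ℝ, 0 ≤ C ∧ ∀ z : ℂ, |z.im| ≤ z.re →
      ‖z‖ ^ (β + 1) * ‖besselE (β + 1 / 2) z‖ ≤ C * Real.exp |z.im| := by
  have hG : 0 < Real.Gamma (β + 1) := Real.Gamma_pos_of_pos (by linarith)
  have hG2 : 0 < Real.Gamma (β + 1 / 2 + 1) := Real.Gamma_pos_of_pos (by linarith)
  have hK := expConst_nonneg hβ
  set D := Real.sqrt Real.pi * Real.Gamma (β + 1) with hD
  have hD0 : 0 < D := by positivity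
  set C₁ := D⁻¹ * (4 ^ (β + 1) * (2 * (expConst β * Real.Gamma (β + 1)))) with hC₁
  set C₂ := 2 ^ (β + 1) * ((Real.Gamma (β + 1 / 2 + 1))⁻¹ * Real.exp 2) with hC₂
  have hC₁0 : 0 ≤ C₁ := by positivity
  have hC₂0 : 0 ≤ C₂ := by positivity
  refine ⟨C₁ + C₂, by positivity, fun z hz => ?_⟩
  have hre : 0 ≤ z.re := (abs_nonneg _).trans hz
  have hn : ‖z‖ ≤ 2 * z.re := by
    have := Complex.norm_le_abs_re_add_abs_im z
    rw [abs_of_nonneg hre] at this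
    linarith
  have hexp1 : 1 ≤ Real.exp |z.im| := Real.one_le_exp (abs_nonneg _)
  rcases le_total 1 z.re with h1 | h1
  · have hz0 : 0 < z.re := by linarith
    have hE : D * ‖besselE (β + 1 / 2) z‖ ≤
        2 * (Real.exp |z.im| * (expConst β * ((2 / z.re) ^ (β + 1) * Real.Gamma (β + 1)))) := by
      have h2 := besselE_eq_poisson hβ z
      rw [poisson_eq_sides hβ h1] at h2
      have h3 := congrArg norm h2
      rw [norm_mul, Complex.norm_real, Real.norm_of_nonneg hD0.le] at h3
      rw [h3]
      refine (norm_sub_le _ _).trans ?_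
      rw [norm_mul, norm_mul, Complex.norm_I, one_mul, one_mul, two_mul]
      exact add_le_add (norm_integral_sideKernel_le (by simp) hβ h1)
        (norm_integral_sideKernel_le (by simp) hβ h1)
    have hpow : ‖z‖ ^ (β + 1) * (2 / z.re) ^ (β + 1) ≤ 4 ^ (β + 1) := by
      rw [← Real.mul_rpow (norm_nonneg _) (by positivity)]
      refine Real.rpow_le_rpow (by positivity) ?_ (by linarith)
      rw [mul_div_assoc', div_le_iff₀ hz0]
      linarith
    calc ‖z‖ ^ (β + 1) * ‖besselE (β + 1 / 2) z‖
        = D⁻¹ * (‖z‖ ^ (β + 1) * (D * ‖besselE (β + 1 / 2) z‖)) := by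
          field_simp
      _ ≤ D⁻¹ * (‖z‖ ^ (β + 1) * (2 * (Real.exp |z.im| *
          (expConst β * ((2 / z.re) ^ (β + 1) * Real.Gamma (β + 1)))))) := by gcongr
      _ = D⁻¹ * ((‖z‖ ^ (β + 1) * (2 / z.re) ^ (β + 1)) *
          (2 * (expConst β * Real.Gamma (β + 1)))) * Real.exp |z.im| := by ring
      _ ≤ C₁ * Real.exp |z.im| := by rw [hC₁]; gcongr
      _ ≤ _ := by gcongr; linarith
  · have hz2 : ‖z‖ ≤ 2 := by linarith
    calc ‖z‖ ^ (β + 1) * ‖besselE (β + 1 / 2) z‖ ≤ C₂ := by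
          refine mul_le_mul (by gcongr) ((norm_besselE_le (by positivity) z).trans (by gcongr))
            (norm_nonneg _) (by positivity)
      _ ≤ (C₁ + C₂) * 1 := by linarith
      _ ≤ _ := by gcongr

/-- The leading coefficients of the asymptotic expansion of the two sides. -/
def sideConst (e β : ℝ) : ℂ :=
  ((2 ^ β : ℝ) : ℂ) * (-(e * Complex.I)) ^ (β : ℂ) / ((Real.sqrt Real.pi : ℝ) : ℂ)

/-- The mean value inequality along the side. -/
lemma norm_two_add_side_cpow_sub_le {e β : ℝ} (he : |e| = 1) (hβ : 0 < β) {τ : ℝ} (hτ : 0 ≤ τ) :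
    ‖(2 + e * Complex.I * τ : ℂ) ^ (β : ℂ) - ((2 ^ β : ℝ) : ℂ)‖ ≤
      β * (expConst β * Real.exp (τ / 2)) * τ := by
  set f : ℝ → ℂ := fun r => (2 + e * Complex.I * r : ℂ) ^ (β : ℂ) with hf
  have hd : ∀ r ∈ Icc 0 τ, HasDerivWithinAt f
      ((β : ℂ) * (2 + e * Complex.I * r) ^ ((β : ℂ) - 1) * (e * Complex.I)) (Icc 0 τ) r := by
    intro r _
    have h1 : HasDerivAt (fun w : ℂ => 2 + e * Complex.I * w) (e * Complex.I) (r : ℂ) := by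
      simpa using ((hasDerivAt_id (r : ℂ)).const_mul (e * Complex.I)).const_add 2
    exact (h1.cpow_const (c := (β : ℂ))
      (Or.inl (by rw [re_two_add_side]; norm_num))).comp_ofReal.hasDerivWithinAt
  have hb : ∀ r ∈ Icc 0 τ,
      ‖(β : ℂ) * (2 + e * Complex.I * r) ^ ((β : ℂ) - 1) * (e * Complex.I)‖ ≤
        β * (expConst β * Real.exp (τ / 2)) := by
    intro r hr
    have h2 : (2 : ℝ) ≤ ‖(2 + e * Complex.I * r : ℂ)‖ := by
      have := Complex.re_le_norm (2 + e * Complex.I * r : ℂ)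
      rwa [re_two_add_side] at this
    have e1 : (β : ℂ) - 1 = ((β - 1 : ℝ) : ℂ) := by push_cast; ring
    rw [norm_mul, norm_mul, norm_mul, Complex.norm_I, Complex.norm_real, Complex.norm_real,
      Real.norm_eq_abs e, he, one_mul, mul_one, e1, Complex.norm_cpow_real,
      Real.norm_of_nonneg hβ.le]
    refine mul_le_mul_of_nonneg_left ?_ hβ.le
    calc ‖(2 + e * Complex.I * r : ℂ)‖ ^ (β - 1) ≤ ‖(2 + e * Complex.I * r : ℂ)‖ ^ β :=
          Real.rpow_le_rpow_of_exponent_le (by linarith) (by linarith)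
      _ ≤ (2 + τ) ^ β := by
          refine Real.rpow_le_rpow (norm_nonneg _) ?_ hβ.le
          linarith [norm_two_add_side_le he hr.1, hr.2]
      _ ≤ _ := two_add_rpow_le hβ hτ
  have h := (convex_Icc 0 τ).norm_image_sub_le_of_norm_hasDerivWithin_le hd hb
    (left_mem_Icc.2 hτ) (right_mem_Icc.2 hτ)
  have h0 : f 0 = ((2 ^ β : ℝ) : ℂ) := by
    simp only [hf]
    rw [Complex.ofReal_cpow (by norm_num)]
    simp
  rw [h0, sub_zero, Real.norm_of_nonneg hτ] at h
  exact h

/-- The leading term of one side, with an error that is smaller by a factor `1/w`. -/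
lemma norm_integral_sideKernel_sub_le {e β : ℝ} (he : |e| = 1) (hβ : 0 < β) {w : ℝ} (hw : 1 ≤ w) :
    ‖((w ^ (β + 1) : ℝ) : ℂ) * (∫ τ in Ioi (0 : ℝ), sideKernel e β w τ) -
      ((Real.sqrt Real.pi * Real.Gamma (β + 1) : ℝ) : ℂ) *
        (sideConst e β * Complex.exp (Complex.I * e * w))‖ ≤
      β * expConst β * 2 ^ (β + 2) * Real.Gamma (β + 2) / w := by
  have hw0 : 0 < w := by linarith
  have hz : 1 ≤ ((w : ℂ)).re := by simpa using hw
  have hK := expConst_nonneg hβ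
  set c : ℂ := ((2 ^ β : ℝ) : ℂ) * (-(e * Complex.I)) ^ (β : ℂ) * Complex.exp (Complex.I * e * w)
    with hc
  set main : ℝ → ℂ := fun τ => c * ((τ ^ β * Real.exp (-(w * τ)) : ℝ) : ℂ) with hmain
  have hmi : IntegrableOn main (Ioi 0) :=
    ((integrableOn_rpow_mul_exp_neg (by linarith : -1 < β) hw0).ofReal).const_mul c
  have hmainint : ((w ^ (β + 1) : ℝ) : ℂ) * ∫ τ in Ioi (0 : ℝ), main τ =
      ((Real.sqrt Real.pi * Real.Gamma (β + 1) : ℝ) : ℂ) *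
        (sideConst e β * Complex.exp (Complex.I * e * w)) := by
    have h := Real.integral_rpow_mul_exp_neg_mul_Ioi (a := β + 1) (by linarith) hw0
    rw [add_sub_cancel_right] at h
    have hpi : ((Real.sqrt Real.pi : ℝ) : ℂ) ≠ 0 := by
      exact_mod_cast (Real.sqrt_pos.2 Real.pi_pos).ne'
    simp only [hmain]
    rw [integral_const_mul, integral_complex_ofReal, h, hc, sideConst, one_div,
      Real.inv_rpow hw0.le]
    have hwb : ((w ^ (β + 1) : ℝ) : ℂ) ≠ 0 := by
      exact_mod_cast (Real.rpow_pos_of_pos hw0 _).ne'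
    push_cast
    field_simp
  rw [← hmainint, ← mul_sub, ← integral_sub (integrableOn_sideKernel he hβ hz) hmi, norm_mul,
    Complex.norm_real, Real.norm_of_nonneg (by positivity)]
  have hpt : ∀ τ ∈ Ioi (0 : ℝ), ‖sideKernel e β w τ - main τ‖ ≤
      β * expConst β * (τ ^ (β + 1) * Real.exp (-(w / 2 * τ))) := by
    intro τ hτ
    have hτ : 0 < τ := hτ
    have he0 : -(e * Complex.I) ≠ 0 := by
      have : e ≠ 0 := by rintro rfl; simp at he
      simpa using this
    have hsplit : (-(e * Complex.I * τ) : ℂ) ^ (β : ℂ) =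
        ((τ ^ β : ℝ) : ℂ) * (-(e * Complex.I)) ^ (β : ℂ) := by
      have h1 : -(e * Complex.I * τ) = (τ : ℂ) * -(e * Complex.I) := by ring
      have hτ0 : (τ : ℂ) ≠ 0 := by exact_mod_cast hτ.ne'
      rw [h1, Complex.ofReal_cpow hτ.le, Complex.cpow_def_of_ne_zero (mul_ne_zero hτ0 he0),
        Complex.cpow_def_of_ne_zero hτ0, Complex.cpow_def_of_ne_zero he0,
        Complex.log_ofReal_mul hτ he0, ← Complex.exp_add, Complex.ofReal_log hτ.le]
      ring_nf
    have hexp : Complex.exp (Complex.I * w * (e + Complex.I * τ)) =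
        Complex.exp (Complex.I * e * w) * ((Real.exp (-(w * τ)) : ℝ) : ℂ) := by
      rw [Complex.ofReal_exp, ← Complex.exp_add]
      congr 1
      push_cast
      linear_combination (w * τ : ℂ) * Complex.I_mul_I
    have hdiff : sideKernel e β w τ - main τ =
        ((2 + e * Complex.I * τ : ℂ) ^ (β : ℂ) - ((2 ^ β : ℝ) : ℂ)) *
          ((-(e * Complex.I * τ)) ^ (β : ℂ) *
            Complex.exp (Complex.I * w * (e + Complex.I * τ))) := by
      rw [sideKernel, hmain, hsplit, hexp, hc]
      push_cast
      ring
    have hside := norm_exp_side he (w : ℂ) τ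
    simp only [Complex.ofReal_im, abs_zero, Real.exp_zero, one_mul, Complex.ofReal_re] at hside
    rw [hdiff, norm_mul, norm_mul, Complex.norm_cpow_real, norm_neg, norm_side_mul he hτ.le]
    have h2 : Real.exp (τ / 2) * Real.exp (-(w * τ)) ≤ Real.exp (-(w / 2 * τ)) := by
      rw [← Real.exp_add]
      refine Real.exp_le_exp.2 ?_
      nlinarith
    calc _ ≤ β * (expConst β * Real.exp (τ / 2)) * τ * (τ ^ β * Real.exp (-(w * τ))) := by
          gcongr
          exact norm_two_add_side_cpow_sub_le he hβ hτ.le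
      _ = β * expConst β * (τ ^ (β + 1) * (Real.exp (τ / 2) * Real.exp (-(w * τ)))) := by
          rw [Real.rpow_add_one hτ.ne']; ring
      _ ≤ _ := by gcongr
  have hint := (integrableOn_rpow_mul_exp_neg (s := β + 1) (by linarith)
    (half_pos hw0)).const_mul (β * expConst β)
  have hle := norm_integral_le_of_norm_le hint
    ((ae_restrict_iff' measurableSet_Ioi).2 (Eventually.of_forall hpt))
  have h := Real.integral_rpow_mul_exp_neg_mul_Ioi (a := β + 2) (by linarith) (half_pos hw0)
  rw [show β + 2 - 1 = β + 1 by ring] at h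
  rw [integral_const_mul, h, one_div_div] at hle
  calc _ ≤ w ^ (β + 1) * (β * expConst β * ((2 / w) ^ (β + 2) * Real.Gamma (β + 2))) := by gcongr
    _ = _ := by
      rw [Real.div_rpow (by norm_num) hw0.le, show β + 2 = β + 1 + 1 by ring,
        Real.rpow_add_one hw0.ne' (β + 1)]
      have := (Real.rpow_pos_of_pos hw0 (β + 1)).ne'
      field_simp

/-- The large-argument asymptotics of the Bessel function on the positive half-line, with an
error that is uniform down to the origin. -/
theorem exists_norm_rpow_mul_besselE_sub_le {β : ℝ} (hβ : 0 < β) :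
    ∃ C : ℝ, 0 ≤ C ∧ ∀ w : ℝ, 0 < w →
      ‖((w ^ (β + 1) : ℝ) : ℂ) * besselE (β + 1 / 2) w -
        (Complex.I * (sideConst (-1) β * Complex.exp (-(Complex.I * w))) -
          Complex.I * (sideConst 1 β * Complex.exp (Complex.I * w)))‖ ≤ C / (1 + w) := by
  have hG : 0 < Real.Gamma (β + 1) := Real.Gamma_pos_of_pos (by linarith)
  have hG3 : 0 < Real.Gamma (β + 2) := Real.Gamma_pos_of_pos (by linarith)
  have hK := expConst_nonneg hβ
  obtain ⟨C₀, hC₀, hE⟩ := exists_norm_rpow_mul_besselE_le hβ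
  set D := Real.sqrt Real.pi * Real.Gamma (β + 1) with hD
  have hD0 : 0 < D := by positivity
  set B := β * expConst β * 2 ^ (β + 2) * Real.Gamma (β + 2) with hB
  have hB0 : 0 ≤ B := by positivity
  set C₂ := C₀ + (‖sideConst (-1) β‖ + ‖sideConst 1 β‖) with hC₂
  have hC₂0 : 0 ≤ C₂ := by positivity
  refine ⟨2 * (D⁻¹ * (2 * B) + C₂), by positivity, fun w hw => ?_⟩
  rcases le_total 1 w with h1 | h1
  · have h2 := besselE_eq_poisson hβ (w : ℂ)
    rw [poisson_eq_sides hβ (by simpa using h1), ← hD] at h2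
    have r1 := norm_integral_sideKernel_sub_le (e := -1) (by simp) hβ h1
    have r2 := norm_integral_sideKernel_sub_le (e := 1) (by simp) hβ h1
    rw [← hB, ← hD] at r1 r2
    have hDC : (D : ℂ) ≠ 0 := by exact_mod_cast hD0.ne'
    have e1 : Complex.exp (Complex.I * (-1 : ℝ) * w) = Complex.exp (-(Complex.I * w)) := by
      congr 1; push_cast; ring
    have e2 : Complex.exp (Complex.I * (1 : ℝ) * w) = Complex.exp (Complex.I * w) := by
      congr 1; push_cast; ring
    rw [e1] at r1
    rw [e2] at r2
    set S₁ := ∫ τ in Ioi (0 : ℝ), sideKernel (-1) β w τ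
    set S₂ := ∫ τ in Ioi (0 : ℝ), sideKernel 1 β w τ
    have hsum := (norm_sub_le _ _).trans (add_le_add r1 r2)
    have hbes : besselE (β + 1 / 2) w = (D : ℂ)⁻¹ * (Complex.I * S₁ - Complex.I * S₂) := by
      rw [← h2, inv_mul_cancel_left₀ hDC]
    have hid : ((w ^ (β + 1) : ℝ) : ℂ) * besselE (β + 1 / 2) w -
        (Complex.I * (sideConst (-1) β * Complex.exp (-(Complex.I * w))) -
          Complex.I * (sideConst 1 β * Complex.exp (Complex.I * w))) =
        (D : ℂ)⁻¹ * (Complex.I * ((((w ^ (β + 1) : ℝ) : ℂ) * S₁ -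
          D * (sideConst (-1) β * Complex.exp (-(Complex.I * w)))) -
          (((w ^ (β + 1) : ℝ) : ℂ) * S₂ -
          D * (sideConst 1 β * Complex.exp (Complex.I * w))))) := by
      rw [hbes]
      field_simp
      ring
    rw [hid, norm_mul, norm_inv, Complex.norm_real, Real.norm_of_nonneg hD0.le, norm_mul,
      Complex.norm_I, one_mul]
    calc _ ≤ D⁻¹ * (B / w + B / w) := by gcongr
      _ = D⁻¹ * (2 * B) / w := by ring
      _ ≤ 2 * (D⁻¹ * (2 * B)) / (1 + w) := by
        rw [div_le_div_iff₀ hw (by positivity)]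
        have : 0 ≤ D⁻¹ * (2 * B) := by positivity
        nlinarith
      _ ≤ _ := by gcongr; linarith
  · have hexp : ∀ r : ℝ, ‖Complex.exp (Complex.I * r)‖ = 1 := fun r => by
      rw [mul_comm, Complex.norm_exp_ofReal_mul_I]
    have h2 : ‖((w ^ (β + 1) : ℝ) : ℂ) * besselE (β + 1 / 2) w‖ ≤ C₀ := by
      have := hE w (by simpa using hw.le)
      simp only [Complex.ofReal_im, abs_zero, Real.exp_zero, mul_one, Complex.norm_real,
        Real.norm_of_nonneg hw.le] at this
      rwa [norm_mul, Complex.norm_real, Real.norm_of_nonneg (by positivity)]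
    have h3 : ‖Complex.I * (sideConst (-1) β * Complex.exp (-(Complex.I * w))) -
          Complex.I * (sideConst 1 β * Complex.exp (Complex.I * w))‖ ≤
          ‖sideConst (-1) β‖ + ‖sideConst 1 β‖ := by
      have h4 := hexp (-w)
      rw [Complex.ofReal_neg, mul_neg] at h4
      refine (norm_sub_le _ _).trans_eq ?_
      rw [norm_mul, norm_mul, norm_mul, norm_mul, Complex.norm_I, h4, hexp]
      ring
    calc _ ≤ C₂ := (norm_sub_le _ _).trans (add_le_add h2 h3)
      _ ≤ 2 * C₂ / (1 + w) := by
        rw [le_div_iff₀ (by positivity)]; nlinarith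
      _ ≤ _ := by
        have : 0 ≤ D⁻¹ * (2 * B) := by positivity
        gcongr; linarith

/-! ### The improper integral against the Green function -/

/-- The `x'`-dependent part of `G(t, x, 0, x') e^{iλx'}`, as a holomorphic function of `x'` in the
right half-plane; `β = ν - 1/2`. -/
def pathIntegrand (β t x lam : ℝ) (z : ℂ) : ℂ :=
  z ^ ((β + 1 : ℝ) : ℂ) * besselE (β + 1 / 2) (x * z / t) *
    Complex.exp (Complex.I * (z ^ 2 / (2 * t)) + Complex.I * lam * z)

/-- The part of the Green function that does not depend on `x'`. -/
def outerFactor (u t x : ℝ) : ℂ :=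
  (-Complex.I) ^ ((besselIndex u : ℂ) + 1) / ((2 ^ besselIndex u : ℝ) : ℂ) *
    (Complex.exp (Complex.I * (x ^ 2 / (2 * t))) *
      ((x ^ (besselIndex u + 1 / 2) / t ^ (besselIndex u + 1) : ℝ) : ℂ))

section PathIntegrand

variable {β t x lam : ℝ}

lemma continuousOn_pathIntegrand (hβ : 0 < β) :
    ContinuousOn (pathIntegrand β t x lam) {z | 0 ≤ z.re} := by
  have hE := continuous_besselE (by positivity : 0 ≤ β + 1 / 2)
  refine ContinuousOn.mul (ContinuousOn.mul ?_ (hE.comp (by fun_prop)).continuousOn) (by fun_prop)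
  intro z hz
  have hβ1 : 0 < (((β + 1 : ℝ) : ℂ)).re := by simp only [Complex.ofReal_re]; linarith
  exact (Complex.continuousAt_cpow_const_of_re_pos (Or.inl hz) hβ1).continuousWithinAt

lemma differentiableOn_pathIntegrand (hβ : 0 < β) :
    DifferentiableOn ℂ (pathIntegrand β t x lam) {z | 0 < z.re} := by
  have hE := differentiable_besselE (by positivity : 0 ≤ β + 1 / 2)
  refine DifferentiableOn.mul (DifferentiableOn.mul ?_
    (hE.comp (by fun_prop)).differentiableOn) (by fun_prop)
  intro z hz
  exact (DifferentiableAt.cpow_const differentiableAt_id (Or.inl hz)).differentiableWithinAt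

/-- The decay `e^{-Im z Re z / t}` of the Gaussian phase beats the growth `e^{x Im z / t}` of the
Bessel function and `e^{|λ| Im z}` of the plane wave as soon as `Re z > x + |λ| t`. -/
lemma norm_pathIntegrand_le {C : ℝ}
    (hE : ∀ z : ℂ, |z.im| ≤ z.re →
      ‖z‖ ^ (β + 1) * ‖besselE (β + 1 / 2) z‖ ≤ C * Real.exp |z.im|)
    (ht : 0 < t) (hx : 0 < x) {z : ℂ} (h0 : 0 ≤ z.im) (hz : z.im ≤ z.re) :
    ‖pathIntegrand β t x lam z‖ ≤
      C * (t / x) ^ (β + 1) * Real.exp (-(z.im * ((z.re - x) / t - |lam|))) := by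
  have hw : (x * z / t : ℂ) = ((x / t : ℝ) : ℂ) * z := by push_cast; ring
  have hre : (x * z / t : ℂ).re = x / t * z.re := by rw [hw, Complex.re_ofReal_mul]
  have him : (x * z / t : ℂ).im = x / t * z.im := by rw [hw, Complex.im_ofReal_mul]
  have hn : ‖(x * z / t : ℂ)‖ = x / t * ‖z‖ := by
    rw [hw, norm_mul, Complex.norm_real, Real.norm_of_nonneg (by positivity)]
  have h1 := hE (x * z / t) (by
    rw [hre, him, abs_of_nonneg (by positivity)]; gcongr)
  rw [hn, him, abs_of_nonneg (by positivity), Real.mul_rpow (by positivity) (norm_nonneg _)] at h1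
  have h2 : ‖Complex.exp (Complex.I * (z ^ 2 / (2 * t)) + Complex.I * lam * z)‖ ≤
      Real.exp (-(z.re * z.im / t) + |lam| * z.im) := by
    rw [Complex.norm_exp]
    refine Real.exp_le_exp.2 ?_
    have e : (Complex.I * (z ^ 2 / (2 * t)) + Complex.I * lam * z).re =
        -(z.re * z.im / t) + -lam * z.im := by
      have e1 : z ^ 2 / (2 * t) = (((2 * t)⁻¹ : ℝ) : ℂ) * z ^ 2 := by push_cast; ring
      rw [Complex.add_re, e1, Complex.I_mul_re, Complex.im_ofReal_mul, sq, Complex.mul_im,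
        mul_assoc, Complex.I_mul_re, Complex.im_ofReal_mul]
      field_simp
      ring
    rw [e]
    gcongr
    exact neg_le_abs lam
  have hpow : (t / x) ^ (β + 1) * (x / t) ^ (β + 1) = 1 := by
    rw [← Real.mul_rpow (by positivity) (by positivity)]
    rw [div_mul_div_cancel₀ hx.ne', div_self ht.ne', Real.one_rpow]
  rw [pathIntegrand, norm_mul, norm_mul, Complex.norm_cpow_real]
  set X := ‖Complex.exp (Complex.I * (z ^ 2 / (2 * t)) + Complex.I * lam * z)‖
  calc ‖z‖ ^ (β + 1) * ‖besselE (β + 1 / 2) (x * z / t)‖ * X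
      = ((t / x) ^ (β + 1) * (x / t) ^ (β + 1)) *
        (‖z‖ ^ (β + 1) * ‖besselE (β + 1 / 2) (x * z / t)‖) * X := by rw [hpow, one_mul]
    _ = (t / x) ^ (β + 1) * ((x / t) ^ (β + 1) * ‖z‖ ^ (β + 1) *
        ‖besselE (β + 1 / 2) (x * z / t)‖) * X := by ring
    _ ≤ (t / x) ^ (β + 1) * (C * Real.exp (x / t * z.im)) *
        Real.exp (-(z.re * z.im / t) + |lam| * z.im) := by
        have : 0 ≤ C * Real.exp (x / t * z.im) := le_trans (by positivity) h1
        gcongr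
    _ = C * (t / x) ^ (β + 1) * (Real.exp (x / t * z.im) *
        Real.exp (-(z.re * z.im / t) + |lam| * z.im)) := by ring
    _ = _ := by
        rw [← Real.exp_add]
        congr 2
        ring

lemma norm_pathIntegrand_ray_le {C A : ℝ}
    (hE : ∀ z : ℂ, |z.im| ≤ z.re →
      ‖z‖ ^ (β + 1) * ‖besselE (β + 1 / 2) z‖ ≤ C * Real.exp |z.im|)
    (ht : 0 < t) (hx : 0 < x) (hA : 0 ≤ A) {r : ℝ} (hr : 0 ≤ r) :
    ‖pathIntegrand β t x lam (A + rot * r)‖ ≤ C * (t / x) ^ (β + 1) *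
      Real.exp (-(1 / (2 * t)) * r ^ 2 + -(Real.sqrt 2 / 2 * ((A - x) / t - |lam|)) * r) := by
  have hre : ((A : ℂ) + rot * r).re = A + Real.sqrt 2 / 2 * r := by
    rw [Complex.add_re, re_rot_mul, Complex.ofReal_re]
  have him : ((A : ℂ) + rot * r).im = Real.sqrt 2 / 2 * r := by
    rw [Complex.add_im, im_rot_mul, Complex.ofReal_im, zero_add]
  refine (norm_pathIntegrand_le (lam := lam) hE ht hx (z := A + rot * r)
    (by rw [him]; positivity) (by rw [him, hre]; linarith)).trans_eq ?_
  rw [him, hre]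
  congr 2
  have h2 : Real.sqrt 2 ^ 2 = 2 := Real.sq_sqrt (by norm_num)
  field_simp
  ring_nf
  rw [h2]
  ring

lemma integrableOn_pathIntegrand_ray (hβ : 0 < β) (ht : 0 < t) (hx : 0 < x) {A : ℝ}
    (hA : 0 ≤ A) :
    IntegrableOn (fun r : ℝ => pathIntegrand β t x lam (A + rot * r)) (Ioi 0) := by
  obtain ⟨C, hC, hE⟩ := exists_norm_rpow_mul_besselE_le hβ
  have h := (integrableOn_rpow_mul_exp (s := 0) (by norm_num)
    (by positivity : 0 < 1 / (2 * t))
    (-(Real.sqrt 2 / 2 * ((A - x) / t - |lam|)))).const_mul (C * (t / x) ^ (β + 1))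
  simp only [Real.rpow_zero, one_mul] at h
  refine h.mono' ?_ ?_
  · refine ContinuousOn.aestronglyMeasurable ?_ measurableSet_Ioi
    refine (continuousOn_pathIntegrand hβ).comp (by fun_prop) fun r hr => ?_
    have hr : 0 < r := hr
    simp only [mem_ofPred_eq]
    rw [Complex.add_re, re_rot_mul, Complex.ofReal_re]
    positivity
  · exact (ae_restrict_iff' measurableSet_Ioi).2 (Eventually.of_forall fun r hr =>
      norm_pathIntegrand_ray_le hE ht hx hA (le_of_lt hr))

/-- The tail of the oscillatory integral, from `A` on, equals the integral over the ray with
direction `e^{iπ/4}` from `A`. -/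
theorem tendsto_integral_pathIntegrand_shift (hβ : 0 < β) (ht : 0 < t) (hx : 0 < x) {A : ℝ}
    (hA : 0 ≤ A) :
    Tendsto (fun R : ℝ => ∫ r in (0 : ℝ)..R, pathIntegrand β t x lam (A + r)) atTop
      (𝓝 (rot * ∫ r in Ioi (0 : ℝ), pathIntegrand β t x lam (A + rot * r))) := by
  obtain ⟨C, hC, hE⟩ := exists_norm_rpow_mul_besselE_le hβ
  -- for `r ≥ r₀` the gain `r cos θ ≥ r / 2` is at least twice the loss `x + |λ| t`
  refine tendsto_integral_rot (h := fun z => pathIntegrand β t x lam (A + z))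
    (C := C * (t / x) ^ (β + 1)) (c := 1 / (8 * t)) (r₀ := 4 * (x + |lam| * t)) ?_ ?_
    (by positivity) (by positivity) ?_ (integrableOn_pathIntegrand_ray hβ ht hx hA)
  · refine (continuousOn_pathIntegrand hβ).comp (by fun_prop) fun z hz => ?_
    have hz : 0 ≤ z.re := hz
    simp only [mem_ofPred_eq]
    rw [Complex.add_re, Complex.ofReal_re]
    positivity
  · refine (differentiableOn_pathIntegrand hβ).comp (by fun_prop) fun z hz => ?_
    have hz : 0 < z.re := hz
    simp only [mem_ofPred_eq]
    rw [Complex.add_re, Complex.ofReal_re]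
    positivity
  · intro r hr θ hθ
    have hr0 : 0 ≤ r := le_trans (by positivity) hr
    have hs := le_sin_mul hθ
    have hs0 : 0 ≤ Real.sin θ := by linarith [hθ.1]
    have hc := half_le_cos hθ
    have hsc : Real.sin θ ≤ Real.cos θ := by
      have h1 : Real.sin θ ≤ Real.sin (Real.pi / 4) :=
        Real.sin_le_sin_of_le_of_le_pi_div_two (by linarith [hθ.1, Real.pi_pos])
          (by linarith [Real.pi_pos]) hθ.2
      have h2 : Real.cos (Real.pi / 4) ≤ Real.cos θ :=
        Real.cos_le_cos_of_nonneg_of_le_pi hθ.1 (by linarith [Real.pi_pos]) hθ.2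
      rw [Real.sin_pi_div_four] at h1
      rw [Real.cos_pi_div_four] at h2
      linarith
    have hre : ((A : ℂ) + r * Complex.exp (θ * Complex.I)).re = A + r * Real.cos θ := by
      rw [Complex.add_re, re_mul_exp, Complex.ofReal_re]
    have him : ((A : ℂ) + r * Complex.exp (θ * Complex.I)).im = r * Real.sin θ := by
      rw [Complex.add_im, im_mul_exp, Complex.ofReal_im, zero_add]
    refine (norm_pathIntegrand_le (lam := lam) hE ht hx
      (z := A + r * Complex.exp (θ * Complex.I)) (by rw [him]; positivity)
      (by rw [him, hre]; nlinarith)).trans ?_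
    refine mul_le_mul_of_nonneg_left (Real.exp_le_exp.2 ?_) (by positivity)
    rw [him, hre, neg_le_neg_iff]
    have h1 : r / (4 * t) ≤ (A + r * Real.cos θ - x) / t - |lam| := by
      rw [div_sub' ht.ne', div_le_div_iff₀ (by positivity) ht]
      have : r * (1 / 2) ≤ r * Real.cos θ := by gcongr
      nlinarith
    calc 1 / (8 * t) * r ^ 2 * θ = r * (θ / 2) * (r / (4 * t)) := by field_simp; ring
      _ ≤ r * Real.sin θ * ((A + r * Real.cos θ - x) / t - |lam|) := by
        have : 0 ≤ r / (4 * t) := by positivity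
        gcongr

end PathIntegrand

lemma rot_mul_cpow {y : ℝ} (hy : 0 < y) (s : ℝ) :
    (rot * y) ^ (s : ℂ) = Complex.exp (Complex.I * s * Real.pi / 4) * ((y ^ s : ℝ) : ℂ) := by
  have hy0 : (y : ℂ) ≠ 0 := by exact_mod_cast hy.ne'
  have hr0 : rot ≠ 0 := Complex.exp_ne_zero _
  have hlog : Complex.log rot = Complex.I * Real.pi / 4 := by
    rw [rot, Complex.log_exp]
    · simp; linarith [Real.pi_pos]
    · simp; linarith [Real.pi_pos]
  rw [mul_comm, Complex.cpow_def_of_ne_zero (mul_ne_zero hy0 hr0), Complex.log_ofReal_mul hy hr0,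
    hlog, Complex.ofReal_cpow hy.le, Complex.cpow_def_of_ne_zero hy0, ← Complex.ofReal_log hy.le,
    ← Complex.exp_add]
  ring_nf

lemma half_lt_besselIndex {u : ℝ} (hu : 0 < u) : 1 / 2 < besselIndex u := by
  have : 1 < Real.sqrt (1 + 4 * u) := by
    rw [Real.lt_sqrt (by norm_num)]; linarith
  rw [besselIndex]; linarith

/-- The regularized integral, rewritten as the integral of the holomorphic integrand along the
rotated half-line. -/
lemma phi_eq_outerFactor_mul {u t x β : ℝ} (hβν : besselIndex u = β + 1 / 2) (lam : ℝ) (ht : 0 < t)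
    (hx : 0 < x) :
    phi u lam (t, x) = outerFactor u t x *
      (rot * ∫ r in Ioi (0 : ℝ), pathIntegrand β t x lam (rot * r)) := by
  have hpt : ∀ y ∈ Ioi (0 : ℝ), pathIntegrand β t x lam (rot * y) =
      Complex.exp (Complex.I * ((β + 1 : ℝ) : ℂ) * Real.pi / 4) *
        (kernel (besselIndex u) (besselIndex u + 1 / 2) (t, x) y * planeWave lam (rot * y)) := by
    intro y hy
    have e1 : besselIndex u + 1 / 2 = β + 1 := by rw [hβν]; ring
    have e2 : Complex.exp (Complex.I * ((rot * y) ^ 2 / (2 * t)) + Complex.I * lam * (rot * y)) =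
        ((Real.exp (-(1 / (2 * t)) * y ^ 2) : ℝ) : ℂ) *
          Complex.exp (Complex.I * lam * (rot * y)) := by
      rw [Complex.exp_add, mul_pow, rot_sq]
      congr 1
      push_cast
      congr 1
      linear_combination (y ^ 2 / (2 * t) : ℂ) * Complex.I_mul_I
    rw [pathIntegrand, rot_mul_cpow hy, e2, kernel, planeWave, e1, hβν]
    push_cast
    ring
  rw [setIntegral_congr_fun measurableSet_Ioi hpt, integral_const_mul, phi_eq_evolve,
    evolve_eq_prefactor_mul_moment u _ (show (t, x) ∈ quadrant from ⟨ht, hx⟩), prefactor,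
    outerFactor, moment]
  have e : Complex.exp (Complex.I * (((besselIndex u + 1 / 2 : ℝ) : ℂ) + 1) * Real.pi / 4) =
      rot * Complex.exp (Complex.I * ((β + 1 : ℝ) : ℂ) * Real.pi / 4) := by
    rw [rot, ← Complex.exp_add, hβν]
    congr 1
    push_cast
    ring
  rw [e]
  ring

lemma green_mul_eq {u t x β : ℝ} (hβν : besselIndex u = β + 1 / 2) (lam : ℝ) (ht : 0 < t)
    (hx : 0 < x) {y : ℝ} (hy : 0 < y) :
    green u t x y * Complex.exp (Complex.I * lam * y) =
      outerFactor u t x * pathIntegrand β t x lam y := by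
  have e1 : besselIndex u + 1 / 2 = β + 1 := by rw [hβν]; ring
  have hreal : Real.sqrt (x * y) / t * (x * y / t / 2) ^ (β + 1 / 2) =
      (2 ^ (β + 1 / 2))⁻¹ * (x ^ (β + 1) / t ^ (β + 1 / 2 + 1)) * y ^ (β + 1) := by
    have hsplit : ∀ r : ℝ, 0 < r → r ^ (β + 1) = Real.sqrt r * r ^ (β + 1 / 2) := by
      intro r hr
      rw [Real.sqrt_eq_rpow, ← Real.rpow_add hr]
      congr 1
      ring
    rw [Real.sqrt_mul hx.le, div_div, Real.div_rpow (by positivity) (by positivity),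
      Real.mul_rpow hx.le hy.le, Real.mul_rpow ht.le (by norm_num),
      Real.rpow_add_one ht.ne', hsplit x hx, hsplit y hy]
    have h1 := (Real.rpow_pos_of_pos ht (β + 1 / 2)).ne'
    have h2 := (Real.rpow_pos_of_pos two_pos (β + 1 / 2)).ne'
    generalize t ^ (β + 1 / 2) = T at *
    generalize (2 : ℝ) ^ (β + 1 / 2) = S at *
    field_simp
  have hrealC := congrArg (fun r : ℝ => (r : ℂ)) hreal
  simp only [Complex.ofReal_mul, Complex.ofReal_inv] at hrealC
  have hJ : (((x * y / t : ℝ) : ℂ) / 2) ^ ((β + 1 / 2 : ℝ) : ℂ) =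
      (((x * y / t / 2) ^ (β + 1 / 2) : ℝ) : ℂ) := by
    rw [Complex.ofReal_cpow (by positivity)]
    push_cast
    rfl
  have hexp : Complex.exp (Complex.I * (((x : ℂ) ^ 2 + y ^ 2) / (2 * t))) *
      Complex.exp (Complex.I * lam * y) = Complex.exp (Complex.I * (x ^ 2 / (2 * t))) *
      Complex.exp (Complex.I * ((y : ℂ) ^ 2 / (2 * t)) + Complex.I * lam * y) := by
    rw [← Complex.exp_add, ← Complex.exp_add]
    congr 1
    ring
  have hyp : (y : ℂ) ^ ((β + 1 : ℝ) : ℂ) = ((y ^ (β + 1) : ℝ) : ℂ) :=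
    (Complex.ofReal_cpow hy.le _).symm
  have harg : ((x * y / t : ℝ) : ℂ) = x * y / t := by push_cast; ring
  rw [green, outerFactor, pathIntegrand, besselJ, e1, hβν, hJ, hyp, harg]
  calc _ = (-Complex.I) ^ (((β + 1 / 2 : ℝ) : ℂ) + 1) * besselE (β + 1 / 2) (x * y / t) *
        (((Real.sqrt (x * y) / t : ℝ) : ℂ) * (((x * y / t / 2) ^ (β + 1 / 2) : ℝ) : ℂ)) *
        (Complex.exp (Complex.I * (((x : ℂ) ^ 2 + y ^ 2) / (2 * t))) *
          Complex.exp (Complex.I * lam * y)) := by ring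
    _ = _ := by rw [hrealC, hexp]; ring

/-- The regularized integral is the improper integral against the Green function. -/
theorem tendsto_integral_green {u : ℝ} (hu : 0 < u) (lam : ℝ) {t x : ℝ} (ht : 0 < t)
    (hx : 0 < x) :
    Tendsto (fun R : ℝ => ∫ x' in (0 : ℝ)..R,
      green u t x x' * Complex.exp (Complex.I * lam * x')) atTop (𝓝 (phi u lam (t, x))) := by
  have hβ : 0 < besselIndex u - 1 / 2 := by linarith [half_lt_besselIndex hu]
  have hβν : besselIndex u = (besselIndex u - 1 / 2) + 1 / 2 := by ring
  have h := (tendsto_integral_pathIntegrand_shift (lam := lam) hβ ht hx le_rfl).const_mul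
    (outerFactor u t x)
  simp only [Complex.ofReal_zero, zero_add] at h
  rw [phi_eq_outerFactor_mul hβν lam ht hx]
  refine h.congr' ?_
  filter_upwards [eventually_ge_atTop 0] with R hR
  rw [← intervalIntegral.integral_const_mul]
  refine intervalIntegral.integral_congr_ae (Eventually.of_forall fun y hy => ?_)
  rw [uIoc_of_le hR] at hy
  exact (green_mul_eq hβν lam ht hx hy.1).symm

/-! ### The initial value -/

/-- The Fresnel function `∫₀^R e^{iv²} dv`. -/
def fresnel (R : ℝ) : ℂ := ∫ v in (0 : ℝ)..R, Complex.exp (Complex.I * v ^ 2)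

lemma tendsto_fresnel_atTop :
    Tendsto fresnel atTop (𝓝 (rot * (Real.sqrt Real.pi / 2 : ℝ))) := tendsto_integral_fresnel

lemma fresnel_neg (R : ℝ) : fresnel (-R) = -fresnel R := by
  have h := intervalIntegral.integral_comp_neg (a := 0) (b := R)
    (fun v : ℝ => Complex.exp (Complex.I * v ^ 2))
  simp only [Complex.ofReal_neg, neg_sq, neg_zero] at h
  rw [fresnel, fresnel, h, intervalIntegral.integral_symm]

lemma tendsto_fresnel_atBot :
    Tendsto fresnel atBot (𝓝 (-(rot * (Real.sqrt Real.pi / 2 : ℝ)))) := by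
  have h := (tendsto_fresnel_atTop.comp tendsto_neg_atBot_atTop).neg
  refine h.congr fun R => ?_
  rw [Function.comp_apply, fresnel_neg, neg_neg]

lemma fresnel_sub (a b : ℝ) :
    ∫ v in a..b, Complex.exp (Complex.I * v ^ 2) = fresnel b - fresnel a := by
  rw [fresnel, fresnel, intervalIntegral.integral_interval_sub_left] <;>
  exact Continuous.intervalIntegrable (by fun_prop) _ _

/-- Completing the square in the free propagator. -/
lemma integral_exp_quadratic {t : ℝ} (ht : 0 < t) (y lam A : ℝ) :
    (((Real.sqrt t)⁻¹ : ℝ) : ℂ) * ∫ z in (0 : ℝ)..A,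
      Complex.exp (Complex.I * (z ^ 2 / (2 * t) + y * z / t + lam * z + y ^ 2 / (2 * t))) =
    Complex.exp (Complex.I * (-(lam * y) - lam ^ 2 * t / 2)) * ((Real.sqrt 2 : ℝ) : ℂ) *
      (fresnel ((A + y + lam * t) / Real.sqrt (2 * t)) -
        fresnel ((y + lam * t) / Real.sqrt (2 * t))) := by
  set c := Real.sqrt (2 * t) with hc
  have hc0 : 0 < c := Real.sqrt_pos.2 (by positivity)
  have hc2 : c ^ 2 = 2 * t := Real.sq_sqrt (by positivity)
  have hcC : (c : ℂ) ≠ 0 := by exact_mod_cast hc0.ne'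
  have htC : (t : ℂ) ≠ 0 := by exact_mod_cast ht.ne'
  have hc2C : (c : ℂ) ^ 2 = 2 * t := by exact_mod_cast hc2
  have hint : ∀ z : ℝ, Complex.exp (Complex.I *
      (z ^ 2 / (2 * t) + y * z / t + lam * z + y ^ 2 / (2 * t))) =
      Complex.exp (Complex.I * (-(lam * y) - lam ^ 2 * t / 2)) *
        Complex.exp (Complex.I * (((y + lam * t) / c + z / c : ℝ) : ℂ) ^ 2) := by
    intro z
    rw [← Complex.exp_add]
    congr 1
    push_cast
    rw [← add_div, div_pow, hc2C]
    field_simp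
    ring
  simp only [hint]
  rw [intervalIntegral.integral_const_mul]
  have hsub := intervalIntegral.integral_comp_add_div (a := 0) (b := A) (c := c)
    (fun v : ℝ => Complex.exp (Complex.I * v ^ 2)) hc0.ne' ((y + lam * t) / c)
  rw [hsub, fresnel_sub, Complex.real_smul]
  have e1 : (y + lam * t) / c + A / c = (A + y + lam * t) / c := by ring
  have e2 : (y + lam * t) / c + 0 / c = (y + lam * t) / c := by ring
  rw [e1, e2]
  have hs : c = Real.sqrt 2 * Real.sqrt t := Real.sqrt_mul (by norm_num) t
  have hst : ((Real.sqrt t : ℝ) : ℂ) ≠ 0 := by exact_mod_cast (Real.sqrt_pos.2 ht).ne'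
  rw [mul_left_comm, ← mul_assoc (((Real.sqrt t)⁻¹ : ℝ) : ℂ) (c : ℂ)]
  have e3 : (((Real.sqrt t)⁻¹ : ℝ) : ℂ) * (c : ℂ) = ((Real.sqrt 2 : ℝ) : ℂ) := by
    rw [hs]; push_cast; field_simp
  rw [e3, mul_assoc]

/-- The constant factor of the Green function. -/
def greenConst (u : ℝ) : ℂ :=
  (-Complex.I) ^ ((besselIndex u : ℂ) + 1) / ((2 ^ besselIndex u : ℝ) : ℂ)

/-- The contribution to `phi` of one exponential of the Bessel asymptotics: with `y = -x` it is
the free propagator, with `y = x` its reflection at the origin. -/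
def freeTerm (κ : ℂ) (lam A t y : ℝ) : ℂ :=
  κ * (Complex.exp (Complex.I * (-(lam * y) - lam ^ 2 * t / 2)) * ((Real.sqrt 2 : ℝ) : ℂ) *
      (fresnel ((A + y + lam * t) / Real.sqrt (2 * t)) -
        fresnel ((y + lam * t) / Real.sqrt (2 * t))))

lemma outerFactor_mul {u t x β : ℝ} (hβν : besselIndex u = β + 1 / 2) (ht : 0 < t) (hx : 0 < x) :
    outerFactor u t x * (((t / x) ^ (β + 1) : ℝ) : ℂ) =
      greenConst u * (Complex.exp (Complex.I * (x ^ 2 / (2 * t))) *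
        (((Real.sqrt t)⁻¹ : ℝ) : ℂ)) := by
  have e : x ^ (besselIndex u + 1 / 2) / t ^ (besselIndex u + 1) * (t / x) ^ (β + 1) =
      (Real.sqrt t)⁻¹ := by
    rw [Real.div_rpow ht.le hx.le, hβν, show β + 1 / 2 + 1 / 2 = β + 1 by ring,
      show β + 1 / 2 + 1 = 1 / 2 + (β + 1) by ring, Real.rpow_add ht, ← Real.sqrt_eq_rpow]
    have h1 := (Real.rpow_pos_of_pos ht (β + 1)).ne'
    have h2 := (Real.rpow_pos_of_pos hx (β + 1)).ne'
    field_simp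
  rw [← e, outerFactor, greenConst]
  push_cast
  ring

lemma pathIntegrand_ofReal {β t x lam z : ℝ} (ht : 0 < t) (hx : 0 < x) (hz : 0 < z) :
    pathIntegrand β t x lam z = (((t / x) ^ (β + 1) : ℝ) : ℂ) *
      (((((x * z / t) ^ (β + 1) : ℝ) : ℂ) * besselE (β + 1 / 2) ((x * z / t : ℝ) : ℂ)) *
        Complex.exp (Complex.I * (z ^ 2 / (2 * t)) + Complex.I * lam * z)) := by
  have e : z ^ (β + 1) = (t / x) ^ (β + 1) * (x * z / t) ^ (β + 1) := by
    rw [← Real.mul_rpow (by positivity) (by positivity)]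
    congr 1
    field_simp
  rw [pathIntegrand, ← Complex.ofReal_cpow hz.le, e]
  push_cast
  ring

/-- The rotation of the contour may start at any `A > 0` instead of the origin. -/
lemma phi_eq_integral_add_ray {u t x β : ℝ} (hβ : 0 < β) (hβν : besselIndex u = β + 1 / 2)
    (lam : ℝ) (ht : 0 < t) (hx : 0 < x) {A : ℝ} (hA : 0 < A) :
    phi u lam (t, x) = outerFactor u t x * ((∫ z in (0 : ℝ)..A, pathIntegrand β t x lam z) +
      rot * ∫ r in Ioi (0 : ℝ), pathIntegrand β t x lam (A + rot * r)) := by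
  rw [phi_eq_outerFactor_mul hβν lam ht hx]
  congr 1
  have h0 := tendsto_integral_pathIntegrand_shift (lam := lam) hβ ht hx le_rfl
  simp only [Complex.ofReal_zero, zero_add] at h0
  have h1 := ((tendsto_integral_pathIntegrand_shift (lam := lam) hβ ht hx hA.le).comp
    (tendsto_atTop_add_const_right atTop (-A) tendsto_id)).const_add
    (∫ z in (0 : ℝ)..A, pathIntegrand β t x lam z)
  refine tendsto_nhds_unique h0 (h1.congr' ?_)
  filter_upwards [eventually_ge_atTop A] with R hR
  have hint : ∀ a b : ℝ, 0 ≤ a → 0 ≤ b →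
      IntervalIntegrable (fun z : ℝ => pathIntegrand β t x lam z) volume a b := by
    intro a b ha hb
    refine ContinuousOn.intervalIntegrable ((continuousOn_pathIntegrand hβ).comp
      Complex.continuous_ofReal.continuousOn fun z hz => ?_)
    have : 0 ≤ z := (le_min ha hb).trans hz.1
    simpa using this
  have hshift := intervalIntegral.integral_comp_add_left (a := 0) (b := R + -A)
    (fun z : ℝ => pathIntegrand β t x lam z) A
  simp only [Complex.ofReal_add] at hshift
  simp only [Function.comp_apply, id]
  rw [hshift, add_zero, show A + (R + -A) = R by ring,
    intervalIntegral.integral_add_adjacent_intervals (hint 0 A le_rfl hA.le)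
      (hint A R hA.le (hA.le.trans hR))]

/-- The hypothesis `hgap` says that `A` lies to the right of the stationary point `x - λt`, by a
distance of order one. -/
lemma norm_integral_ray_le {β t x lam C A : ℝ} (hC : 0 ≤ C)
    (hE : ∀ z : ℂ, |z.im| ≤ z.re →
      ‖z‖ ^ (β + 1) * ‖besselE (β + 1 / 2) z‖ ≤ C * Real.exp |z.im|)
    (ht : 0 < t) (hx : 0 < x) (hA : 0 ≤ A) (hgap : 1 / (4 * t) ≤ (A - x) / t - |lam|) :
    ‖rot * ∫ r in Ioi (0 : ℝ), pathIntegrand β t x lam (A + rot * r)‖ ≤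
      (t / x) ^ (β + 1) * (C * (8 * t)) := by
  set b := 1 / (8 * t) with hb
  have hb0 : 0 < b := by positivity
  have hs : (1 : ℝ) / 2 ≤ Real.sqrt 2 / 2 := by
    have : (1 : ℝ) ≤ Real.sqrt 2 := by rw [Real.one_le_sqrt]; norm_num
    linarith
  have hpt : ∀ r ∈ Ioi (0 : ℝ), ‖pathIntegrand β t x lam (A + rot * r)‖ ≤
      C * (t / x) ^ (β + 1) * Real.exp (-b * r) := by
    intro r hr
    have hr : 0 < r := hr
    refine (norm_pathIntegrand_ray_le hE ht hx hA hr.le).trans ?_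
    refine mul_le_mul_of_nonneg_left (Real.exp_le_exp.2 ?_) (by positivity)
    have h1 : b ≤ Real.sqrt 2 / 2 * ((A - x) / t - |lam|) := by
      calc b = 1 / 2 * (1 / (4 * t)) := by rw [hb]; field_simp; norm_num
        _ ≤ _ := by gcongr
    have h2 : 0 ≤ 1 / (2 * t) * r ^ 2 := by positivity
    have h3 := mul_le_mul_of_nonneg_right h1 hr.le
    linarith
  have hi := (integrableOn_exp_mul_Ioi (neg_neg_of_pos hb0) 0).const_mul (C * (t / x) ^ (β + 1))
  rw [norm_mul, norm_rot, one_mul]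
  refine (norm_integral_le_of_norm_le hi ((ae_restrict_iff' measurableSet_Ioi).2
    (Eventually.of_forall hpt))).trans_eq ?_
  rw [integral_const_mul, integral_exp_mul_Ioi (neg_neg_of_pos hb0), mul_zero, Real.exp_zero, hb]
  field_simp

/-- Replacing the Bessel function by its asymptotics changes the integral over `[0, A]` by little,
because `1 / (1 + w) ≤ w^(-3/4)`. -/
lemma norm_integral_sub_le {β t x C A : ℝ} (hβ : 0 < β) (lam : ℝ) (ht : 0 < t) (hx : 0 < x)
    (hA : 0 < A) (κ₁ κ₂ : ℂ) (hC : 0 ≤ C)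
    (hQ : ∀ w : ℝ, 0 < w → ‖((w ^ (β + 1) : ℝ) : ℂ) * besselE (β + 1 / 2) w -
      (κ₁ * Complex.exp (-(Complex.I * w)) + κ₂ * Complex.exp (Complex.I * w))‖ ≤ C / (1 + w)) :
    ‖(∫ z in (0 : ℝ)..A, pathIntegrand β t x lam z) - (((t / x) ^ (β + 1) : ℝ) : ℂ) *
      ∫ z in (0 : ℝ)..A, (κ₁ * Complex.exp (-(Complex.I * (x * z / t))) +
        κ₂ * Complex.exp (Complex.I * (x * z / t))) *
        Complex.exp (Complex.I * (z ^ 2 / (2 * t)) + Complex.I * lam * z)‖ ≤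
      (t / x) ^ (β + 1) * (C * ((t / x) ^ (3 / 4 : ℝ) * (4 * A ^ (1 / 4 : ℝ)))) := by
  have i1 : IntervalIntegrable (fun z : ℝ => pathIntegrand β t x lam z) volume 0 A := by
    refine ContinuousOn.intervalIntegrable ((continuousOn_pathIntegrand hβ).comp
      Complex.continuous_ofReal.continuousOn fun z hz => ?_)
    have : 0 ≤ z := (le_min le_rfl hA.le).trans hz.1
    simpa using this
  have i2 : IntervalIntegrable (fun z : ℝ => (((t / x) ^ (β + 1) : ℝ) : ℂ) *
      ((κ₁ * Complex.exp (-(Complex.I * (x * z / t))) +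
        κ₂ * Complex.exp (Complex.I * (x * z / t))) *
        Complex.exp (Complex.I * (z ^ 2 / (2 * t)) + Complex.I * lam * z))) volume 0 A :=
    Continuous.intervalIntegrable (by fun_prop) _ _
  rw [← intervalIntegral.integral_const_mul, ← intervalIntegral.integral_sub i1 i2]
  have i3 : IntervalIntegrable (fun z : ℝ => (t / x) ^ (β + 1) *
      (C * ((t / x) ^ (3 / 4 : ℝ) * z ^ (-(3 / 4) : ℝ)))) volume 0 A :=
    (((intervalIntegral.intervalIntegrable_rpow' (by norm_num)).const_mul
      _).const_mul _).const_mul _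
  have hle := intervalIntegral.norm_integral_le_of_norm_le (f := fun z : ℝ =>
      pathIntegrand β t x lam z - (((t / x) ^ (β + 1) : ℝ) : ℂ) *
      ((κ₁ * Complex.exp (-(Complex.I * (x * z / t))) +
        κ₂ * Complex.exp (Complex.I * (x * z / t))) *
        Complex.exp (Complex.I * (z ^ 2 / (2 * t)) + Complex.I * lam * z)))
    hA.le (Eventually.of_forall fun z hz => ?_) i3
  · refine hle.trans_eq ?_
    rw [intervalIntegral.integral_const_mul, intervalIntegral.integral_const_mul,
      intervalIntegral.integral_const_mul, integral_rpow (Or.inl (by norm_num)),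
      show (-(3 / 4) + 1 : ℝ) = 1 / 4 by norm_num, Real.zero_rpow (by norm_num)]
    ring
  · have hz0 : 0 < z := hz.1
    set w := x * z / t with hw
    have hw0 : 0 < w := by positivity
    have hexp : ‖Complex.exp (Complex.I * ((z : ℂ) ^ 2 / (2 * t)) + Complex.I * lam * z)‖ = 1 := by
      have e : Complex.I * ((z : ℂ) ^ 2 / (2 * t)) + Complex.I * lam * z =
          ((z ^ 2 / (2 * t) + lam * z : ℝ) : ℂ) * Complex.I := by push_cast; ring
      rw [e, Complex.norm_exp_ofReal_mul_I]
    have hwC : (x * z / t : ℂ) = (w : ℂ) := by rw [hw]; push_cast; ring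
    rw [pathIntegrand_ofReal ht hx hz0, ← hw, hwC, ← mul_sub, ← sub_mul, norm_mul, norm_mul, hexp,
      mul_one, Complex.norm_real, Real.norm_of_nonneg (by positivity)]
    refine mul_le_mul_of_nonneg_left ((hQ w hw0).trans ?_) (by positivity)
    have h1 : w ^ (3 / 4 : ℝ) ≤ 1 + w := by
      calc w ^ (3 / 4 : ℝ) ≤ (1 + w) ^ (3 / 4 : ℝ) := by gcongr; linarith
        _ ≤ (1 + w) ^ (1 : ℝ) :=
          Real.rpow_le_rpow_of_exponent_le (by linarith) (by norm_num)
        _ = 1 + w := Real.rpow_one _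
    have h2 : (t / x) ^ (3 / 4 : ℝ) * z ^ (-(3 / 4) : ℝ) = (w ^ (3 / 4 : ℝ))⁻¹ := by
      rw [hw, Real.rpow_neg hz0.le, ← Real.inv_rpow hz0.le, ← Real.inv_rpow (by positivity),
        ← Real.mul_rpow (by positivity) (by positivity)]
      congr 1
      field_simp
    rw [h2, div_eq_mul_inv]
    gcongr

/-- The contribution of the two exponentials, in terms of Fresnel functions. -/
lemma freeTerms_eq {t x : ℝ} (ht : 0 < t) (lam A : ℝ) (κ₁ κ₂ : ℂ) :
    (Complex.exp (Complex.I * (x ^ 2 / (2 * t))) * (((Real.sqrt t)⁻¹ : ℝ) : ℂ)) *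
      ∫ z in (0 : ℝ)..A, (κ₁ * Complex.exp (-(Complex.I * (x * z / t))) +
        κ₂ * Complex.exp (Complex.I * (x * z / t))) *
        Complex.exp (Complex.I * (z ^ 2 / (2 * t)) + Complex.I * lam * z) =
    freeTerm κ₁ lam A t (-x) + freeTerm κ₂ lam A t x := by
  rw [freeTerm, freeTerm, ← integral_exp_quadratic ht, ← integral_exp_quadratic ht,
    ← mul_assoc, ← mul_assoc, ← intervalIntegral.integral_const_mul,
    ← intervalIntegral.integral_const_mul, ← intervalIntegral.integral_const_mul,
    ← intervalIntegral.integral_add (Continuous.intervalIntegrable (by fun_prop) _ _)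
      (Continuous.intervalIntegrable (by fun_prop) _ _)]
  refine intervalIntegral.integral_congr fun z _ => ?_
  have e1 : Complex.exp (Complex.I * ((z : ℂ) ^ 2 / (2 * t) + (-x : ℝ) * z / t + lam * z +
      ((-x : ℝ) : ℂ) ^ 2 / (2 * t))) = Complex.exp (Complex.I * (x ^ 2 / (2 * t))) *
      (Complex.exp (-(Complex.I * (x * z / t))) *
        Complex.exp (Complex.I * (z ^ 2 / (2 * t)) + Complex.I * lam * z)) := by
    rw [← Complex.exp_add, ← Complex.exp_add]
    congr 1
    push_cast
    ring
  have e2 : Complex.exp (Complex.I * ((z : ℂ) ^ 2 / (2 * t) + x * z / t + lam * z +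
      (x : ℂ) ^ 2 / (2 * t))) = Complex.exp (Complex.I * (x ^ 2 / (2 * t))) *
      (Complex.exp (Complex.I * (x * z / t)) *
        Complex.exp (Complex.I * (z ^ 2 / (2 * t)) + Complex.I * lam * z)) := by
    rw [← Complex.exp_add, ← Complex.exp_add]
    congr 1
    ring
  simp only [e1, e2]
  ring

/-- Near `t = 0` the function `phi` is the sum of the free evolution and its reflection, up to an
error that vanishes with `t`. -/
lemma exists_norm_phi_sub_le {u β : ℝ} (hβ : 0 < β) (hβν : besselIndex u = β + 1 / 2)
    (lam : ℝ) {A : ℝ} (hA : 0 < A) :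
    ∃ κ₂ : ℂ, ∃ K : ℝ, ∀ t x : ℝ, 0 < t → 0 < x → 1 / (4 * t) ≤ (A - x) / t - |lam| →
      ‖phi u lam (t, x) - (freeTerm (greenConst u * (Complex.I * sideConst (-1) β)) lam A t (-x) +
        freeTerm κ₂ lam A t x)‖ ≤
        K * (t ^ (1 / 4 : ℝ) * (x ^ (3 / 4 : ℝ))⁻¹ + t ^ (1 / 2 : ℝ)) := by
  obtain ⟨C, hC, hE⟩ := exists_norm_rpow_mul_besselE_le hβ
  obtain ⟨C', hC', hQ⟩ := exists_norm_rpow_mul_besselE_sub_le hβ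
  set κ₁ := Complex.I * sideConst (-1) β with hκ₁
  set κ₂ := -(Complex.I * sideConst 1 β) with hκ₂
  have hQ' : ∀ w : ℝ, 0 < w → ‖((w ^ (β + 1) : ℝ) : ℂ) * besselE (β + 1 / 2) w -
      (κ₁ * Complex.exp (-(Complex.I * w)) + κ₂ * Complex.exp (Complex.I * w))‖ ≤
        C' / (1 + w) := by
    intro w hw
    have e : κ₁ * Complex.exp (-(Complex.I * w)) + κ₂ * Complex.exp (Complex.I * w) =
        Complex.I * (sideConst (-1) β * Complex.exp (-(Complex.I * w))) -
          Complex.I * (sideConst 1 β * Complex.exp (Complex.I * w)) := by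
      rw [hκ₁, hκ₂]; ring
    rw [e]
    exact hQ w hw
  set L := ‖greenConst u‖ with hL
  refine ⟨greenConst u * κ₂, L * (C' * (4 * A ^ (1 / 4 : ℝ)) + C * 8), fun t x ht hx hgap => ?_⟩
  have hR := norm_integral_ray_le hC hE ht hx hA.le hgap
  have hM := norm_integral_sub_le hβ lam ht hx hA κ₁ κ₂ hC' hQ'
  set M := ∫ z in (0 : ℝ)..A, (κ₁ * Complex.exp (-(Complex.I * (x * z / t))) +
        κ₂ * Complex.exp (Complex.I * (x * z / t))) *
        Complex.exp (Complex.I * (z ^ 2 / (2 * t)) + Complex.I * lam * z) with hMdef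
  set S := (t / x) ^ (β + 1) with hS
  have hS0 : 0 < S := by positivity
  have hfree : freeTerm (greenConst u * κ₁) lam A t (-x) + freeTerm (greenConst u * κ₂) lam A t x =
      outerFactor u t x * ((S : ℂ) * M) := by
    rw [← mul_assoc (outerFactor u t x), outerFactor_mul hβν ht hx, mul_assoc (greenConst u),
      freeTerms_eq ht]
    simp only [freeTerm]
    ring
  have hO : ‖outerFactor u t x‖ * S = L * (Real.sqrt t)⁻¹ := by
    have h := congrArg norm (outerFactor_mul hβν ht hx)
    have hexp : ‖Complex.exp (Complex.I * ((x : ℂ) ^ 2 / (2 * t)))‖ = 1 := by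
      have e : Complex.I * ((x : ℂ) ^ 2 / (2 * t)) = ((x ^ 2 / (2 * t) : ℝ) : ℂ) * Complex.I := by
        push_cast; ring
      rw [e, Complex.norm_exp_ofReal_mul_I]
    rw [norm_mul, norm_mul, norm_mul, hexp, one_mul, Complex.norm_real, Complex.norm_real,
      Real.norm_of_nonneg hS0.le, Real.norm_of_nonneg (by positivity)] at h
    exact h
  rw [hfree, phi_eq_integral_add_ray hβ hβν lam ht hx hA, ← mul_sub, norm_mul]
  have hsum : ‖(∫ z in (0 : ℝ)..A, pathIntegrand β t x lam z) +
      rot * (∫ r in Ioi (0 : ℝ), pathIntegrand β t x lam (A + rot * r)) - (S : ℂ) * M‖ ≤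
      S * (C' * ((t / x) ^ (3 / 4 : ℝ) * (4 * A ^ (1 / 4 : ℝ))) + C * (8 * t)) := by
    rw [add_sub_right_comm, mul_add]
    exact (norm_add_le _ _).trans (add_le_add hM hR)
  have hst : (Real.sqrt t)⁻¹ * (t / x) ^ (3 / 4 : ℝ) = t ^ (1 / 4 : ℝ) * (x ^ (3 / 4 : ℝ))⁻¹ := by
    rw [Real.div_rpow ht.le hx.le, Real.sqrt_eq_rpow, ← Real.rpow_neg ht.le,
      div_eq_mul_inv (t ^ (3 / 4 : ℝ)),
      ← mul_assoc, ← Real.rpow_add ht]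
    norm_num
  have hst2 : (Real.sqrt t)⁻¹ * t = t ^ (1 / 2 : ℝ) := by
    rw [← Real.sqrt_eq_rpow, inv_mul_eq_div, Real.div_sqrt]
  calc _ ≤ ‖outerFactor u t x‖ *
        (S * (C' * ((t / x) ^ (3 / 4 : ℝ) * (4 * A ^ (1 / 4 : ℝ))) + C * (8 * t))) := by gcongr
    _ = L * (C' * (4 * A ^ (1 / 4 : ℝ)) * ((Real.sqrt t)⁻¹ * (t / x) ^ (3 / 4 : ℝ)) +
        C * 8 * ((Real.sqrt t)⁻¹ * t)) := by
        rw [← mul_assoc, hO]; ring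
    _ = L * (C' * (4 * A ^ (1 / 4 : ℝ)) * (t ^ (1 / 4 : ℝ) * (x ^ (3 / 4 : ℝ))⁻¹) +
        C * 8 * t ^ (1 / 2 : ℝ)) := by rw [hst, hst2]
    _ ≤ _ := by
        have h1 : 0 ≤ C' * (4 * A ^ (1 / 4 : ℝ)) := by positivity
        have h2 : 0 ≤ t ^ (1 / 4 : ℝ) * (x ^ (3 / 4 : ℝ))⁻¹ := by positivity
        have h3 : 0 ≤ t ^ (1 / 2 : ℝ) := by positivity
        rw [mul_assoc L]
        refine mul_le_mul_of_nonneg_left ?_ (norm_nonneg _)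
        nlinarith [mul_nonneg h1 h3, mul_nonneg (mul_nonneg hC (by norm_num : (0 : ℝ) ≤ 8)) h2]

/-- The constants of the Green function, of the Bessel asymptotics and of the Fresnel integral over
the whole line cancel. -/
lemma greenConst_mul_sideConst {u β : ℝ} (hβν : besselIndex u = β + 1 / 2) :
    greenConst u * (Complex.I * sideConst (-1) β) *
      (((Real.sqrt 2 : ℝ) : ℂ) * (2 * (rot * (Real.sqrt Real.pi / 2 : ℝ)))) = 1 := by
  have hlog1 : Complex.log Complex.I = Real.pi / 2 * Complex.I := Complex.log_I
  have e1 : (-Complex.I) ^ ((besselIndex u : ℂ) + 1) =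
      Complex.exp (-(Real.pi / 2 * Complex.I) * (β + 1 / 2 + 1)) := by
    rw [Complex.cpow_def_of_ne_zero (neg_ne_zero.2 Complex.I_ne_zero), Complex.log_neg_I, hβν]
    push_cast
    ring_nf
  have e2 : (-(((-1 : ℝ) : ℂ) * Complex.I)) ^ (β : ℂ) =
      Complex.exp (Real.pi / 2 * Complex.I * β) := by
    rw [show -(((-1 : ℝ) : ℂ) * Complex.I) = Complex.I by push_cast; ring,
      Complex.cpow_def_of_ne_zero Complex.I_ne_zero, hlog1]
  have e3 : Complex.I = Complex.exp (Real.pi / 2 * Complex.I) :=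
    Complex.exp_pi_div_two_mul_I.symm
  have e4 : Complex.exp (-(Real.pi / 2 * Complex.I) * (β + 1 / 2 + 1)) *
      (Complex.exp (Real.pi / 2 * Complex.I) * Complex.exp (Real.pi / 2 * Complex.I * β)) *
        rot = 1 := by
    rw [rot, ← Complex.exp_add, ← Complex.exp_add, ← Complex.exp_add]
    convert Complex.exp_zero using 2
    ring
  have hpow : (2 : ℝ) ^ besselIndex u = 2 ^ β * Real.sqrt 2 := by
    rw [hβν, Real.rpow_add two_pos, Real.sqrt_eq_rpow]
  have h2 : (((2 : ℝ) ^ β : ℝ) : ℂ) ≠ 0 := by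
    exact_mod_cast (Real.rpow_pos_of_pos two_pos β).ne'
  have h3 : ((Real.sqrt 2 : ℝ) : ℂ) ≠ 0 := by
    exact_mod_cast (Real.sqrt_pos.2 (two_pos (α := ℝ))).ne'
  have h4 : ((Real.sqrt Real.pi : ℝ) : ℂ) ≠ 0 := by
    exact_mod_cast (Real.sqrt_pos.2 Real.pi_pos).ne'
  rw [greenConst, sideConst, e1, e2, hpow, Complex.ofReal_mul, Complex.ofReal_div,
    Complex.ofReal_ofNat]
  generalize (((2 : ℝ) ^ β : ℝ) : ℂ) = b at *
  generalize ((Real.sqrt 2 : ℝ) : ℂ) = s at *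
  generalize ((Real.sqrt Real.pi : ℝ) : ℂ) = q at *
  rw [← e3] at e4
  generalize Complex.exp (-(Real.pi / 2 * Complex.I) * (β + 1 / 2 + 1)) = v at *
  generalize Complex.exp (Real.pi / 2 * Complex.I * β) = v' at *
  field_simp
  linear_combination e4

/-- The initial value of `phi`. -/
theorem tendsto_phi {u : ℝ} (hu : 0 < u) (lam : ℝ) {x₀ : ℝ} (hx₀ : 0 < x₀) :
    Tendsto (phi u lam) (𝓝[>] (0 : ℝ) ×ˢ 𝓝 x₀) (𝓝 (Complex.exp (Complex.I * lam * x₀))) := by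
  have hβ : 0 < besselIndex u - 1 / 2 := by linarith [half_lt_besselIndex hu]
  have hβν : besselIndex u = (besselIndex u - 1 / 2) + 1 / 2 := by ring
  set β := besselIndex u - 1 / 2 with hβdef
  have hA : 0 < x₀ + 1 := by linarith
  obtain ⟨κ₂, K, hK⟩ := exists_norm_phi_sub_le hβ hβν lam hA
  set l := 𝓝[>] (0 : ℝ) ×ˢ 𝓝 x₀ with hl
  have ht : Tendsto (fun p : ℝ × ℝ => p.1) l (𝓝[>] 0) := tendsto_fst
  have ht0 : Tendsto (fun p : ℝ × ℝ => p.1) l (𝓝 0) := ht.mono_right nhdsWithin_le_nhds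
  have hx : Tendsto (fun p : ℝ × ℝ => p.2) l (𝓝 x₀) := tendsto_snd
  have htpos : ∀ᶠ p : ℝ × ℝ in l, 0 < p.1 := ht.eventually self_mem_nhdsWithin
  have hxpos : ∀ᶠ p : ℝ × ℝ in l, 0 < p.2 := hx.eventually (lt_mem_nhds hx₀)
  have hxlt : ∀ᶠ p : ℝ × ℝ in l, p.2 < x₀ + 1 / 2 := hx.eventually (gt_mem_nhds (by linarith))
  have htlam : ∀ᶠ p : ℝ × ℝ in l, |lam| * p.1 < 1 / 4 := by
    have h1 := ht0.const_mul |lam|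
    rw [mul_zero] at h1
    exact h1.eventually (gt_mem_nhds (by norm_num))
  have herr : Tendsto (fun p : ℝ × ℝ => phi u lam p -
      (freeTerm (greenConst u * (Complex.I * sideConst (-1) β)) lam (x₀ + 1) p.1 (-p.2) +
        freeTerm κ₂ lam (x₀ + 1) p.1 p.2)) l (𝓝 0) := by
    refine squeeze_zero_norm' (a := fun p : ℝ × ℝ =>
      K * (p.1 ^ (1 / 4 : ℝ) * (p.2 ^ (3 / 4 : ℝ))⁻¹ + p.1 ^ (1 / 2 : ℝ))) ?_ ?_
    · filter_upwards [htpos, hxpos, hxlt, htlam] with p h1 h2 h3 h4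
      refine hK p.1 p.2 h1 h2 ?_
      rw [div_sub' h1.ne', div_le_div_iff₀ (by positivity) h1]
      nlinarith
    · have h1 : Tendsto (fun p : ℝ × ℝ => p.1 ^ (1 / 4 : ℝ)) l (𝓝 0) := by
        have := ht0.rpow_const (p := (1 / 4 : ℝ)) (Or.inr (by norm_num))
        rwa [Real.zero_rpow (by norm_num)] at this
      have h2 : Tendsto (fun p : ℝ × ℝ => p.1 ^ (1 / 2 : ℝ)) l (𝓝 0) := by
        have := ht0.rpow_const (p := (1 / 2 : ℝ)) (Or.inr (by norm_num))
        rwa [Real.zero_rpow (by norm_num)] at this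
      have h3 := (hx.rpow_const (p := (3 / 4 : ℝ)) (Or.inl hx₀.ne')).inv₀
        (Real.rpow_pos_of_pos hx₀ _).ne'
      simpa using ((h1.mul h3).add h2).const_mul K
  -- the arguments of the Fresnel functions tend to `±∞` because `√(2t) → 0+`
  have hsqrt : Tendsto (fun p : ℝ × ℝ => (Real.sqrt (2 * p.1))⁻¹) l atTop := by
    refine tendsto_inv_nhdsGT_zero.comp (tendsto_nhdsWithin_iff.2 ⟨?_, ?_⟩)
    · have h1 := (ht0.const_mul 2).sqrt
      simpa using h1
    · filter_upwards [htpos] with p hp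
      exact Real.sqrt_pos.2 (by linarith)
  have harg : ∀ (c : ℝ → ℝ) (c₀ : ℝ), Tendsto (fun p : ℝ × ℝ => c p.2) l (𝓝 c₀) →
      Tendsto (fun p : ℝ × ℝ => c p.2 + lam * p.1) l (𝓝 c₀) := by
    intro c c₀ hc
    simpa using hc.add (ht0.const_mul lam)
  have htop : ∀ (c : ℝ → ℝ) (c₀ : ℝ), 0 < c₀ → Tendsto (fun p : ℝ × ℝ => c p.2) l (𝓝 c₀) →
      Tendsto (fun p : ℝ × ℝ => fresnel ((c p.2 + lam * p.1) / Real.sqrt (2 * p.1))) l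
        (𝓝 (rot * (Real.sqrt Real.pi / 2 : ℝ))) := by
    intro c c₀ hc₀ hc
    simp only [div_eq_mul_inv _ (Real.sqrt _)]
    exact tendsto_fresnel_atTop.comp ((harg c c₀ hc).pos_mul_atTop hc₀ hsqrt)
  have hbot : Tendsto (fun p : ℝ × ℝ => fresnel ((-p.2 + lam * p.1) / Real.sqrt (2 * p.1))) l
        (𝓝 (-(rot * (Real.sqrt Real.pi / 2 : ℝ)))) := by
    simp only [div_eq_mul_inv _ (Real.sqrt _)]
    exact tendsto_fresnel_atBot.comp
      ((harg (fun x => -x) (-x₀) hx.neg).neg_mul_atTop (by linarith) hsqrt)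
  have hphase : ∀ s : ℝ, Tendsto (fun p : ℝ × ℝ =>
      Complex.exp (Complex.I * (-(lam * (s * p.2 : ℝ)) - lam ^ 2 * p.1 / 2))) l
      (𝓝 (Complex.exp (Complex.I * (-(lam * (s * x₀ : ℝ)) - lam ^ 2 * (0 : ℝ) / 2)))) := by
    intro s
    have hF : Continuous fun p : ℝ × ℝ =>
        Complex.exp (Complex.I * (-(lam * (s * p.2 : ℝ)) - lam ^ 2 * p.1 / 2)) := by fun_prop
    exact (hF.tendsto (0, x₀)).comp (ht0.prodMk_nhds hx)
  -- here the stationary point separates the arguments, and the whole Fresnel integral remains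
  have hm1 : Tendsto (fun p : ℝ × ℝ =>
      freeTerm (greenConst u * (Complex.I * sideConst (-1) β)) lam (x₀ + 1) p.1 (-p.2)) l
      (𝓝 (Complex.exp (Complex.I * lam * x₀))) := by
    have h1 := htop (fun x => x₀ + 1 + -x) 1 one_pos (by
      have := hx.neg.const_add (x₀ + 1)
      rwa [show x₀ + 1 + -x₀ = 1 by ring] at this)
    have h2 := (((hphase (-1)).mul_const ((Real.sqrt 2 : ℝ) : ℂ)).mul (h1.sub hbot)).const_mul
      (greenConst u * (Complex.I * sideConst (-1) β))
    simp only [neg_one_mul] at h2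
    have hval : greenConst u * (Complex.I * sideConst (-1) β) *
        (Complex.exp (Complex.I * (-(lam * ((-x₀ : ℝ) : ℂ)) - lam ^ 2 * ((0 : ℝ) : ℂ) / 2)) *
          ((Real.sqrt 2 : ℝ) : ℂ) * (rot * ((Real.sqrt Real.pi / 2 : ℝ) : ℂ) -
            -(rot * ((Real.sqrt Real.pi / 2 : ℝ) : ℂ)))) =
        Complex.exp (Complex.I * lam * x₀) := by
      have e : Complex.I * (-(lam * ((-x₀ : ℝ) : ℂ)) - lam ^ 2 * ((0 : ℝ) : ℂ) / 2) =
          Complex.I * lam * x₀ := by push_cast; ring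
      rw [e]
      linear_combination Complex.exp (Complex.I * lam * x₀) * greenConst_mul_sideConst hβν
    rw [hval] at h2
    exact h2
  -- both Fresnel functions of the reflected term have the same limit
  have hm2 : Tendsto (fun p : ℝ × ℝ => freeTerm κ₂ lam (x₀ + 1) p.1 p.2) l (𝓝 0) := by
    have h1 := htop (fun x => x₀ + 1 + x) (x₀ + 1 + x₀) (by linarith) (hx.const_add (x₀ + 1))
    have h2 := htop (fun x => x) x₀ hx₀ hx
    have h3 := (((hphase 1).mul_const ((Real.sqrt 2 : ℝ) : ℂ)).mul (h1.sub h2)).const_mul κ₂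
    simp only [one_mul, sub_self, mul_zero] at h3
    exact h3
  have hfinal := herr.add (hm1.add hm2)
  simp only [sub_add_cancel, zero_add, add_zero] at hfinal
  exact hfinal

/-! ### Convergence of the superoscillating solutions -/

lemma iterate_dt_congr {f g : ℝ × ℝ → ℂ} (h : EqOn f g quadrant) (m : ℕ) :
    EqOn (dt^[m] f) (dt^[m] g) quadrant := by
  induction m with
  | zero => exact h
  | succ m ih => simp only [Function.iterate_succ_apply']; exact EqOn.dt ih

lemma smoothQ_phi (u lam : ℝ) : SmoothQ (phi u lam) :=
  (fresnelOp_evolve u).smoothQ (expBounded_planeWave lam)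

lemma schrodinger_phi {u : ℝ} (hu : 0 < u) (lam : ℝ) {p : ℝ × ℝ} (hp : p ∈ quadrant) :
    Complex.I * dt (phi u lam) p = hamiltonian u (phi u lam) p :=
  schrodinger_evolve hu (expBounded_planeWave lam) hp

lemma smoothQ_psi (u a : ℝ) {N : ℕ} (hN : 1 ≤ N) : SmoothQ (psi u a N) :=
  ((fresnelOp_evolve u).smoothQ (expBounded_superosc a hN)).congr (psi_eq_evolve u a N).symm

lemma schrodinger_psi {u : ℝ} (hu : 0 < u) (a : ℝ) {N : ℕ} (hN : 1 ≤ N) {p : ℝ × ℝ}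
    (hp : p ∈ quadrant) : Complex.I * dt (psi u a N) p = hamiltonian u (psi u a N) p := by
  have h := psi_eq_evolve u a N
  rw [hamiltonian, EqOn.dt h hp, EqOn.dx (EqOn.dx h) hp, h hp]
  exact schrodinger_evolve hu (expBounded_superosc a hN) hp

/-- Whatever is built from the evolution by a Fresnel operator passes to the limit along the
superoscillating sequence. -/
lemma FresnelOp.tendstoUniformlyOn_superosc {T : (ℂ → ℂ) → ℝ × ℝ → ℂ} (hT : FresnelOp T) (a : ℝ)
    {K : Set (ℝ × ℝ)} (hK : IsCompact K) (hKq : K ⊆ quadrant) :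
    TendstoUniformlyOn (fun N => T (superosc a N)) (T (planeWave a)) atTop K := by
  refine hT.tendstoUniformlyOn (A := 1) (B := max (|(1 + a) / 2| + |(1 - a) / 2|) |a|)
    ?_ ((expBounded_planeWave a).mono le_rfl (le_max_right _ _)) (tendsto_superosc a) hK hKq
  filter_upwards [eventually_ge_atTop 1] with N hN
  exact (expBounded_superosc a hN).mono le_rfl (le_max_left _ _)

theorem tendstoUniformlyOn_iterate_dt_iterate_dx_psi (u a : ℝ) (m n : ℕ) {K : Set (ℝ × ℝ)}
    (hK : IsCompact K) (hKq : K ⊆ quadrant) :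
    TendstoUniformlyOn (fun N : ℕ => dt^[m] (dx^[n] (psi u a N)))
      (dt^[m] (dx^[n] (phi u a))) atTop K := by
  have hT : FresnelOp fun Y => dt^[m] (dx^[n] (evolve u Y)) :=
    FresnelOp.iterate FresnelOp.dt (FresnelOp.iterate FresnelOp.dx (fresnelOp_evolve u) n) m
  refine (hT.tendstoUniformlyOn_superosc a hK hKq).congr (Eventually.of_forall fun N p hp => ?_)
  exact (iterate_dt_congr ((isTimeInvariant_dx.iterate n).congr (psi_eq_evolve u a N)) m
    (hKq hp)).symm

theorem tendstoUniformlyOn_iterate_centrifugalOp_iterate_dx_psi (u a : ℝ) (m n : ℕ)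
    {K : Set (ℝ × ℝ)} (hK : IsCompact K) (hKq : K ⊆ quadrant) :
    TendstoUniformlyOn (fun (N : ℕ) (p : ℝ × ℝ) => 1 / (2 * Complex.I) ^ m *
        ((centrifugalOp u)^[m] (dx^[n] (psi u a N))) p)
      (fun p => 1 / (2 * Complex.I) ^ m * ((centrifugalOp u)^[m] (dx^[n] (phi u a))) p)
      atTop K := by
  have hT : FresnelOp fun Y p => 1 / (2 * Complex.I) ^ m *
      ((centrifugalOp u)^[m] (dx^[n] (evolve u Y))) p :=
    (FresnelOp.iterate (fun h => h.centrifugalOp u)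
      (FresnelOp.iterate FresnelOp.dx (fresnelOp_evolve u) n) m).mul_left (smoothQ_const _)
  refine (hT.tendstoUniformlyOn_superosc a hK hKq).congr (Eventually.of_forall fun N p hp => ?_)
  simp only
  rw [((isTimeInvariant_centrifugalOp u).iterate m).congr
    ((isTimeInvariant_dx.iterate n).congr (psi_eq_evolve u a N)) (hKq hp)]

theorem isSupershift_psi (u : ℝ) {a : ℝ} (ha : a ∉ Icc (-1 : ℝ) 1) :
    IsSupershift (fun (lam : ℝ) (τ : quadrant) => phi u lam τ)
      (fun (N : ℕ) (τ : quadrant) => psi u a N τ) univ where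
  combination := by
    refine ⟨fun N j => coeff N j a, fun N j => 1 - 2 * (j : ℝ) / N, fun N hN =>
      ⟨fun j hj => ?_, rfl⟩⟩
    have hN0 : (0 : ℝ) < N := by exact_mod_cast hN
    have hj : (j : ℝ) / N ≤ 1 := (div_le_one hN0).2 (by exact_mod_cast hj)
    have hj0 : 0 ≤ (j : ℝ) / N := by positivity
    simp only
    rw [abs_le, mul_div_assoc]
    constructor <;> linarith
  isOpen_domain := isOpen_univ
  limit := by
    refine ⟨a, {1}, fun _ => 1, ha, by simp, ?_⟩
    rw [tendstoLocallyUniformlyOn_iff_forall_isCompact isOpen_univ]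
    intro K _ hK
    have h := tendstoUniformlyOn_iterate_dt_iterate_dx_psi u a 0 0
      (hK.image continuous_subtype_val) (by rintro _ ⟨τ, _, rfl⟩; exact τ.2)
    simp only [Function.iterate_zero, id_eq] at h
    simp only [Finset.sum_singleton, Int.cast_one, one_mul]
    exact (h.comp Subtype.val).mono (subset_preimage_image _ _)

end Centrifugal

end

theorem mainTheorem4 (u : ℝ) (hu : 0 < u) :
    -- the evolution of the data `exp(iλx)` through the Green function
    (∀ lam : ℝ,
      (∀ t x : ℝ, 0 < t → 0 < x →
        Tendsto (fun R : ℝ => ∫ x' in (0 : ℝ)..R,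
            Centrifugal.green u t x x' * Complex.exp (Complex.I * lam * x'))
          atTop (𝓝 (Centrifugal.phi u lam (t, x)))) ∧
      ContDiffOn ℝ ((⊤ : ℕ∞) : WithTop ℕ∞) (Centrifugal.phi u lam) Centrifugal.quadrant ∧
      Centrifugal.SolvesCauchy u (fun x => Complex.exp (Complex.I * lam * x))
        (Centrifugal.phi u lam)) ∧
    ∀ a : ℝ, a ∉ Icc (-1 : ℝ) 1 →
      -- the supershift property on the whole quadrant
      Centrifugal.IsSupershift
        (fun (lam : ℝ) (τ : Centrifugal.quadrant) => Centrifugal.phi u lam τ)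
        (fun (N : ℕ) (τ : Centrifugal.quadrant) => Centrifugal.psi u a N τ) univ ∧
      -- mixed derivatives, and their uniform convergence on compact sets
      ∀ m n : ℕ,
        (∀ N : ℕ, 1 ≤ N → ∀ p ∈ Centrifugal.quadrant,
          (Centrifugal.dt^[m] (Centrifugal.dx^[n] (Centrifugal.psi u a N))) p =
            1 / (2 * Complex.I) ^ m *
              (Centrifugal.dx^[n] ((Centrifugal.centrifugalOp u)^[m]
                (Centrifugal.psi u a N))) p) ∧
        (∀ p ∈ Centrifugal.quadrant,
          (Centrifugal.dt^[m] (Centrifugal.dx^[n] (Centrifugal.phi u a))) p =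
            1 / (2 * Complex.I) ^ m *
              (Centrifugal.dx^[n] ((Centrifugal.centrifugalOp u)^[m]
                (Centrifugal.phi u a))) p) ∧
        ∀ K : Set (ℝ × ℝ), IsCompact K → K ⊆ Centrifugal.quadrant →
          TendstoUniformlyOn
            (fun N : ℕ => Centrifugal.dt^[m] (Centrifugal.dx^[n] (Centrifugal.psi u a N)))
            (Centrifugal.dt^[m] (Centrifugal.dx^[n] (Centrifugal.phi u a))) atTop K ∧
          TendstoUniformlyOn
            (fun (N : ℕ) (p : ℝ × ℝ) => 1 / (2 * Complex.I) ^ m *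
              ((Centrifugal.centrifugalOp u)^[m]
                (Centrifugal.dx^[n] (Centrifugal.psi u a N))) p)
            (fun p : ℝ × ℝ => 1 / (2 * Complex.I) ^ m *
              ((Centrifugal.centrifugalOp u)^[m]
                (Centrifugal.dx^[n] (Centrifugal.phi u a))) p) atTop K := by
  refine ⟨fun lam => ⟨fun t x ht hx => Centrifugal.tendsto_integral_green hu lam ht hx,
    Centrifugal.smoothQ_phi u lam, fun p hp => Centrifugal.schrodinger_phi hu lam hp,
    fun x₀ hx₀ => Centrifugal.tendsto_phi hu lam hx₀⟩, fun a ha =>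
    ⟨Centrifugal.isSupershift_psi u ha, fun m n => ⟨fun N hN p hp => ?_, fun p hp => ?_,
      fun K hK hKq =>
        ⟨Centrifugal.tendstoUniformlyOn_iterate_dt_iterate_dx_psi u a m n hK hKq,
          Centrifugal.tendstoUniformlyOn_iterate_centrifugalOp_iterate_dx_psi u a m n hK hKq⟩⟩⟩⟩
  · exact Centrifugal.iterate_dt_iterate_dx_of_schrodinger (Centrifugal.smoothQ_psi u a hN)
      (fun q hq => Centrifugal.schrodinger_psi hu a hN hq) m n hp
  · exact Centrifugal.iterate_dt_iterate_dx_of_schrodinger (Centrifugal.smoothQ_phi u a)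
      (fun q hq => Centrifugal.schrodinger_phi hu a hq) m n hp
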